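/- Let $V$ be a holomorphic vector bundle of rank $\alpha$ on $\mathbb P^1$, let $\nabla:V\to\Omega^1_{\mathbb P^1}(D)\otimes V$ be a meromorphic connection with pole divisor $D=\sum_i m_ic_i$, $m_i>0$, and put $C=\{c_i\}$. Let $\nabla^*$ be the dual connection on $V^*$, given by $\langle\nabla^*\delta,\omega\rangle=d\langle\delta,\omega\rangle-\langle\delta,\nabla\omega\rangle$. Assume that $\nabla$ is regular, i.e. at each $c_i$ every flat section of $V^*$ in a sector with vertex $c_i$ has, in a trivialization of $V^*$ around $c_i$, at most polynomial growth near $c_i$. Let $t$ be the affine coordinate on $\mathbb C=\mathbb P^1\setminus\{\infty\}$ and write $\nabla$ also for $\nabla_{\partial/\partial t}$. Let $Z\subset\mathbb C$ be a finite set, $X=\mathbb C\setminus(C\cup Z)$, and let $$\psi:\quad Y^{(\alpha)}+\sum_{k=0}^{\alpha-1}a_k(t)\,Y^{(k)}=0$$ be a linear differential equation with coefficients $a_k$ holomorphic on $X$ such that: 1. $\psi$ is regular at every point of $C\cup Z\cup\{\infty\}$: solutions in a sector with vertex at the point have at most polynomial growth near it; 2. the points of $Z$ are (at most) apparent singularities: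 near each $z\in Z$ there is an $\alpha$-dimensional space of solutions that are holomorphic at $z$ too; 3. near $\infty$ the solutions form an $\alpha$-dimensional space of single-valued functions that are meromorphic at $\infty$; 4. $\psi$ has the same monodromy representation as $\nabla^*$: for a base point $b\in X$ there are a basis $e_1,\dots,e_\alpha$ of solutions of $\psi$ near $b$ and a basis $\delta_1,\dots,\delta_\alpha$ of flat sections of $V^*$ near $b$ which have the same monodromy matrix along every loop in $X$ based at $b$. Then there is a global meromorphic section $\omega$ of $V$ with poles in $C\cup\{\infty\}$ such that $\psi$ is the Picard–Fuchs equation of $\omega$. That is, on $X$: * for every local basis $\delta_1,\dots,\delta_\alpha$ of flat sections of $V^*$ (on a connected open subset of $X$), the Wronskian $W=\det\big[\langle\delta_j,\nabla^i\omega\rangle\big]_{0\le i\le\alpha-1,\,1\le j\le\alpha}$ has no zero, and $$a_k=(-1)^{\alpha-k}\,\frac{\det\big[\langle\delta_j,\nabla^i\omega\rangle\big]_{0\le i\le\alpha,\ i\ne k;\ 1\le j\le\alpha}}{W},\qquad 0\le k\le\alpha-1;$$ * on every open subset of $X$ the holomorphic solutions of $\psi$ are exactly the functions $\langle\delta,\omega\rangle$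 with $\delta$ a flat section of $V^*$. -/

import Mathlib

open Filter Topology Set

noncomputable section

namespace P1Connection

/-! ### Local coordinates on the Riemann sphere `OnePoint ℂ` -/

/-- The affine coordinate `t` expressed through the standard local coordinate `z` at the point `p`
of the Riemann sphere: `t = c + z` at a finite point `c`, and `t = 1 / z` at `∞`. -/
def aff (p : OnePoint ℂ) (z : ℂ) : ℂ := OnePoint.elim p z⁻¹ (fun c => c + z)

open Classical in
/-- The point of the Riemann sphere with local coordinate `z` at `p` (so `z = 0` is `p`). -/
def loc (p : OnePoint ℂ) (z : ℂ) : OnePoint ℂ := if z = 0 then p else ((aff p z : ℂ) : OnePoint ℂ)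

/-- The sector with vertex `0`, radius `r`, bounded by the angles `θ₁` and `θ₂`. -/
def sector (r θ₁ θ₂ : ℝ) : Set ℂ :=
  {z | ∃ ρ φ : ℝ, 0 < ρ ∧ ρ < r ∧ θ₁ < φ ∧ φ < θ₂ ∧ z = (ρ : ℂ) * Complex.exp (φ * Complex.I)}

/-- At most polynomial growth (in `1 / |z|`) of `f` as `z → 0` inside `S`. -/
def PolynomialGrowth {G : Type*} [NormedAddCommGroup G] (S : Set ℂ) (f : ℂ → G) : Prop :=
  ∃ (K : ℝ) (N : ℕ) (ε : ℝ), 0 < ε ∧ ∀ z ∈ S, ‖z‖ < ε → ‖f z‖ ≤ K * (‖z‖⁻¹) ^ N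

/-! ### Holomorphic vector bundles on the Riemann sphere, meromorphic connections -/

section Bundles

variable {F ι : Type*} [NormedAddCommGroup F] [NormedSpace ℂ F]

/-- A vector bundle on the Riemann sphere, given by its cocycle of transition functions over an
open cover, is holomorphic if all transition functions are holomorphic. -/
def IsHolomorphic (V : VectorBundleCore ℂ (OnePoint ℂ) F ι) : Prop :=
  ∀ i j, ∀ p ∈ V.baseSet i ∩ V.baseSet j,
    AnalyticAt ℂ (fun z : ℂ => V.coordChange i j (loc p z)) 0

/-- A (local) section `s` of `V` over a subset of `ℂ` is recorded by the elements `s t` of the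
fibres, `V.Fiber t` being `F` through the preferred trivialization at `t`.
`rep V i s` is the expression of `s` in the `i`-th trivialization. -/
def rep (V : VectorBundleCore ℂ (OnePoint ℂ) F ι) (i : ι) (s : ℂ → F) (t : ℂ) : F :=
  V.coordChange (V.indexAt (t : OnePoint ℂ)) i (t : OnePoint ℂ) (s t)

/-- A meromorphic connection on `V` with pole divisor `D`. In the `i`-th trivialization
`∇ s = ds + A i s dt`, where `A i dt` is a matrix of `1`-forms, holomorphic off the support of `D`
and with a pole of order at most `D p` at each point `p`; on overlaps the `A i` are related by the
gauge transformation rule. (The value of `A i` at points of `D.support` and at `∞` is not used.) -/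
structure MeromorphicConnection (V : VectorBundleCore ℂ (OnePoint ℂ) F ι)
    (D : OnePoint ℂ →₀ ℕ) where
  A : ι → ℂ → (F →L[ℂ] F)
  analytic : ∀ i, ∀ t : ℂ, (t : OnePoint ℂ) ∈ V.baseSet i → (t : OnePoint ℂ) ∉ D.support →
    AnalyticAt ℂ (A i) t
  pole : ∀ i, ∀ p ∈ V.baseSet i, ∃ B : ℂ → (F →L[ℂ] F), AnalyticAt ℂ B 0 ∧
    ∀ᶠ z in 𝓝[≠] (0 : ℂ), z ^ (D p) • (deriv (aff p) z • A i (aff p z)) = B z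
  gauge : ∀ i j, ∀ t : ℂ, (t : OnePoint ℂ) ∈ V.baseSet i ∩ V.baseSet j →
    (t : OnePoint ℂ) ∉ D.support →
    (V.coordChange i j (t : OnePoint ℂ)).comp (A i t) =
      (A j t).comp (V.coordChange i j (t : OnePoint ℂ)) +
        deriv (fun τ : ℂ => V.coordChange i j (τ : OnePoint ℂ)) t

/-- A global meromorphic section of `V` with poles in `D.support ∪ {∞}`. -/
def IsMeromorphicSection (V : VectorBundleCore ℂ (OnePoint ℂ) F ι) (D : OnePoint ℂ →₀ ℕ)
    (ω : ℂ → F) : Prop :=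
  (∀ i, ∀ t : ℂ, (t : OnePoint ℂ) ∈ V.baseSet i → (t : OnePoint ℂ) ∉ D.support →
    AnalyticAt ℂ (rep V i ω) t) ∧
  ∀ i, ∀ p ∈ V.baseSet i, (p ∈ D.support ∨ p = OnePoint.infty) →
    MeromorphicAt (fun z : ℂ => rep V i ω (aff p z)) 0

variable {V : VectorBundleCore ℂ (OnePoint ℂ) F ι} {D : OnePoint ℂ →₀ ℕ}

/-- The covariant derivative along `∂/∂t` of a section (meaningful off `D.support ∪ {∞}`). -/
def MeromorphicConnection.nabla (conn : MeromorphicConnection V D) (s : ℂ → F) (t : ℂ) : F :=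
  deriv (rep V (V.indexAt (t : OnePoint ℂ)) s) t + conn.A (V.indexAt (t : OnePoint ℂ)) t (s t)

/-- `s` is a holomorphic flat section over the open set `W ⊆ ℂ`, that is `∇ s = 0` on `W`. -/
def MeromorphicConnection.IsFlatOn (conn : MeromorphicConnection V D) (W : Set ℂ)
    (s : ℂ → F) : Prop :=
  ∀ i, ∀ t ∈ W, (t : OnePoint ℂ) ∈ V.baseSet i →
    HasDerivAt (rep V i s) (-(conn.A i t (rep V i s t))) t

/-- The connection is regular: in every sector with vertex at a point `p` of `D.support`
the flat sections have at most polynomial growth near `p`, in a trivialization around `p`. -/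
def MeromorphicConnection.IsRegular (conn : MeromorphicConnection V D) : Prop :=
  ∀ p ∈ D.support, ∀ i, p ∈ V.baseSet i → ∀ r θ₁ θ₂ : ℝ, 0 < r → θ₁ < θ₂ →
    θ₂ - θ₁ < 2 * Real.pi →
    (∀ z ∈ sector r θ₁ θ₂, loc p z ∈ V.baseSet i ∧ loc p z ∉ D.support) →
    ∀ s : ℂ → F, conn.IsFlatOn (aff p '' sector r θ₁ θ₂) s →
      PolynomialGrowth (sector r θ₁ θ₂) (fun z => rep V i s (aff p z))

/-- Precomposition: `precompL L δ = δ ∘ L`, the transpose of `L`. -/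
def precompL : (F →L[ℂ] F) →L[ℂ] ((F →L[ℂ] ℂ) →L[ℂ] (F →L[ℂ] ℂ)) :=
  (ContinuousLinearMap.compL ℂ F F ℂ).flip

@[simp] lemma precompL_apply (L : F →L[ℂ] F) (δ : F →L[ℂ] ℂ) : precompL L δ = δ.comp L := rfl

/-- The dual bundle: its transition functions are the inverse transposes of those of `V`. The
fibre at `t` is the dual of the fibre of `V` at `t`, the pairing being `⟨δ, s⟩ (t) = δ t (s t)`. -/
def dualBundle (V : VectorBundleCore ℂ (OnePoint ℂ) F ι) :
    VectorBundleCore ℂ (OnePoint ℂ) (F →L[ℂ] ℂ) ι where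
  baseSet := V.baseSet
  isOpen_baseSet := V.isOpen_baseSet
  indexAt := V.indexAt
  mem_baseSet_at := V.mem_baseSet_at
  coordChange i j x := precompL (V.coordChange j i x)
  coordChange_self i x hx v := by
    ext w
    simp [V.coordChange_self i x hx]
  continuousOn_coordChange i j := by
    have h := V.continuousOn_coordChange j i
    rw [inter_comm] at h
    exact precompL.continuous.comp_continuousOn h
  coordChange_comp i j k x hx v := by
    ext w
    have := V.coordChange_comp k j i x ⟨⟨hx.2, hx.1.2⟩, hx.1.1⟩ w
    simp [this]

lemma analyticAt_coordChange (hV : IsHolomorphic V) (i j : ι) (t : ℂ)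
    (ht : (t : OnePoint ℂ) ∈ V.baseSet i ∩ V.baseSet j) :
    AnalyticAt ℂ (fun τ : ℂ => V.coordChange i j (τ : OnePoint ℂ)) t := by
  have h := hV i j t ht
  have hloc : ∀ z : ℂ, loc (t : OnePoint ℂ) z = ((t + z : ℂ) : OnePoint ℂ) := by
    intro z
    unfold loc
    split_ifs with hz
    · simp [hz]
    · rfl
  simp only [hloc] at h
  have h2 : AnalyticAt ℂ (fun τ : ℂ => τ - t) t := analyticAt_id.sub analyticAt_const
  have h3 := AnalyticAt.comp_of_eq (g := fun z : ℂ => V.coordChange i j ((t + z : ℂ) : OnePoint ℂ))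
    (f := fun τ : ℂ => τ - t) h h2 (sub_self t)
  simpa [Function.comp_def] using h3

lemma analyticAt_neg_precompL {f : ℂ → (F →L[ℂ] F)} {t : ℂ} (hf : AnalyticAt ℂ f t) :
    AnalyticAt ℂ (fun τ => -precompL (f τ)) t := by
  have h := ContinuousLinearMap.analyticAt (𝕜 := ℂ) (E := F →L[ℂ] F)
    (F := ((F →L[ℂ] ℂ) →L[ℂ] (F →L[ℂ] ℂ))) precompL (f t)
  have h2 := AnalyticAt.comp h hf
  exact h2.neg

lemma hasDerivAt_precompL {f : ℂ → (F →L[ℂ] F)} {f' : F →L[ℂ] F} {t : ℂ}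
    (hf : HasDerivAt f f' t) : HasDerivAt (fun τ => precompL (f τ)) (precompL f') t := by
  have h := ContinuousLinearMap.hasFDerivAt (𝕜 := ℂ) (E := F →L[ℂ] F)
    (F := ((F →L[ℂ] ℂ) →L[ℂ] (F →L[ℂ] ℂ))) precompL (x := f t)
  have h2 := HasFDerivAt.comp_hasDerivAt (𝕜 := ℂ) (F := F →L[ℂ] F)
    (E := ((F →L[ℂ] ℂ) →L[ℂ] (F →L[ℂ] ℂ))) (l := fun L => precompL L) (l' := precompL) t h hf
  exact h2

/-- The dual connection, `⟨∇* δ, s⟩ = d⟨δ, s⟩ - ⟨δ, ∇ s⟩`, that is `∇* δ = dδ - (δ ∘ A i) dt` in the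
`i`-th trivialization. -/
def MeromorphicConnection.dual (conn : MeromorphicConnection V D) (hV : IsHolomorphic V) :
    MeromorphicConnection (dualBundle V) D where
  A i t := -precompL (conn.A i t)
  analytic i t ht htD :=
    analyticAt_neg_precompL (conn.analytic i t ht htD)
  pole i p hp := by
    obtain ⟨B, hB, h⟩ := conn.pole i p hp
    refine ⟨fun z => -precompL (B z), analyticAt_neg_precompL hB, ?_⟩
    filter_upwards [h] with z hz
    ext δ w
    simp [← hz]
  gauge i j t ht htD := by
    have hg := conn.gauge j i t ht.symm htD
    have hd := (analyticAt_coordChange hV j i t ht.symm).differentiableAt.hasDerivAt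
    have hd2 : deriv (fun τ : ℂ => (dualBundle V).coordChange i j (τ : OnePoint ℂ)) t =
        precompL (deriv (fun τ : ℂ => V.coordChange j i (τ : OnePoint ℂ)) t) :=
      (hasDerivAt_precompL hd).deriv
    rw [hd2]
    have hg2 := congrArg (precompL (F := F)) hg
    rw [map_add] at hg2
    ext δ w
    have hg3 := congrArg (fun L => L δ w) hg2
    simp only [precompL_apply, add_apply, ContinuousLinearMap.comp_apply,
      dualBundle, neg_apply] at hg3 ⊢
    rw [hg3]
    ring

/-- The Wronskian-type determinant with entries `⟨δ_j, ∇^(n i) ω⟩`. -/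
def MeromorphicConnection.wronskian {α : ℕ} (conn : MeromorphicConnection V D) (ω : ℂ → F)
    (δ : Fin α → ℂ → (F →L[ℂ] ℂ)) (n : Fin α → ℕ) (t : ℂ) : ℂ :=
  Matrix.det (Matrix.of fun i j : Fin α => δ j t (((conn.nabla)^[n i] ω) t))

end Bundles

/-! ### Linear differential equations -/

/-- The coefficients of the linear equation `Y^(α) + ∑_{k < α} a_k Y^(k) = 0`. -/
abbrev LinearODE (α : ℕ) : Type := Fin α → ℂ → ℂ

/-- `y` is a holomorphic solution of the equation on the open set `W`. -/
def LinearODE.IsSolOn {α : ℕ} (ψ : LinearODE α) (W : Set ℂ) (y : ℂ → ℂ) : Prop :=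
  AnalyticOnNhd ℂ y W ∧
    ∀ t ∈ W, iteratedDeriv α y t + ∑ k : Fin α, ψ k t * iteratedDeriv (k : ℕ) y t = 0

/-- Linear independence over `ℂ` of functions restricted to `W`. -/
def IndepOn {G : Type*} [AddCommGroup G] [Module ℂ G] {α : ℕ} (W : Set ℂ) (f : Fin α → ℂ → G) :
    Prop :=
  LinearIndependent ℂ (fun k => fun t : W => f k (t : ℂ))

/-- The equation is regular at `p`: in every sector with vertex `p`, inside the set `X` of regular
points, its solutions have at most polynomial growth near `p`. -/
def LinearODE.IsRegularAt {α : ℕ} (ψ : LinearODE α) (X : Set ℂ) (p : OnePoint ℂ) : Prop :=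
  ∀ r θ₁ θ₂ : ℝ, 0 < r → θ₁ < θ₂ → θ₂ - θ₁ < 2 * Real.pi → aff p '' sector r θ₁ θ₂ ⊆ X →
    ∀ y : ℂ → ℂ, ψ.IsSolOn (aff p '' sector r θ₁ θ₂) y →
      PolynomialGrowth (sector r θ₁ θ₂) (fun z => y (aff p z))

/-- `z` is (at most) an apparent singularity: near `z` the solutions form an `α`-dimensional
space of functions that are holomorphic at `z` too. -/
def LinearODE.IsApparentAt {α : ℕ} (ψ : LinearODE α) (X : Set ℂ) (z : ℂ) : Prop :=
  ∃ (r : ℝ) (e : Fin α → ℂ → ℂ), 0 < r ∧ Metric.ball z r \ {z} ⊆ X ∧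
    IndepOn (Metric.ball z r \ {z}) e ∧
    ∀ k, AnalyticOnNhd ℂ (e k) (Metric.ball z r) ∧ ψ.IsSolOn (Metric.ball z r \ {z}) (e k)

/-- Singularity of pole type at `∞`: near `∞` the solutions form an `α`-dimensional space of
single-valued functions that are meromorphic at `∞`. -/
def LinearODE.IsPoleTypeAtInfty {α : ℕ} (ψ : LinearODE α) (X : Set ℂ) : Prop :=
  ∃ (R : ℝ) (e : Fin α → ℂ → ℂ), {t : ℂ | R < ‖t‖} ⊆ X ∧ IndepOn {t : ℂ | R < ‖t‖} e ∧
    ∀ k, ψ.IsSolOn {t : ℂ | R < ‖t‖} (e k) ∧ MeromorphicAt (fun z : ℂ => e k z⁻¹) 0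

/-! ### Analytic continuation and monodromy -/

/-- The germ of `f` at the start of `γ` continues analytically along `γ`, through local solutions of
the linear problem `Sol`, to the germ of `g` at the end of `γ`. -/
def ContinuesAlong {G : Type*} (Sol : Set ℂ → (ℂ → G) → Prop) {a b : ℂ} (γ : Path a b)
    (f g : ℂ → G) : Prop :=
  ∃ Φ : unitInterval → ℂ → G, Φ 0 =ᶠ[𝓝 a] f ∧ Φ 1 =ᶠ[𝓝 b] g ∧
    ∀ τ, (∃ W, IsOpen W ∧ γ τ ∈ W ∧ Sol W (Φ τ)) ∧ ∀ᶠ τ' in 𝓝 τ, Φ τ' =ᶠ[𝓝 (γ τ')] Φ τ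

/-- `M` is the monodromy matrix of the local solutions `f` along the loop `γ`. -/
def HasMonodromy {G : Type*} [AddCommGroup G] [Module ℂ G] (Sol : Set ℂ → (ℂ → G) → Prop)
    {α : ℕ} {b : ℂ} (γ : Path b b) (f : Fin α → ℂ → G) (M : Matrix (Fin α) (Fin α) ℂ) : Prop :=
  ∀ k, ContinuesAlong Sol γ (f k) (∑ l, M k l • f l)

/-- Two linear problems of rank `α` on `X` have the same monodromy representation: near the base
point `b` they have bases of solutions with the same monodromy matrix along every loop in `X`. -/
def SameMonodromy {G H : Type*} [AddCommGroup G] [Module ℂ G] [AddCommGroup H] [Module ℂ H]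
    (α : ℕ) (Sol₁ : Set ℂ → (ℂ → G) → Prop) (Sol₂ : Set ℂ → (ℂ → H) → Prop) (X : Set ℂ) (b : ℂ) :
    Prop :=
  ∃ (r : ℝ) (δ : Fin α → ℂ → G) (e : Fin α → ℂ → H), 0 < r ∧ Metric.ball b r ⊆ X ∧
    (IndepOn (Metric.ball b r) δ ∧ ∀ k, Sol₁ (Metric.ball b r) (δ k)) ∧
    (IndepOn (Metric.ball b r) e ∧ ∀ k, Sol₂ (Metric.ball b r) (e k)) ∧
    ∀ γ : Path b b, (∀ τ, γ τ ∈ X) → ∀ M : Matrix (Fin α) (Fin α) ℂ,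
      HasMonodromy Sol₁ γ δ M ↔ HasMonodromy Sol₂ γ e M

/-! ### The Picard-Fuchs equation of a section -/

/-- The affine points outside the poles `D.support` of the connection and outside `Z`. -/
def regularSet (D : OnePoint ℂ →₀ ℕ) (Z : Finset ℂ) : Set ℂ :=
  {t : ℂ | (t : OnePoint ℂ) ∉ D.support ∧ t ∉ Z}

/-- `ψ` is the Picard-Fuchs equation of the section `ω` on the open set `X`: for each local basis
`δ_1, …, δ_α` of flat sections of the dual bundle the Wronskian
`W = det ⟨δ_j, ∇^i ω⟩` (`0 ≤ i < α`) does not vanish and the coefficient of `Y^(k)` is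
`(-1)^(α-k) / W` times the determinant with rows `i ∈ {0, …, α} \ {k}` (so `ψ` is the expansion of
the determinant with columns `(Y^(i))`, `(⟨δ_j, ∇^i ω⟩)`); and the solutions of `ψ` are
exactly the functions `⟨δ, ω⟩` with `δ` flat. -/
def IsPicardFuchsOf {ι : Type*} {α : ℕ} {V : VectorBundleCore ℂ (OnePoint ℂ) (Fin α → ℂ) ι}
    {D : OnePoint ℂ →₀ ℕ} (hV : IsHolomorphic V) (conn : MeromorphicConnection V D) (X : Set ℂ)
    (ψ : LinearODE α) (ω : ℂ → (Fin α → ℂ)) : Prop :=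
  (∀ W : Set ℂ, IsOpen W → IsPreconnected W → W ⊆ X →
    ∀ δ : Fin α → ℂ → ((Fin α → ℂ) →L[ℂ] ℂ), (∀ j, (conn.dual hV).IsFlatOn W (δ j)) →
      IndepOn W δ → ∀ t ∈ W,
        conn.wronskian ω δ (fun i => (i : ℕ)) t ≠ 0 ∧
        ∀ k : Fin α, ψ k t = (-1) ^ (α - (k : ℕ)) *
          conn.wronskian ω δ (fun i => ((k.castSucc.succAbove i : Fin (α + 1)) : ℕ)) t /
            conn.wronskian ω δ (fun i => (i : ℕ)) t) ∧
  ∀ W : Set ℂ, IsOpen W → W ⊆ X → ∀ y : ℂ → ℂ,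
    ψ.IsSolOn W y ↔ ∃ δ : ℂ → ((Fin α → ℂ) →L[ℂ] ℂ),
      (conn.dual hV).IsFlatOn W δ ∧ ∀ t ∈ W, y t = δ t (ω t)

end P1Connection

end

open Filter Topology Set

/-! Off the poles of the connection, a section of `V` amounts to the column of its periods against a
basis of flat sections of the dual bundle. Continue the two given bases from `b` to `t` along one
and the same path, obtaining flat sections `Δ k` and solutions `E k`, and define `ω t` by `⟨Δ k, ω⟩
= E k`. Equality of the monodromy makes this legitimate: two paths change `Δ` and `E` by the same
constant matrix (`JointContinuation.exists_matrix`), so `ω t` does not depend on the path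
(`exists_section_of_sameMonodromy`). `HasPeriods` records the outcome, and everything else is
deduced from it.

The Picard–Fuchs property is local. Pairing with `ω` is an isomorphism from germs of flat sections
to germs of solutions, and by its injectivity local flat sections glue (`isSolOn_iff_exists_flat`).
By uniqueness for linear equations, independent solutions have independent jets, so the Wronskian
has no zero, and Cramer's rule returns the coefficients (`mul_det_eq_of_relation`).

For the singularities, let `Y` be a flat frame in a trivialization and `X` its inverse; there `ω` is
`X` applied to its periods. At a point of `Z` which is not a pole of the connection, `X` is
holomorphic, and the periods are combinations of solutions holomorphic at the point; hence `ω`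
extends (`exists_analytic_extension`).

At a pole of the connection or at `∞`, the periods have polynomial growth because `ψ` is regular,
and `X` has to be bounded likewise. If the connection has no pole there, the frame extends across
the point. Otherwise `Y` has polynomial growth by regularity, and by the adjugate formula only `1 /
det Y` is in question. By Liouville's formula `det Y` solves `u' = (tr A) u` with meromorphic `tr
A`, so up to a constant it is `exp G` times a branch of `z ^ k`, where `exp G` is single-valued.
Growth in all half planes makes `exp G` meromorphic, and then its inverse is meromorphic too
(`tempered_inv_of_scalar_equation`). Riemann's theorem turns polynomial growth of `ω` into
meromorphy (`meromorphicAt_rep_aff`). -/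

namespace P1Connection

/-! ### Linear holomorphic differential equations on convex domains -/

section LinearODE

variable {E : Type*} [NormedAddCommGroup E] [NormedSpace ℂ E] [CompleteSpace E]

/-- Holomorphic functions on convex domains have primitives. -/
lemma exists_primitive_of_convex {U : Set ℂ} (hU : IsOpen U) (hc : Convex ℝ U) {t₀ : ℂ}
    {f : ℂ → E} (hf : DifferentiableOn ℂ f U) :
    ∃ g : ℂ → E, g t₀ = 0 ∧ ∀ t ∈ U, HasDerivAt g (f t) t := by
  obtain ⟨g, hg⟩ := hc.exists_forall_hasDerivWithinAt hf
  refine ⟨fun t => g t - g t₀, sub_self _, fun t ht => ?_⟩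
  exact ((hg t ht).hasDerivAt (hU.mem_nhds ht)).sub_const _

omit [CompleteSpace E] in
/-- The factorial bound for Picard iterates along a segment. -/
lemma norm_iterate_le {U : Set ℂ} (hc : Convex ℝ U) {t₀ : ℂ} (ht₀ : t₀ ∈ U)
    {L : ℂ → E →L[ℂ] E} {T : ℕ → ℂ → E} {c M : ℝ} (h0 : ∀ t, ‖T 0 t‖ ≤ c)
    (hT0 : ∀ n, T (n + 1) t₀ = 0)
    (hT : ∀ n, ∀ t ∈ U, HasDerivAt (T (n + 1)) (L t (T n t)) t) {t : ℂ} (ht : t ∈ U)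
    (hM : ∀ s ∈ Icc (0 : ℝ) 1, ‖L (t₀ + s * (t - t₀))‖ ≤ M) (n : ℕ) :
    ∀ s ∈ Icc (0 : ℝ) 1, ‖T n (t₀ + s * (t - t₀))‖ ≤ c * ((M * ‖t - t₀‖ * s) ^ n / n.factorial) := by
  have hM0 : 0 ≤ M := (norm_nonneg _).trans (hM 0 (by simp))
  induction n with
  | zero => intro s _; simpa using h0 _
  | succ n ih =>
    have hmem : ∀ s ∈ Icc (0 : ℝ) 1, t₀ + s * (t - t₀) ∈ U := fun s hs => by
      have := hc.add_smul_sub_mem ht₀ ht hs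
      simpa using this
    have hline : ∀ s : ℝ, HasDerivAt (fun s : ℝ => t₀ + (s : ℂ) * (t - t₀)) (t - t₀) s := by
      intro s
      have h1 : HasDerivAt (fun s : ℝ => (s : ℂ)) 1 s := Complex.ofRealCLM.hasDerivAt
      simpa using (h1.mul_const (t - t₀)).const_add t₀
    have hd : ∀ s ∈ Icc (0 : ℝ) 1, HasDerivAt (fun s : ℝ => T (n + 1) (t₀ + s * (t - t₀)))
        ((t - t₀) • (L (t₀ + s * (t - t₀)) (T n (t₀ + s * (t - t₀))))) s := by
      intro s hs
      exact (hT n _ (hmem s hs)).scomp s (hline s)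
    -- Comparison along the segment: the derivative of the bound for `n + 1` is `M * ‖t - t₀‖` times
    -- the bound for `n`, which dominates the derivative of the iterate.
    refine image_norm_le_of_norm_deriv_right_le_deriv_boundary
      (f' := fun s : ℝ => (t - t₀) • (L (t₀ + s * (t - t₀)) (T n (t₀ + s * (t - t₀)))))
      (B' := fun s => c * (M * ‖t - t₀‖ * (M * ‖t - t₀‖ * s) ^ n / n.factorial))
      (fun s hs => (hd s hs).continuousAt.continuousWithinAt)
      (fun s hs => (hd s ⟨hs.1, hs.2.le⟩).hasDerivWithinAt) ?_ ?_ ?_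
    · simp [hT0]
    · intro s
      have h1 : HasDerivAt (fun s : ℝ => M * ‖t - t₀‖ * s) (M * ‖t - t₀‖) s := by
        simpa using (hasDerivAt_id s).const_mul (M * ‖t - t₀‖)
      refine (((h1.pow (n + 1)).div_const ((n + 1).factorial : ℝ)).const_mul c).congr_deriv ?_
      have h2 : ((n : ℝ) + 1) ≠ 0 := by positivity
      have h3 : (n.factorial : ℝ) ≠ 0 := by positivity
      rw [Nat.factorial_succ]
      push_cast
      field_simp
    · intro s hs
      have hs' : s ∈ Icc (0 : ℝ) 1 := ⟨hs.1, hs.2.le⟩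
      rw [norm_smul]
      calc ‖t - t₀‖ * ‖L (t₀ + s * (t - t₀)) (T n (t₀ + s * (t - t₀)))‖
          ≤ ‖t - t₀‖ * (M * (c * ((M * ‖t - t₀‖ * s) ^ n / n.factorial))) := by
            gcongr
            exact ((L _).le_opNorm _).trans
              (mul_le_mul (hM s hs') (ih s hs') (norm_nonneg _) hM0)
        _ = _ := by ring

/-- Global existence for linear holomorphic differential equations on a convex domain. -/
lemma exists_linearODE_solution {U : Set ℂ} (hU : IsOpen U) (hc : Convex ℝ U) {t₀ : ℂ}
    (ht₀ : t₀ ∈ U) {L : ℂ → E →L[ℂ] E} (hL : DifferentiableOn ℂ L U) (v₀ : E) :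
    ∃ v : ℂ → E, v t₀ = v₀ ∧ ∀ t ∈ U, HasDerivAt v (L t (v t)) t := by
  -- With holomorphy as a premise inside the existential, `choose` yields a total operator; the
  -- Picard iterates can then be defined by plain recursion and shown holomorphic afterwards.
  have hprim : ∀ f : ℂ → E, ∃ g : ℂ → E, DifferentiableOn ℂ f U →
      g t₀ = 0 ∧ ∀ t ∈ U, HasDerivAt g (f t) t := by
    intro f
    by_cases hf : DifferentiableOn ℂ f U
    · obtain ⟨g, hg⟩ := exists_primitive_of_convex hU hc (t₀ := t₀) hf
      exact ⟨g, fun _ => hg⟩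
    · exact ⟨f, fun h => absurd h hf⟩
  choose prim hprim using hprim
  let T : ℕ → ℂ → E := fun n => Nat.rec (fun _ => v₀) (fun _ f => prim fun t => L t (f t)) n
  have hTs : ∀ n, T (n + 1) = prim fun t => L t (T n t) := fun n => rfl
  have hTd : ∀ n, DifferentiableOn ℂ (T n) U := by
    intro n
    induction n with
    | zero => exact differentiableOn_const _
    | succ n ih =>
      rw [hTs]
      exact fun t ht => ((hprim _ (hL.clm_apply ih)).2 t ht).differentiableAt.differentiableWithinAt
  have hT0 : ∀ n, T (n + 1) t₀ = 0 := fun n => (hprim _ (hL.clm_apply (hTd n))).1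
  have hT : ∀ n, ∀ t ∈ U, HasDerivAt (T (n + 1)) (L t (T n t)) t :=
    fun n => (hprim _ (hL.clm_apply (hTd n))).2
  refine ⟨fun t => ∑' n, T n t, ?_, fun t ht => ?_⟩
  · change ∑' n, T n t₀ = v₀
    rw [tsum_eq_single 0]
    · rfl
    · intro n hn
      obtain ⟨m, rfl⟩ := Nat.exists_eq_succ_of_ne_zero hn
      exact hT0 m
  obtain ⟨ε, hε, hball⟩ := Metric.nhds_basis_closedBall.mem_iff.1 (hU.mem_nhds ht)
  -- The segments from `t₀` to the points of a closed ball around `t` sweep out a compact subset of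
  -- `U`, so a single `M` bounds `L` on all of them and the factorial estimates are uniform on the
  -- ball.
  let S : ℝ × ℂ → ℂ := fun q => t₀ + q.1 * (q.2 - t₀)
  have hS : Continuous S := by fun_prop
  have hSU : ∀ q ∈ Icc (0 : ℝ) 1 ×ˢ Metric.closedBall t ε, S q ∈ U := by
    rintro ⟨s, τ⟩ ⟨hs, hτ⟩
    have := hc.add_smul_sub_mem ht₀ (hball hτ) hs
    simpa [S] using this
  have hK : IsCompact (S '' (Icc (0 : ℝ) 1 ×ˢ Metric.closedBall t ε)) :=
    (isCompact_Icc.prod (isCompact_closedBall _ _)).image hS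
  obtain ⟨M, hM⟩ := hK.exists_bound_of_continuousOn
    (hL.continuousOn.mono (image_subset_iff.2 hSU))
  have hM0 : 0 ≤ M := (norm_nonneg _).trans
    (hM _ (mem_image_of_mem S (show ((0 : ℝ), t) ∈ _ by simp [hε.le])))
  let R := ‖t - t₀‖ + ε
  have hbound : ∀ n, ∀ τ ∈ Metric.ball t ε, ‖T n τ‖ ≤ ‖v₀‖ * ((M * R) ^ n / n.factorial) := by
    intro n τ hτ
    have hτ' := Metric.ball_subset_closedBall hτ
    have h1 := norm_iterate_le hc ht₀ (L := L) (T := T) (c := ‖v₀‖) (M := M) (fun _ => le_rfl) hT0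
      hT (hball hτ') (fun s hs => hM _ (mem_image_of_mem S (show (s, τ) ∈ Icc (0 : ℝ) 1 ×ˢ Metric.closedBall t ε from ⟨hs, hτ'⟩)))
      n 1 (by simp)
    have h2 : ‖τ - t₀‖ ≤ R := by
      have : τ - t₀ = (t - t₀) + (τ - t) := by ring
      rw [this]
      refine (norm_add_le _ _).trans (add_le_add le_rfl ?_)
      simpa [dist_eq_norm] using (Metric.mem_closedBall.1 hτ')
    simp only [Complex.ofReal_one, one_mul, add_sub_cancel, mul_one] at h1
    refine h1.trans ?_
    gcongr
  have hsum : Summable fun n => ‖v₀‖ * ((M * R) ^ n / (n.factorial : ℝ)) :=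
    (Real.summable_pow_div_factorial _).mul_left _
  have hbU : Metric.ball t ε ⊆ U := Metric.ball_subset_closedBall.trans hball
  have hdiff := Complex.differentiableOn_tsum_of_summable_norm hsum
    (fun n => (hTd n).mono hbU) Metric.isOpen_ball hbound
  have hder := Complex.hasSum_deriv_of_summable_norm hsum
    (fun n => (hTd n).mono hbU) Metric.isOpen_ball hbound (Metric.mem_ball_self hε)
  have hsummT : Summable fun n => T n t :=
    Summable.of_norm_bounded hsum (fun n => hbound n t (Metric.mem_ball_self hε))
  have hder2 : deriv (fun w => ∑' n, T n w) t = L t (∑' n, T n t) := by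
    -- The zeroth iterate is constant, so the differentiated series, shifted by one, is `L t`
    -- applied to the original series.
    have h1 : HasSum (fun n => deriv (T (n + 1)) t) (L t (∑' n, T n t)) := by
      simp_rw [fun n => (hT n t ht).deriv]
      exact (L t).hasSum hsummT.hasSum
    have h2 : deriv (T 0) t = 0 := deriv_const t v₀
    have h3 := (hasSum_nat_add_iff' 1).2 hder
    simp only [Finset.range_one, Finset.sum_singleton, h2, sub_zero] at h3
    exact h3.unique h1
  rw [← hder2]
  exact (hdiff.differentiableAt (Metric.isOpen_ball.mem_nhds (Metric.mem_ball_self hε))).hasDerivAt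

/-- Fundamental solutions `Y' = Y A`, `X' = -A X`, inverse to each other. -/
lemma exists_frame {F : Type*} [NormedAddCommGroup F] [NormedSpace ℂ F] [FiniteDimensional ℂ F]
    {U : Set ℂ} (hU : IsOpen U) (hc : Convex ℝ U) (hne : U.Nonempty) {A : ℂ → F →L[ℂ] F}
    (hA : DifferentiableOn ℂ A U) :
    ∃ Y X : ℂ → F →L[ℂ] F, (∀ t ∈ U, HasDerivAt Y (Y t * A t) t) ∧
      (∀ t ∈ U, HasDerivAt X (-(A t * X t)) t) ∧ (∀ t ∈ U, Y t * X t = 1) ∧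
      ∀ t ∈ U, X t * Y t = 1 := by
  have : CompleteSpace F := FiniteDimensional.complete ℂ F
  obtain ⟨t₀, ht₀⟩ := hne
  let Rm := (ContinuousLinearMap.mul ℂ (F →L[ℂ] F)).flip
  let Lm := -(ContinuousLinearMap.mul ℂ (F →L[ℂ] F))
  obtain ⟨Y, hY0, hY⟩ := exists_linearODE_solution hU hc ht₀ (L := fun t => Rm (A t))
    (Rm.differentiable.comp_differentiableOn hA) 1
  obtain ⟨X, hX0, hX⟩ := exists_linearODE_solution hU hc ht₀ (L := fun t => Lm (A t))
    (Lm.differentiable.comp_differentiableOn hA) 1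
  have hY' : ∀ t ∈ U, HasDerivAt Y (Y t * A t) t := hY
  have hX' : ∀ t ∈ U, HasDerivAt X (-(A t * X t)) t := hX
  have hYX : ∀ t ∈ U, Y t * X t = 1 := by
    intro t ht
    have hd : ∀ t ∈ U, HasDerivAt (fun t => Y t * X t) 0 t := by
      intro t ht
      refine ((hY' t ht).mul (hX' t ht)).congr_deriv ?_
      rw [mul_neg, mul_assoc, add_neg_cancel]
    have := hU.is_const_of_deriv_eq_zero hc.isPreconnected
      (fun t ht => (hd t ht).differentiableAt.differentiableWithinAt)
      (fun t ht => (hd t ht).deriv) ht ht₀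
    simpa [hY0, hX0] using this
  refine ⟨Y, X, hY', hX', hYX, fun t ht => ?_⟩
  have h1 := hYX t ht
  -- In finite dimension a one-sided inverse is two-sided, and this is available for linear maps.
  have h2 : (Y t : F →ₗ[ℂ] F) * (X t : F →ₗ[ℂ] F) = 1 := by
    ext v
    exact congrArg (fun L => L v) h1
  have h3 := mul_eq_one_comm.1 h2
  ext v
  exact congrArg (fun L => L v) h3

end LinearODE

/-! ### Analytic continuation of germs of solutions along paths -/

section Continuation

variable {G : Type*}

/-- `f` represents a germ at `c` of a solution of the linear problem `Sol`. -/
def SolAt (Sol : Set ℂ → (ℂ → G) → Prop) (c : ℂ) (f : ℂ → G) : Prop :=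
  ∃ W, IsOpen W ∧ c ∈ W ∧ Sol W f

/-- The family of germs `Φ` along `γ` consists of solutions and is locally constant. -/
def Along (Sol : Set ℂ → (ℂ → G) → Prop) (γ : unitInterval → ℂ) (Φ : unitInterval → ℂ → G) :
    Prop :=
  ∀ τ, SolAt Sol (γ τ) (Φ τ) ∧ ∀ᶠ τ' in 𝓝 τ, Φ τ' =ᶠ[𝓝 (γ τ')] Φ τ

/-- The solutions of `Sol` form a sheaf of vector spaces with unique continuation on `X`. -/
structure IsSolSheaf [AddCommGroup G] [Module ℂ G] (X : Set ℂ)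
    (Sol : Set ℂ → (ℂ → G) → Prop) : Prop where
  mono : ∀ {W W' : Set ℂ} {f : ℂ → G}, W' ⊆ W → Sol W f → Sol W' f
  congr : ∀ {W : Set ℂ} {f g : ℂ → G}, IsOpen W → EqOn f g W → Sol W f → Sol W g
  zero : ∀ W : Set ℂ, Sol W 0
  add : ∀ {W : Set ℂ} {f g : ℂ → G}, IsOpen W → Sol W f → Sol W g → Sol W (f + g)
  smul : ∀ {W : Set ℂ} {f : ℂ → G} (k : ℂ), IsOpen W → Sol W f → Sol W (k • f)
  ident : ∀ {c : ℂ} {f g : ℂ → G}, c ∈ X → SolAt Sol c f → SolAt Sol c g →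
    (∃ᶠ t in 𝓝 c, f =ᶠ[𝓝 t] g) → f =ᶠ[𝓝 c] g

lemma Along.comp {Sol : Set ℂ → (ℂ → G) → Prop} {γ : unitInterval → ℂ}
    {Φ : unitInterval → ℂ → G} (h : Along Sol γ Φ) {φ : unitInterval → unitInterval}
    (hφ : Continuous φ) : Along Sol (γ ∘ φ) (Φ ∘ φ) :=
  fun τ => ⟨(h (φ τ)).1, hφ.continuousAt.eventually (h (φ τ)).2⟩

lemma continuesAlong_iff {Sol : Set ℂ → (ℂ → G) → Prop} {a b : ℂ} {γ : Path a b} {f g : ℂ → G} :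
    ContinuesAlong Sol γ f g ↔
      ∃ Φ : unitInterval → ℂ → G, Φ 0 =ᶠ[𝓝 a] f ∧ Φ 1 =ᶠ[𝓝 b] g ∧ Along Sol γ Φ :=
  Iff.rfl

lemma ContinuesAlong.symm {Sol : Set ℂ → (ℂ → G) → Prop} {a b : ℂ} {γ : Path a b} {f g : ℂ → G}
    (h : ContinuesAlong Sol γ f g) : ContinuesAlong Sol γ.symm g f := by
  obtain ⟨Φ, h0, h1, h⟩ := continuesAlong_iff.1 h
  refine continuesAlong_iff.2 ⟨Φ ∘ unitInterval.symm, ?_, ?_,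
    h.comp unitInterval.continuous_symm⟩
  · simpa using h1
  · simpa using h0

lemma ContinuesAlong.congr {Sol : Set ℂ → (ℂ → G) → Prop} {a b : ℂ} {γ : Path a b}
    {f g f' g' : ℂ → G} (h : ContinuesAlong Sol γ f g) (hf : f =ᶠ[𝓝 a] f') (hg : g =ᶠ[𝓝 b] g') :
    ContinuesAlong Sol γ f' g' := by
  obtain ⟨Φ, h0, h1, h⟩ := continuesAlong_iff.1 h
  exact ⟨Φ, h0.trans hf, h1.trans hg, h⟩

lemma ContinuesAlong.trans {Sol : Set ℂ → (ℂ → G) → Prop} {a b c : ℂ} {γ : Path a b}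
    {γ' : Path b c} {f g k : ℂ → G} (h : ContinuesAlong Sol γ f g)
    (h' : ContinuesAlong Sol γ' g k) : ContinuesAlong Sol (γ.trans γ') f k := by
  obtain ⟨Φ, h0, h1, h⟩ := continuesAlong_iff.1 h
  obtain ⟨Φ', h0', h1', h'⟩ := continuesAlong_iff.1 h'
  -- Clamped reparametrizations of the two halves, continuous on the whole interval, so that both
  -- families of germs can be pulled back before being glued.
  let p : unitInterval → unitInterval := fun τ => projIcc 0 1 zero_le_one (2 * (τ : ℝ))
  let q : unitInterval → unitInterval := fun τ => projIcc 0 1 zero_le_one (2 * (τ : ℝ) - 1)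
  have hp : Continuous p := by fun_prop
  have hq : Continuous q := by fun_prop
  have hγ : ∀ τ : unitInterval, (γ.trans γ') τ =
      if (τ : ℝ) ≤ 1 / 2 then γ (p τ) else γ' (q τ) := by
    intro τ
    rw [Path.trans_apply]
    split_ifs with hτ
    · congr 1
      exact (projIcc_of_mem zero_le_one ((unitInterval.mul_pos_mem_iff zero_lt_two).2
        ⟨τ.2.1, hτ⟩)).symm
    · congr 1
      exact (projIcc_of_mem zero_le_one (unitInterval.two_mul_sub_one_mem_iff.2
        ⟨(not_le.1 hτ).le, τ.2.2⟩)).symm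
  have hA := h.comp hp
  have hA' := h'.comp hq
  have hval : Continuous fun τ : unitInterval => (τ : ℝ) := continuous_subtype_val
  refine continuesAlong_iff.2 ⟨fun τ => if (τ : ℝ) ≤ 1 / 2 then Φ (p τ) else Φ' (q τ), ?_, ?_, ?_⟩
  · have : p 0 = 0 := by simp [p]
    simpa [this] using h0
  · have : q 1 = 1 := by
      simp only [q]
      norm_num
    have h2 : ¬ (((1 : unitInterval) : ℝ) ≤ 1 / 2) := by norm_num
    simp only [h2, if_false, this]
    exact h1'
  · intro τ
    refine ⟨?_, ?_⟩
    · rw [hγ]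
      by_cases hτ : (τ : ℝ) ≤ 1 / 2
      · simpa only [hτ, if_true] using! (hA τ).1
      · simpa only [hτ, if_false] using! (hA' τ).1
    · rcases lt_trichotomy (τ : ℝ) (1 / 2) with hτ | hτ | hτ
      · filter_upwards [(hA τ).2, hval.continuousAt.eventually (gt_mem_nhds hτ)] with σ h3 h4
        simp only [hγ, h4.le, hτ.le, if_true]
        exact h3
      -- At the junction the two families have the same germ at `b`, and equality of germs persists
      -- at the nearby points of the second path.
      · have hp1 : p τ = 1 := by simp [p, hτ]
        have hq0 : q τ = 0 := by simp [q, hτ]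
        have hmid : Φ' 0 =ᶠ[𝓝 b] Φ 1 := h0'.trans h1.symm
        have hcont : Tendsto (fun σ => γ' (q σ)) (𝓝 τ) (𝓝 b) := by
          have := (γ'.continuous.comp hq).tendsto τ
          rwa [Function.comp_apply, hq0, γ'.source] at this
        filter_upwards [(hA τ).2, (hA' τ).2, hcont.eventually hmid.eventuallyEq_nhds]
          with σ h3 h4 h5
        simp only [hτ, le_refl, if_true, hγ]
        split_ifs with hσ
        · exact h3
        · simp only [Function.comp_apply, hq0] at h4
          rw [hp1]
          exact h4.trans h5
      · filter_upwards [(hA' τ).2, hval.continuousAt.eventually (lt_mem_nhds hτ)] with σ h3 h4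
        simp only [hγ, not_le.2 h4, not_le.2 hτ, if_false]
        exact h3

/-- The intermediate germ is the one carried by the family at the midpoint. This extracts
continuability along a path from continuability along a loop through it. -/
lemma ContinuesAlong.split {Sol : Set ℂ → (ℂ → G) → Prop} {a b c : ℂ} {γ : Path a b}
    {γ' : Path b c} {f k : ℂ → G} (h : ContinuesAlong Sol (γ.trans γ') f k) :
    ∃ g, ContinuesAlong Sol γ f g ∧ ContinuesAlong Sol γ' g k := by
  obtain ⟨Φ, h0, h1, h⟩ := continuesAlong_iff.1 h
  let p : unitInterval → unitInterval := fun τ =>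
    ⟨(τ : ℝ) / 2, by have := τ.2.1; positivity, by have := τ.2.2; linarith⟩
  let q : unitInterval → unitInterval := fun τ =>
    ⟨((τ : ℝ) + 1) / 2, by have := τ.2.1; positivity, by have := τ.2.2; linarith⟩
  have hp : Continuous p := by fun_prop
  have hq : Continuous q := by fun_prop
  have hγ : (γ.trans γ' : unitInterval → ℂ) ∘ p = γ := by
    ext τ
    have h3 : (p τ : ℝ) ≤ 1 / 2 := by have := τ.2.2; simp only [p]; linarith
    simp only [Function.comp_apply, Path.trans_apply, h3, dif_pos]
    congr 1
    ext
    simp only [p]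
    ring
  have hγ' : (γ.trans γ' : unitInterval → ℂ) ∘ q = γ' := by
    ext τ
    simp only [Function.comp_apply, Path.trans_apply]
    split_ifs with h3
    -- The two branches of the concatenation overlap only at the midpoint, which `q` attains at `0`.
    · have h4 : (τ : ℝ) = 0 := le_antisymm (by simp only [q] at h3; linarith) τ.2.1
      have h5 : τ = 0 := by ext; simpa using h4
      subst h5
      simp [q]
    · congr 1
      ext
      simp only [q]
      ring
  refine ⟨Φ (p 1), continuesAlong_iff.2 ⟨Φ ∘ p, ?_, EventuallyEq.rfl, hγ ▸ h.comp hp⟩,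
    continuesAlong_iff.2 ⟨Φ ∘ q, ?_, ?_, hγ' ▸ h.comp hq⟩⟩
  · have : p 0 = 0 := by ext; simp [p]
    simpa [this] using h0
  · have : q 0 = p 1 := by ext; simp [p, q]
    simp [this]
  · have : q 1 = 1 := by ext; simp [q]
    simpa [this] using h1

lemma ContinuesAlong.const {Sol : Set ℂ → (ℂ → G) → Prop} {a b : ℂ} {γ : Path a b}
    {f : ℂ → G} (h : ∀ τ, SolAt Sol (γ τ) f) : ContinuesAlong Sol γ f f :=
  ⟨fun _ => f, EventuallyEq.rfl, EventuallyEq.rfl,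
    fun τ => ⟨h τ, Eventually.of_forall fun _ => EventuallyEq.rfl⟩⟩

lemma SolAt.eventually {Sol : Set ℂ → (ℂ → G) → Prop} {c : ℂ} {f : ℂ → G} (h : SolAt Sol c f) : ∀ᶠ t in 𝓝 c, SolAt Sol t f := by
  obtain ⟨W, hW, hc, hs⟩ := h
  filter_upwards [hW.mem_nhds hc] with t ht using ⟨W, hW, ht, hs⟩

variable [AddCommGroup G] [Module ℂ G] {X : Set ℂ} {Sol : Set ℂ → (ℂ → G) → Prop}

namespace IsSolSheaf

variable (hS : IsSolSheaf X Sol)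
include hS

lemma solAt_congr {c : ℂ} {f g : ℂ → G} (h : SolAt Sol c f) (hfg : f =ᶠ[𝓝 c] g) :
    SolAt Sol c g := by
  obtain ⟨W, hW, hc, hs⟩ := h
  obtain ⟨W', hW'1, hW', hc'⟩ := mem_nhds_iff.1 hfg
  exact ⟨W ∩ W', hW.inter hW', ⟨hc, hc'⟩,
    hS.congr (hW.inter hW') (fun t ht => hW'1 ht.2) (hS.mono inter_subset_left hs)⟩

lemma solAt_add {c : ℂ} {f g : ℂ → G} (hf : SolAt Sol c f) (hg : SolAt Sol c g) :
    SolAt Sol c (f + g) := by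
  obtain ⟨W, hW, hc, hs⟩ := hf
  obtain ⟨W', hW', hc', hs'⟩ := hg
  have ho := hW.inter hW'
  exact ⟨W ∩ W', ho, ⟨hc, hc'⟩,
    hS.add ho (hS.mono inter_subset_left hs) (hS.mono inter_subset_right hs')⟩

lemma solAt_smul {c : ℂ} {f : ℂ → G} (k : ℂ) (hf : SolAt Sol c f) : SolAt Sol c (k • f) := by
  obtain ⟨W, hW, hc, hs⟩ := hf
  exact ⟨W, hW, hc, hS.smul k hW hs⟩

lemma solAt_zero (c : ℂ) : SolAt Sol c 0 := ⟨univ, isOpen_univ, mem_univ _, hS.zero _⟩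

lemma sum {α : ℕ} {W : Set ℂ} (hW : IsOpen W) {f : Fin α → ℂ → G} (hf : ∀ k, Sol W (f k))
    (s : Finset (Fin α)) (k : Fin α → ℂ) : Sol W (∑ l ∈ s, k l • f l) := by
  induction s using Finset.induction_on with
  | empty => simpa using hS.zero W
  | insert a s ha ih => rw [Finset.sum_insert ha]; exact hS.add hW (hS.smul _ hW (hf a)) ih

lemma solAt_sum {α : ℕ} {c : ℂ} {f : Fin α → ℂ → G} (hf : ∀ k, SolAt Sol c (f k))
    (s : Finset (Fin α)) (k : Fin α → ℂ) : SolAt Sol c (∑ l ∈ s, k l • f l) := by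
  induction s using Finset.induction_on with
  | empty => simpa using hS.solAt_zero c
  | insert a s ha ih => rw [Finset.sum_insert ha]; exact hS.solAt_add (hS.solAt_smul _ (hf a)) ih

lemma continuesAlong_add {a b : ℂ} {γ : Path a b} {f g f' g' : ℂ → G}
    (h : ContinuesAlong Sol γ f g) (h' : ContinuesAlong Sol γ f' g') :
    ContinuesAlong Sol γ (f + f') (g + g') := by
  obtain ⟨Φ, h0, h1, h⟩ := continuesAlong_iff.1 h
  obtain ⟨Φ', h0', h1', h'⟩ := continuesAlong_iff.1 h'
  refine ⟨fun τ => Φ τ + Φ' τ, h0.add h0', h1.add h1',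
    fun τ => ⟨hS.solAt_add (h τ).1 (h' τ).1, ?_⟩⟩
  filter_upwards [(h τ).2, (h' τ).2] with σ h2 h3 using h2.add h3

lemma continuesAlong_smul {a b : ℂ} {γ : Path a b} {f g : ℂ → G} (k : ℂ)
    (h : ContinuesAlong Sol γ f g) : ContinuesAlong Sol γ (k • f) (k • g) := by
  obtain ⟨Φ, h0, h1, h⟩ := continuesAlong_iff.1 h
  refine ⟨fun τ => k • Φ τ, h0.const_smul k, h1.const_smul k,
    fun τ => ⟨hS.solAt_smul k (h τ).1, ?_⟩⟩
  filter_upwards [(h τ).2] with σ h2 using h2.const_smul k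

lemma continuesAlong_sum {α : ℕ} {a b : ℂ} {γ : Path a b} {f g : Fin α → ℂ → G}
    (h : ∀ k, ContinuesAlong Sol γ (f k) (g k)) (k : Fin α → ℂ) :
    ContinuesAlong Sol γ (∑ l, k l • f l) (∑ l, k l • g l) := by
  suffices ∀ s : Finset (Fin α), ContinuesAlong Sol γ (∑ l ∈ s, k l • f l) (∑ l ∈ s, k l • g l) from
    this _
  intro s
  induction s using Finset.induction_on with
  | empty =>
    simp only [Finset.sum_empty]
    exact ContinuesAlong.const fun τ => hS.solAt_zero _
  | insert a s ha ih =>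
    rw [Finset.sum_insert ha, Finset.sum_insert ha]
    exact hS.continuesAlong_add (hS.continuesAlong_smul _ (h a)) ih

/-- The parameters at which the two families have the same germ form a clopen subset of the
interval: openness is local constancy, closedness is the identity principle `ident`. -/
lemma continuesAlong_unique {a b : ℂ} {γ : Path a b} (hγ : ∀ τ, γ τ ∈ X) {f g f' g' : ℂ → G}
    (h : ContinuesAlong Sol γ f g) (h' : ContinuesAlong Sol γ f' g') (hf : f =ᶠ[𝓝 a] f') :
    g =ᶠ[𝓝 b] g' := by
  obtain ⟨Φ, h0, h1, h⟩ := continuesAlong_iff.1 h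
  obtain ⟨Φ', h0', h1', h'⟩ := continuesAlong_iff.1 h'
  let T : Set unitInterval := {τ | Φ τ =ᶠ[𝓝 (γ τ)] Φ' τ}
  have hT : IsClopen T := by
    constructor
    · rw [isClosed_iff_frequently]
      intro τ hτ
      refine hS.ident (hγ τ) (h τ).1 (h' τ).1 ?_
      refine (γ.continuous.continuousAt (x := τ)).frequently
        (p := fun t => Φ τ =ᶠ[𝓝 t] Φ' τ) ?_
      refine (hτ.and_eventually ((h τ).2.and (h' τ).2)).mono ?_
      rintro σ ⟨h2, h3, h4⟩
      exact h3.symm.trans (EventuallyEq.trans h2 h4)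
    · rw [isOpen_iff_eventually]
      intro τ hτ
      have h2 := (γ.continuous.continuousAt (x := τ)).eventually
        (EventuallyEq.eventuallyEq_nhds (show Φ τ =ᶠ[𝓝 (γ τ)] Φ' τ from hτ))
      filter_upwards [(h τ).2, (h' τ).2, h2] with σ h3 h4 h5
      exact h3.trans (EventuallyEq.trans h5 h4.symm)
  have hne : T.Nonempty := by
    refine ⟨0, ?_⟩
    change Φ 0 =ᶠ[𝓝 (γ 0)] Φ' 0
    rw [γ.source]
    exact h0.trans (hf.trans h0'.symm)
  have h2 : Φ 1 =ᶠ[𝓝 (γ 1)] Φ' 1 := by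
    have : (1 : unitInterval) ∈ T := by rw [hT.eq_univ hne]; trivial
    exact this
  rw [γ.target] at h2
  exact h1.symm.trans (h2.trans h1')

/-- Unique continuation on preconnected open sets. -/
lemma eqOn_of_eventuallyEq {W : Set ℂ} (hW : IsOpen W) (hWX : W ⊆ X) (hc : IsPreconnected W)
    {f g : ℂ → G} (hf : Sol W f) (hg : Sol W g) {c : ℂ} (hcW : c ∈ W) (h : f =ᶠ[𝓝 c] g) :
    EqOn f g W := by
  have key : W ⊆ {t | f =ᶠ[𝓝 t] g} := by
    refine hc.subset_of_closure_inter_subset ?_ ⟨c, hcW, h⟩ ?_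
    · rw [isOpen_iff_eventually]
      exact fun t ht => EventuallyEq.eventuallyEq_nhds ht
    · rintro t ⟨ht, htW⟩
      exact hS.ident (hWX htW) ⟨W, hW, htW, hf⟩ ⟨W, hW, htW, hg⟩ (mem_closure_iff_frequently.1 ht)
  exact fun t ht => (key ht).self_of_nhds

end IsSolSheaf

end Continuation

lemma analyticAt_clm_apply {E G : Type*} [NormedAddCommGroup E] [NormedSpace ℂ E]
    [NormedAddCommGroup G] [NormedSpace ℂ G] {L : ℂ → E →L[ℂ] G} {f : ℂ → E} {t : ℂ}
    (hL : AnalyticAt ℂ L t) (hf : AnalyticAt ℂ f t) : AnalyticAt ℂ (fun τ => L τ (f τ)) t :=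
  AnalyticAt.comp (g := fun x : (E →L[ℂ] G) × E => x.1 x.2)
    ((ContinuousLinearMap.id ℂ (E →L[ℂ] G)).analyticAt_bilinear _) (hL.prod hf)

/-! ### Sections in trivializations, covariant derivative and pairing -/

section BundleBasics

variable {F ι : Type*} [NormedAddCommGroup F] [NormedSpace ℂ F]
  {V : VectorBundleCore ℂ (OnePoint ℂ) F ι} {D : OnePoint ℂ →₀ ℕ}

lemma isOpen_chart (V : VectorBundleCore ℂ (OnePoint ℂ) F ι) (i : ι) :
    IsOpen {t : ℂ | (t : OnePoint ℂ) ∈ V.baseSet i} :=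
  (V.isOpen_baseSet i).preimage OnePoint.continuous_coe

lemma isOpen_compl_support (D : OnePoint ℂ →₀ ℕ) : IsOpen {t : ℂ | (t : OnePoint ℂ) ∉ D.support} :=
  D.support.finite_toSet.isClosed.isOpen_compl.preimage OnePoint.continuous_coe

lemma coordChange_rep {i j : ι} {t : ℂ} (hi : (t : OnePoint ℂ) ∈ V.baseSet i)
    (hj : (t : OnePoint ℂ) ∈ V.baseSet j) (s : ℂ → F) :
    V.coordChange i j t (rep V i s t) = rep V j s t :=
  V.coordChange_comp _ _ _ _ ⟨⟨V.mem_baseSet_at _, hi⟩, hj⟩ _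

lemma rep_indexAt (s : ℂ → F) (t : ℂ) : rep V (V.indexAt (t : OnePoint ℂ)) s t = s t :=
  V.coordChange_self _ _ (V.mem_baseSet_at _) _

lemma coordChange_indexAt_rep {i : ι} {t : ℂ} (hi : (t : OnePoint ℂ) ∈ V.baseSet i) (s : ℂ → F) :
    V.coordChange i (V.indexAt (t : OnePoint ℂ)) t (rep V i s t) = s t := by
  rw [coordChange_rep hi (V.mem_baseSet_at _), rep_indexAt]

lemma rep_eq_iff {i : ι} {t : ℂ} (hi : (t : OnePoint ℂ) ∈ V.baseSet i) (s s' : ℂ → F) :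
    rep V i s t = rep V i s' t ↔ s t = s' t := by
  constructor
  · intro h
    rw [← coordChange_indexAt_rep hi s, ← coordChange_indexAt_rep hi s', h]
  · intro h
    simp only [rep, h]

lemma rep_add (i : ι) (s s' : ℂ → F) : rep V i (s + s') = rep V i s + rep V i s' := by
  ext t; simp [rep]

lemma rep_smul (i : ι) (k : ℂ) (s : ℂ → F) : rep V i (k • s) = k • rep V i s := by
  ext t; simp [rep]

lemma rep_zero (i : ι) : rep V i (0 : ℂ → F) = 0 := by
  ext t; simp [rep]

/-- The section whose expression in the `i`-th trivialization is `Φ`. -/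
noncomputable def ofRep (V : VectorBundleCore ℂ (OnePoint ℂ) F ι) (i : ι) (Φ : ℂ → F) (t : ℂ) : F :=
  V.coordChange i (V.indexAt (t : OnePoint ℂ)) t (Φ t)

lemma rep_ofRep {i : ι} {t : ℂ} (hi : (t : OnePoint ℂ) ∈ V.baseSet i) (Φ : ℂ → F) :
    rep V i (ofRep V i Φ) t = Φ t := by
  have := V.coordChange_comp i (V.indexAt (t : OnePoint ℂ)) i t
    ⟨⟨hi, V.mem_baseSet_at _⟩, hi⟩ (Φ t)
  rw [V.coordChange_self i _ hi] at this
  exact this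

lemma rep_dual_pairing {i : ι} {t : ℂ} (hi : (t : OnePoint ℂ) ∈ V.baseSet i)
    (δ : ℂ → (F →L[ℂ] ℂ)) (s : ℂ → F) :
    (rep (dualBundle V) i δ t) (rep V i s t) = δ t (s t) := by
  have h : rep (dualBundle V) i δ t = (δ t).comp (V.coordChange i (V.indexAt (t : OnePoint ℂ)) t) :=
    rfl
  rw [h, ContinuousLinearMap.comp_apply, coordChange_indexAt_rep hi]

variable (hV : IsHolomorphic V)

include hV in
lemma hasDerivAt_rep_change {i j : ι} {t : ℂ} (hi : (t : OnePoint ℂ) ∈ V.baseSet i)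
    (hj : (t : OnePoint ℂ) ∈ V.baseSet j) {s : ℂ → F} {v : F} (h : HasDerivAt (rep V i s) v t) :
    HasDerivAt (rep V j s) (deriv (fun τ : ℂ => V.coordChange i j (τ : OnePoint ℂ)) t (rep V i s t)
      + V.coordChange i j t v) t := by
  have h1 := (analyticAt_coordChange hV i j t ⟨hi, hj⟩).differentiableAt.hasDerivAt.clm_apply h
  refine h1.congr_of_eventuallyEq ?_
  filter_upwards [(isOpen_chart V i).mem_nhds hi, (isOpen_chart V j).mem_nhds hj] with τ h2 h3
  exact (coordChange_rep h2 h3 s).symm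

include hV in
lemma analyticAt_rep_change {i j : ι} {t : ℂ} (hi : (t : OnePoint ℂ) ∈ V.baseSet i)
    (hj : (t : OnePoint ℂ) ∈ V.baseSet j) {s : ℂ → F} (h : AnalyticAt ℂ (rep V i s) t) :
    AnalyticAt ℂ (rep V j s) t := by
  have h1 := analyticAt_clm_apply (analyticAt_coordChange hV i j t ⟨hi, hj⟩) h
  refine h1.congr ?_
  filter_upwards [(isOpen_chart V i).mem_nhds hi, (isOpen_chart V j).mem_nhds hj] with τ h2 h3
  exact coordChange_rep h2 h3 s

include hV in
-- The inhomogeneous term of the gauge rule absorbs the derivative of the transition function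
-- produced by the product rule. Flatness therefore needs checking in one chart only.
lemma flat_chart_change (conn : MeromorphicConnection V D) {i j : ι} {t : ℂ}
    (hi : (t : OnePoint ℂ) ∈ V.baseSet i) (hj : (t : OnePoint ℂ) ∈ V.baseSet j)
    (hD : (t : OnePoint ℂ) ∉ D.support) {s : ℂ → F}
    (h : HasDerivAt (rep V i s) (-(conn.A i t (rep V i s t))) t) :
    HasDerivAt (rep V j s) (-(conn.A j t (rep V j s t))) t := by
  have h1 := hasDerivAt_rep_change hV hi hj h
  have h2 := congrArg (fun L => L (rep V i s t)) (conn.gauge i j t ⟨hi, hj⟩ hD)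
  simp only [ContinuousLinearMap.comp_apply, add_apply, coordChange_rep hi hj] at h2
  rw [map_neg, h2] at h1
  convert! h1 using 1
  abel

include hV in
lemma isFlatOn_of_chart (conn : MeromorphicConnection V D) {i : ι} {W : Set ℂ}
    (hW : ∀ t ∈ W, (t : OnePoint ℂ) ∈ V.baseSet i ∧ (t : OnePoint ℂ) ∉ D.support) {s : ℂ → F}
    (h : ∀ t ∈ W, HasDerivAt (rep V i s) (-(conn.A i t (rep V i s t))) t) : conn.IsFlatOn W s :=
  fun _ t ht hj => flat_chart_change hV conn (hW t ht).1 hj (hW t ht).2 (h t ht)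

include hV in
-- `nabla` is defined through the preferred trivialization at each point, which need not vary
-- continuously. In a fixed chart it is an honest differential operator and can be iterated.
lemma rep_nabla (conn : MeromorphicConnection V D) {j : ι} {t : ℂ}
    (hj : (t : OnePoint ℂ) ∈ V.baseSet j) (hD : (t : OnePoint ℂ) ∉ D.support) {s : ℂ → F}
    (h : DifferentiableAt ℂ (rep V j s) t) :
    rep V j (conn.nabla s) t = deriv (rep V j s) t + conn.A j t (rep V j s t) := by
  have hi := V.mem_baseSet_at (t : OnePoint ℂ)
  have h1 := (hasDerivAt_rep_change hV hj hi h.hasDerivAt)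
  have h2 := congrArg (fun L => L (rep V j s t)) (conn.gauge j _ t ⟨hj, hi⟩ hD)
  simp only [ContinuousLinearMap.comp_apply, add_apply, coordChange_rep hj hi] at h2
  have h3 : conn.nabla s t = V.coordChange j (V.indexAt (t : OnePoint ℂ)) t
      (deriv (rep V j s) t + conn.A j t (rep V j s t)) := by
    rw [map_add, h2, MeromorphicConnection.nabla, h1.deriv, rep_indexAt]
    abel
  rw [rep, h3, V.coordChange_comp _ _ _ _ ⟨⟨hj, hi⟩, hj⟩, V.coordChange_self _ _ hj]

include hV in
lemma analyticAt_rep_nabla [CompleteSpace F] (conn : MeromorphicConnection V D) {j : ι} {t : ℂ}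
    (hj : (t : OnePoint ℂ) ∈ V.baseSet j) (hD : (t : OnePoint ℂ) ∉ D.support) {s : ℂ → F}
    (h : AnalyticAt ℂ (rep V j s) t) : AnalyticAt ℂ (rep V j (conn.nabla s)) t := by
  have h1 : AnalyticAt ℂ (fun τ => deriv (rep V j s) τ + conn.A j τ (rep V j s τ)) t :=
    h.deriv.add (analyticAt_clm_apply (conn.analytic j t hj hD) h)
  refine h1.congr ?_
  filter_upwards [(isOpen_chart V j).mem_nhds hj, (isOpen_compl_support D).mem_nhds hD,
    h.eventually_analyticAt] with τ h2 h3 h4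
  exact (rep_nabla hV conn h2 h3 h4.differentiableAt).symm

include hV in
lemma analyticAt_rep_iterate_nabla [CompleteSpace F] (conn : MeromorphicConnection V D) {j : ι}
    {t : ℂ} (hj : (t : OnePoint ℂ) ∈ V.baseSet j) (hD : (t : OnePoint ℂ) ∉ D.support) {s : ℂ → F}
    (h : AnalyticAt ℂ (rep V j s) t) (n : ℕ) : AnalyticAt ℂ (rep V j (conn.nabla^[n] s)) t := by
  induction n with
  | zero => exact h
  | succ n ih =>
    rw [Function.iterate_succ_apply']
    exact analyticAt_rep_nabla hV conn hj hD ih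

lemma isFlatOn_dual_iff (conn : MeromorphicConnection V D) {W : Set ℂ} {δ : ℂ → (F →L[ℂ] ℂ)} :
    (conn.dual hV).IsFlatOn W δ ↔ ∀ i, ∀ t ∈ W, (t : OnePoint ℂ) ∈ V.baseSet i →
      HasDerivAt (rep (dualBundle V) i δ) ((rep (dualBundle V) i δ t).comp (conn.A i t)) t := by
  have : ∀ i t, -((conn.dual hV).A i t (rep (dualBundle V) i δ t)) =
      (rep (dualBundle V) i δ t).comp (conn.A i t) := by
    intro i t
    change -((-precompL (conn.A i t)) (rep (dualBundle V) i δ t)) = _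
    rw [neg_apply, neg_neg, precompL_apply]
  simp only [MeromorphicConnection.IsFlatOn, this]
  rfl

include hV in
lemma isHolomorphic_dual : IsHolomorphic (dualBundle V) := by
  intro i j p hp
  have h := hV j i p hp.symm
  refine (analyticAt_neg_precompL h).neg.congr (Eventually.of_forall fun z => ?_)
  exact neg_neg (precompL (V.coordChange j i (loc p z)))

/-- The pairing of a flat section of the dual bundle with a section is compatible with `nabla`. -/
lemma hasDerivAt_pairing (conn : MeromorphicConnection V D) {t : ℂ}
    (hD : (t : OnePoint ℂ) ∉ D.support) {s : ℂ → F} {i : ι} (hi : (t : OnePoint ℂ) ∈ V.baseSet i)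
    (hs : DifferentiableAt ℂ (rep V i s) t) {δ : ℂ → (F →L[ℂ] ℂ)}
    (hδ : SolAt (conn.dual hV).IsFlatOn t δ) :
    HasDerivAt (fun τ => δ τ (s τ)) (δ t (conn.nabla s t)) t := by
  obtain ⟨W, hW, ht, hδ⟩ := hδ
  have h1 := ((isFlatOn_dual_iff hV conn).1 hδ i t ht hi).clm_apply hs.hasDerivAt
  rw [ContinuousLinearMap.comp_apply, ← map_add, add_comm, ← rep_nabla hV conn hi hD hs,
    rep_dual_pairing hi] at h1
  refine h1.congr_of_eventuallyEq ?_
  filter_upwards [(isOpen_chart V i).mem_nhds hi] with τ h2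
  exact (rep_dual_pairing h2 δ s).symm

/-- Iteration of `d⟨δ, s⟩ = ⟨δ, ∇ s⟩` for flat `δ`. The identity is carried on a neighbourhood
because the induction step differentiates it. -/
lemma iteratedDeriv_pairing [CompleteSpace F] (conn : MeromorphicConnection V D) {t : ℂ}
    (hD : (t : OnePoint ℂ) ∉ D.support) {s : ℂ → F} {i : ι} (hi : (t : OnePoint ℂ) ∈ V.baseSet i)
    (hs : AnalyticAt ℂ (rep V i s) t) {δ : ℂ → (F →L[ℂ] ℂ)}
    (hδ : SolAt (conn.dual hV).IsFlatOn t δ) (n : ℕ) :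
    ∀ᶠ u in 𝓝 t, iteratedDeriv n (fun τ => δ τ (s τ)) u = δ u ((conn.nabla^[n] s) u) := by
  induction n with
  | zero => simp
  | succ n ih =>
    filter_upwards [ih.eventually_nhds, (isOpen_chart V i).mem_nhds hi,
      (isOpen_compl_support D).mem_nhds hD, hδ.eventually,
      (analyticAt_rep_iterate_nabla hV conn hi hD hs n).eventually_analyticAt] with u h1 h2 h3 h4 h5
    rw [iteratedDeriv_succ, Function.iterate_succ_apply', EventuallyEq.deriv_eq h1]
    exact (hasDerivAt_pairing hV conn h3 h2 h5.differentiableAt h4).deriv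

end BundleBasics

/-! ### Flat sections and solutions of `ψ` obey unique continuation -/

section Sheaves

/-- If the germs at `c` differed, `f` and `g` would differ at every point of a punctured
neighbourhood of `c`; but a neighbourhood of any `t`, even `t = c`, contains points other than `c`.
-/
lemma eventuallyEq_of_frequently_eventuallyEq {G : Type*} [NormedAddCommGroup G] [NormedSpace ℂ G]
    {f g : ℂ → G} {c : ℂ} (hf : AnalyticAt ℂ f c) (hg : AnalyticAt ℂ g c)
    (h : ∃ᶠ t in 𝓝 c, f =ᶠ[𝓝 t] g) : f =ᶠ[𝓝 c] g := by
  refine (hf.frequently_eq_iff_eventually_eq hg).1 ?_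
  intro hne
  refine h ?_
  have h1 := eventually_nhdsWithin_iff.1 hne
  filter_upwards [h1.eventually_nhds] with t ht h2
  have h3 : ∀ᶠ u in 𝓝 t, u = c := by
    filter_upwards [ht, h2] with u h4 h5
    by_contra hu
    exact h4 hu h5
  have h4 := mem_closure_iff_frequently.1 (dense_compl_singleton c t)
  exact h4 (h3.mono fun u hu => by simp [hu])

variable {F ι : Type*} [NormedAddCommGroup F] [NormedSpace ℂ F] [CompleteSpace F]
  {V : VectorBundleCore ℂ (OnePoint ℂ) F ι} {D : OnePoint ℂ →₀ ℕ}

lemma analyticAt_of_solAt (conn : MeromorphicConnection V D) {t : ℂ} {i : ι}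
    (hi : (t : OnePoint ℂ) ∈ V.baseSet i) {s : ℂ → F} (h : SolAt conn.IsFlatOn t s) :
    AnalyticAt ℂ (rep V i s) t := by
  obtain ⟨W, hW, ht, h⟩ := h
  refine DifferentiableOn.analyticAt (s := W ∩ {t : ℂ | (t : OnePoint ℂ) ∈ V.baseSet i}) ?_
    ((hW.inter (isOpen_chart V i)).mem_nhds ⟨ht, hi⟩)
  exact fun τ hτ => (h i τ hτ.1 hτ.2).differentiableAt.differentiableWithinAt

lemma isSolSheaf_isFlatOn (conn : MeromorphicConnection V D) (X : Set ℂ) :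
    IsSolSheaf X conn.IsFlatOn where
  mono h hf i t ht hi := hf i t (h ht) hi
  congr {W f g} hW hfg hf i t ht hi := by
    have h1 : rep V i f =ᶠ[𝓝 t] rep V i g := by
      filter_upwards [hW.mem_nhds ht] with τ hτ
      simp only [rep, hfg hτ]
    rw [← h1.self_of_nhds]
    exact (hf i t ht hi).congr_of_eventuallyEq h1.symm
  zero W i t ht hi := by
    rw [rep_zero]
    simp [Pi.zero_def, hasDerivAt_const]
  add _ hf hg i t ht hi := by
    rw [rep_add]
    convert! (hf i t ht hi).add (hg i t ht hi) using 1
    rw [Pi.add_apply, map_add, neg_add]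
  smul k _ hf i t ht hi := by
    rw [rep_smul]
    convert! (hf i t ht hi).const_smul k using 1
    rw [Pi.smul_apply, map_smul, smul_neg]
  ident {c f g} hc hf hg h := by
    have hi := V.mem_baseSet_at (c : OnePoint ℂ)
    have h1 : rep V (V.indexAt (c : OnePoint ℂ)) f =ᶠ[𝓝 c] rep V (V.indexAt (c : OnePoint ℂ)) g := by
      refine eventuallyEq_of_frequently_eventuallyEq (analyticAt_of_solAt conn hi hf)
        (analyticAt_of_solAt conn hi hg) (h.mono fun t ht => ?_)
      filter_upwards [ht] with τ hτ
      simp only [rep, hτ]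
    filter_upwards [h1, (isOpen_chart V _).mem_nhds hi] with τ h2 h3
    exact (rep_eq_iff h3 f g).1 h2

lemma isSolSheaf_isSolOn {α : ℕ} (ψ : LinearODE α) (X : Set ℂ) : IsSolSheaf X ψ.IsSolOn where
  mono h hf := ⟨hf.1.mono h, fun t ht => hf.2 t (h ht)⟩
  congr {W f g} hW hfg hf := by
    have h1 : ∀ t ∈ W, f =ᶠ[𝓝 t] g := fun t ht => by
      filter_upwards [hW.mem_nhds ht] with τ hτ using hfg hτ
    refine ⟨fun t ht => (hf.1 t ht).congr (h1 t ht), fun t ht => ?_⟩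
    have h2 := hf.2 t ht
    simpa only [(h1 t ht).iteratedDeriv_eq] using h2
  zero W := by
    refine ⟨fun t _ => analyticAt_const, fun t _ => ?_⟩
    have h : ∀ n, iteratedDeriv n (0 : ℂ → ℂ) t = 0 := fun n => by
      have := iteratedDeriv_const (n := n) (c := (0 : ℂ)) (x := t)
      rw [show (0 : ℂ → ℂ) = fun _ => 0 from rfl, this]
      simp
    simp [h]
  add {W f g} hW hf hg := by
    refine ⟨hf.1.add hg.1, fun t ht => ?_⟩
    have h : ∀ n, iteratedDeriv n (f + g) t = iteratedDeriv n f t + iteratedDeriv n g t :=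
      fun n => iteratedDeriv_add (hf.1 t ht).contDiffAt (hg.1 t ht).contDiffAt
    simp only [h, mul_add, Finset.sum_add_distrib]
    linear_combination hf.2 t ht + hg.2 t ht
  smul {W f} k hW hf := by
    refine ⟨fun t ht => analyticAt_const.smul (hf.1 t ht), fun t ht => ?_⟩
    have h : ∀ n, iteratedDeriv n (k • f) t = k * iteratedDeriv n f t := fun n => by
      rw [iteratedDeriv_const_smul_field, smul_eq_mul]
    have h2 := hf.2 t ht
    simp only [h, mul_left_comm _ k, ← Finset.mul_sum]
    linear_combination k * h2
  ident {c f g} hc hf hg h := by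
    obtain ⟨W, hW, ht, hf⟩ := hf
    obtain ⟨W', hW', ht', hg⟩ := hg
    exact eventuallyEq_of_frequently_eventuallyEq (hf.1 c ht) (hg.1 c ht') h

end Sheaves

/-! ### Comparison of two problems with the same monodromy -/

section Monodromy

variable {G H : Type*} [AddCommGroup G] [Module ℂ G] [AddCommGroup H] [Module ℂ H]
  {X : Set ℂ} {α : ℕ}

/-- The germs of the `f k` at `t` are linearly independent. -/
def GermIndep (t : ℂ) (f : Fin α → ℂ → G) : Prop :=
  ∀ k : Fin α → ℂ, (∑ l, k l • f l) =ᶠ[𝓝 t] 0 → k = 0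

lemma IsSolSheaf.germIndep_of_indepOn {Sol : Set ℂ → (ℂ → G) → Prop} (hS : IsSolSheaf X Sol)
    {W : Set ℂ} (hW : IsOpen W) (hWX : W ⊆ X) (hc : IsPreconnected W) {f : Fin α → ℂ → G}
    (hf : ∀ k, Sol W (f k)) (hi : IndepOn W f) {t : ℂ} (ht : t ∈ W) : GermIndep t f := by
  intro k hk
  have h1 := hS.eqOn_of_eventuallyEq hW hWX hc (hS.sum hW hf Finset.univ k) (hS.zero W) ht hk
  refine funext (Fintype.linearIndependent_iff.1 hi k ?_)
  ext u
  have := h1 u.2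
  simpa using this

/-- A relation between the final germs, continued back along the reversed path, becomes a relation
between the initial ones, by uniqueness against the zero continuation. -/
lemma IsSolSheaf.germIndep_continuesAlong {Sol : Set ℂ → (ℂ → G) → Prop} (hS : IsSolSheaf X Sol)
    {a b : ℂ} {γ : Path a b} (hγ : ∀ τ, γ τ ∈ X) {f g : Fin α → ℂ → G}
    (h : ∀ k, ContinuesAlong Sol γ (f k) (g k)) (hf : GermIndep a f) : GermIndep b g := by
  intro k hk
  refine hf k ?_
  exact hS.continuesAlong_unique (γ := γ.symm) (fun τ => hγ _) (hS.continuesAlong_sum h k).symm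
    (ContinuesAlong.const fun τ => hS.solAt_zero _) hk

lemma ContinuesAlong.solAt_right {Sol : Set ℂ → (ℂ → G) → Prop} (hS : IsSolSheaf X Sol)
    {a b : ℂ} {γ : Path a b} {f g : ℂ → G} (h : ContinuesAlong Sol γ f g) : SolAt Sol b g := by
  obtain ⟨Φ, -, h1, h⟩ := h
  have := (h 1).1
  rw [γ.target] at this
  exact hS.solAt_congr this h1

/-- Local extension of solution germs to a neighbourhood independent of the germ. -/
def HasLocalExtension (X : Set ℂ) (Sol : Set ℂ → (ℂ → G) → Prop) : Prop :=
  ∀ c ∈ X, ∃ U, IsOpen U ∧ c ∈ U ∧ ∀ t ∈ U, ∀ f, SolAt Sol t f → ∃ g, Sol U g ∧ g =ᶠ[𝓝 t] f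

omit [AddCommGroup G] [Module ℂ G] in
lemma exists_continuation_step {Sol : Set ℂ → (ℂ → G) → Prop}
    {U : Set ℂ} (hU : IsOpen U) (hext : ∀ t ∈ U, ∀ f, SolAt Sol t f → ∃ g, Sol U g ∧ g =ᶠ[𝓝 t] f)
    {c : ℂ} {r : ℝ} (hB : Metric.ball c r ⊆ U ∩ X) {t t' : ℂ} (ht : t ∈ Metric.ball c r)
    (ht' : t' ∈ Metric.ball c r) :
    ∃ γ : Path t t', (∀ τ, γ τ ∈ X) ∧ ∀ f, SolAt Sol t f → ∃ g, ContinuesAlong Sol γ f g := by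
  have hr : 0 < r := dist_nonneg.trans_lt (Metric.mem_ball.1 ht)
  have hj := ((convex_ball c r).isPathConnected ⟨c, Metric.mem_ball_self hr⟩).joinedIn t ht t' ht'
  refine ⟨hj.somePath, fun τ => (hB (hj.somePath_mem τ)).2, fun f hf => ?_⟩
  obtain ⟨g, hg, hgf⟩ := hext t (hB ht).1 f hf
  refine ⟨g, (ContinuesAlong.const (f := g) fun τ => ?_).congr hgf EventuallyEq.rfl⟩
  exact ⟨U, hU, (hB (hj.somePath_mem τ)).1, hg⟩

lemma path_trans_mem {a b c : ℂ} {γ : Path a b} {γ' : Path b c} (h : ∀ τ, γ τ ∈ X)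
    (h' : ∀ τ, γ' τ ∈ X) : ∀ τ, γ.trans γ' τ ∈ X := by
  intro τ
  have : γ.trans γ' τ ∈ range (γ.trans γ') := mem_range_self _
  rw [Path.trans_range] at this
  rcases this with ⟨σ, hσ⟩ | ⟨σ, hσ⟩
  · exact hσ ▸ h σ
  · exact hσ ▸ h' σ

/-- The points reachable by a path along which all of the `δ k` continue form a set that is open and
relatively closed in `X`, since near each point of `X` germs extend to a common neighbourhood. -/
lemma exists_continuation {Sol : Set ℂ → (ℂ → G) → Prop} (hS : IsSolSheaf X Sol) (hX : IsOpen X)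
    (hc : IsPreconnected X) (hext : HasLocalExtension X Sol) {b : ℂ} (hb : b ∈ X)
    {δ : Fin α → ℂ → G} (hδ : ∀ k, SolAt Sol b (δ k)) {t : ℂ} (ht : t ∈ X) :
    ∃ γ : Path b t, (∀ τ, γ τ ∈ X) ∧ ∃ Δ : Fin α → ℂ → G, ∀ k, ContinuesAlong Sol γ (δ k) (Δ k) := by
  let S : Set ℂ := {t | ∃ γ : Path b t, (∀ τ, γ τ ∈ X) ∧
    ∃ Δ : Fin α → ℂ → G, ∀ k, ContinuesAlong Sol γ (δ k) (Δ k)}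
  have hstep : ∀ c ∈ X, ∃ r > 0, ∀ t ∈ Metric.ball c r, ∀ t' ∈ Metric.ball c r,
      t ∈ S → t' ∈ S := by
    intro c hcX
    obtain ⟨U, hU, hcU, hUe⟩ := hext c hcX
    obtain ⟨r, hr, hB⟩ := Metric.isOpen_iff.1 (hU.inter hX) c ⟨hcU, hcX⟩
    refine ⟨r, hr, ?_⟩
    rintro t ht t' ht' ⟨γ, hγ, Δ, hΔ⟩
    obtain ⟨γ', hγ', h⟩ := exists_continuation_step hU hUe hB ht ht'
    choose Δ' hΔ' using fun k => h (Δ k) ((hΔ k).solAt_right hS)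
    exact ⟨γ.trans γ', path_trans_mem hγ hγ', Δ', fun k => (hΔ k).trans (hΔ' k)⟩
  have hSX : S ⊆ X := by
    rintro t ⟨γ, hγ, -⟩
    simpa using hγ 1
  refine hc.subset_of_closure_inter_subset (u := S) ?_ ⟨b, hb, ?_⟩ ?_ ht
  · rw [Metric.isOpen_iff]
    intro t ht
    obtain ⟨r, hr, h⟩ := hstep t (hSX ht)
    exact ⟨r, hr, fun t' ht' => h t (Metric.mem_ball_self hr) t' ht' ht⟩
  · exact ⟨Path.refl b, fun _ => hb, δ, fun k => ContinuesAlong.const fun τ => hδ k⟩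
  · rintro c ⟨hcS, hcX⟩
    obtain ⟨r, hr, h⟩ := hstep c hcX
    obtain ⟨t, htS, ht⟩ := Metric.mem_closure_iff.1 hcS r hr
    exact h t (Metric.mem_ball'.2 ht) c (Metric.mem_ball_self hr) htS

/-- `Δ` and `E` are the continuations of `δ` and `e` along one and the same path in `X`. -/
def JointContinuation (Sol₁ : Set ℂ → (ℂ → G) → Prop) (Sol₂ : Set ℂ → (ℂ → H) → Prop) (X : Set ℂ)
    (b : ℂ) (δ : Fin α → ℂ → G) (e : Fin α → ℂ → H) (t : ℂ) (Δ : Fin α → ℂ → G)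
    (E : Fin α → ℂ → H) : Prop :=
  ∃ γ : Path b t, (∀ τ, γ τ ∈ X) ∧ (∀ k, ContinuesAlong Sol₁ γ (δ k) (Δ k)) ∧
    ∀ k, ContinuesAlong Sol₂ γ (e k) (E k)

variable {Sol₁ : Set ℂ → (ℂ → G) → Prop} {Sol₂ : Set ℂ → (ℂ → H) → Prop} {b : ℂ}
  {δ : Fin α → ℂ → G} {e : Fin α → ℂ → H}

/-- Appending a short segment inside a ball where all germs remain solutions leaves `Δ` and `E`
unchanged. Thus a single choice of them describes `ω` on a whole neighbourhood. -/
lemma JointContinuation.eventually (hS₁ : IsSolSheaf X Sol₁) (hS₂ : IsSolSheaf X Sol₂)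
    (hX : IsOpen X) {t : ℂ} {Δ : Fin α → ℂ → G} {E : Fin α → ℂ → H}
    (h : JointContinuation Sol₁ Sol₂ X b δ e t Δ E) :
    ∀ᶠ u in 𝓝 t, JointContinuation Sol₁ Sol₂ X b δ e u Δ E := by
  obtain ⟨γ, hγ, h1, h2⟩ := h
  have htX : t ∈ X := by simpa using hγ 1
  have h3 : ∀ᶠ u in 𝓝 t, u ∈ X ∧ ∀ k, SolAt Sol₁ u (Δ k) ∧ SolAt Sol₂ u (E k) := by
    refine Eventually.and (hX.mem_nhds htX) (eventually_all.2 fun k => ?_)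
    exact ((h1 k).solAt_right hS₁).eventually.and ((h2 k).solAt_right hS₂).eventually
  obtain ⟨r, hr, hB⟩ := Metric.eventually_nhds_iff_ball.1 h3
  filter_upwards [Metric.ball_mem_nhds t hr] with u hu
  have hj := ((convex_ball t r).isPathConnected ⟨t, Metric.mem_ball_self hr⟩).joinedIn t
    (Metric.mem_ball_self hr) u hu
  refine ⟨γ.trans hj.somePath, path_trans_mem hγ fun τ => (hB _ (hj.somePath_mem τ)).1,
    fun k => (h1 k).trans (ContinuesAlong.const fun τ => ((hB _ (hj.somePath_mem τ)).2 k).1),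
    fun k => (h2 k).trans (ContinuesAlong.const fun τ => ((hB _ (hj.somePath_mem τ)).2 k).2)⟩

/-- Continuability is required only of the first problem; for the second it comes out of the
equality of monodromy. -/
lemma exists_jointContinuation (hS₁ : IsSolSheaf X Sol₁)
    (hX : IsOpen X) (hc : IsPreconnected X) (hext : HasLocalExtension X Sol₁) (hb : b ∈ X)
    (hδ : ∀ k, SolAt Sol₁ b (δ k))
    (hmon : ∀ γ : Path b b, (∀ τ, γ τ ∈ X) → ∀ M : Matrix (Fin α) (Fin α) ℂ,
      HasMonodromy Sol₁ γ δ M ↔ HasMonodromy Sol₂ γ e M) {t : ℂ} (ht : t ∈ X) :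
    ∃ Δ E, JointContinuation Sol₁ Sol₂ X b δ e t Δ E := by
  obtain ⟨γ, hγ, Δ, hΔ⟩ := exists_continuation hS₁ hX hc hext hb hδ ht
  -- Out and back, `δ` has trivial monodromy, hence so does `e`. In particular `e` continues along
  -- this loop, and therefore along its first half `γ`.
  have h1 : HasMonodromy Sol₁ (γ.trans γ.symm) δ 1 := by
    intro k
    have : ∑ l, (1 : Matrix (Fin α) (Fin α) ℂ) k l • δ l = δ k := by
      simp [Matrix.one_apply]
    rw [this]
    exact (hΔ k).trans (hΔ k).symm
  have h2 := (hmon _ (path_trans_mem hγ fun τ => hγ _) 1).1 h1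
  choose E hE _ using fun k => (h2 k).split
  exact ⟨Δ, E, γ, hγ, hΔ, hE⟩

/-- The matrix that relates `Δ'` to `Δ` is the monodromy matrix of `δ` along the loop out by `γ'`
and back by `γ`. The hypothesis gives `e` the same matrix, and continuing forward again relates `E'`
to `E`. -/
lemma JointContinuation.exists_matrix (hS₁ : IsSolSheaf X Sol₁) (hS₂ : IsSolSheaf X Sol₂)
    (hδ : GermIndep b δ)
    (hspan : ∀ t ∈ X, ∀ Δ : Fin α → ℂ → G, (∀ k, SolAt Sol₁ t (Δ k)) → GermIndep t Δ →
      ∀ f, SolAt Sol₁ t f → ∃ n : Fin α → ℂ, f =ᶠ[𝓝 t] ∑ l, n l • Δ l)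
    (hmon : ∀ γ : Path b b, (∀ τ, γ τ ∈ X) → ∀ M : Matrix (Fin α) (Fin α) ℂ,
      HasMonodromy Sol₁ γ δ M ↔ HasMonodromy Sol₂ γ e M) {t : ℂ} (ht : t ∈ X)
    {Δ Δ' : Fin α → ℂ → G} {E E' : Fin α → ℂ → H}
    (h : JointContinuation Sol₁ Sol₂ X b δ e t Δ E)
    (h' : JointContinuation Sol₁ Sol₂ X b δ e t Δ' E') :
    ∃ N : Matrix (Fin α) (Fin α) ℂ, ∀ k, Δ' k =ᶠ[𝓝 t] ∑ l, N k l • Δ l ∧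
      E' k =ᶠ[𝓝 t] ∑ l, N k l • E l := by
  obtain ⟨γ, hγ, hΔ, hE⟩ := h
  obtain ⟨γ', hγ', hΔ', hE'⟩ := h'
  choose N hN using fun k => hspan t ht Δ (fun l => (hΔ l).solAt_right hS₁)
    (hS₁.germIndep_continuesAlong hγ hΔ hδ) (Δ' k) ((hΔ' k).solAt_right hS₁)
  refine ⟨Matrix.of N, fun k => ⟨hN k, ?_⟩⟩
  have h1 : HasMonodromy Sol₁ (γ'.trans γ.symm) δ (Matrix.of N) := by
    intro k
    refine (hΔ' k).trans (ContinuesAlong.congr (f := ∑ l, N k l • Δ l) ?_ (hN k).symm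
      EventuallyEq.rfl)
    exact (hS₁.continuesAlong_sum hΔ (N k)).symm
  have h2 := (hmon _ (path_trans_mem hγ' fun τ => hγ _) _).1 h1 k
  obtain ⟨g, hg, hg'⟩ := h2.split
  have h3 : g =ᶠ[𝓝 t] ∑ l, N k l • E l :=
    hS₂.continuesAlong_unique hγ (by simpa using hg'.symm) (hS₂.continuesAlong_sum hE (N k))
      EventuallyEq.rfl
  exact (hS₂.continuesAlong_unique hγ' (hE' k) hg EventuallyEq.rfl).trans h3

end Monodromy

/-! ### Frames of flat sections of the dual bundle -/

section Frames

variable {F ι : Type*} [NormedAddCommGroup F] [NormedSpace ℂ F] [FiniteDimensional ℂ F]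
  {V : VectorBundleCore ℂ (OnePoint ℂ) F ι} {D : OnePoint ℂ →₀ ℕ} (hV : IsHolomorphic V)
  (conn : MeromorphicConnection V D)

/-- `Y` is a frame of flat sections of the dual bundle over `U`, expressed in the `i`-th
trivialization, and `X` is its inverse. -/
structure IsDualFrame (i : ι) (U : Set ℂ) (Y X : ℂ → F →L[ℂ] F) : Prop where
  isOpen : IsOpen U
  chart : ∀ t ∈ U, (t : OnePoint ℂ) ∈ V.baseSet i
  regular : ∀ t ∈ U, (t : OnePoint ℂ) ∉ D.support
  hasDerivAt : ∀ t ∈ U, HasDerivAt Y (Y t * conn.A i t) t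
  hasDerivAt_inv : ∀ t ∈ U, HasDerivAt X (-(conn.A i t * X t)) t
  mul_inv : ∀ t ∈ U, Y t * X t = 1
  inv_mul : ∀ t ∈ U, X t * Y t = 1

lemma exists_isDualFrame {i : ι} {U : Set ℂ} (hU : IsOpen U) (hc : Convex ℝ U) (hne : U.Nonempty)
    (h : ∀ t ∈ U, (t : OnePoint ℂ) ∈ V.baseSet i ∧ (t : OnePoint ℂ) ∉ D.support) :
    ∃ Y X, IsDualFrame conn i U Y X := by
  obtain ⟨Y, X, h1, h2, h3, h4⟩ := exists_frame hU hc hne (A := conn.A i) fun t ht =>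
    (conn.analytic i t (h t ht).1 (h t ht).2).differentiableAt.differentiableWithinAt
  exact ⟨Y, X, hU, fun t ht => (h t ht).1, fun t ht => (h t ht).2, h1, h2, h3, h4⟩

omit [FiniteDimensional ℂ F] in
lemma exists_ball_chart {i : ι} {t : ℂ} (hi : (t : OnePoint ℂ) ∈ V.baseSet i)
    (hD : (t : OnePoint ℂ) ∉ D.support) : ∃ r > 0, ∀ u ∈ Metric.ball t r,
      (u : OnePoint ℂ) ∈ V.baseSet i ∧ (u : OnePoint ℂ) ∉ D.support :=
  Metric.eventually_nhds_iff_ball.1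
    (Eventually.and ((isOpen_chart V i).mem_nhds hi) ((isOpen_compl_support D).mem_nhds hD))

lemma exists_isDualFrame_ball {i : ι} {t : ℂ} (hi : (t : OnePoint ℂ) ∈ V.baseSet i)
    (hD : (t : OnePoint ℂ) ∉ D.support) :
    ∃ r > 0, ∃ Y X, IsDualFrame conn i (Metric.ball t r) Y X := by
  obtain ⟨r, hr, h⟩ := exists_ball_chart hi hD
  exact ⟨r, hr, exists_isDualFrame conn Metric.isOpen_ball (convex_ball _ _)
    ⟨t, Metric.mem_ball_self hr⟩ h⟩

variable {conn}

namespace IsDualFrame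

variable {i : ι} {U : Set ℂ} {Y X : ℂ → F →L[ℂ] F} (hY : IsDualFrame conn i U Y X)
include hY

lemma analyticAt_inv {t : ℂ} (ht : t ∈ U) : AnalyticAt ℂ X t := by
  have : CompleteSpace F := FiniteDimensional.complete ℂ F
  exact DifferentiableOn.analyticAt
    (fun u hu => (hY.hasDerivAt_inv u hu).differentiableAt.differentiableWithinAt)
    (hY.isOpen.mem_nhds ht)

omit [FiniteDimensional ℂ F] in
lemma apply_inv {t : ℂ} (ht : t ∈ U) (v : F) : Y t (X t v) = v :=
  congrArg (fun L => L v) (hY.mul_inv t ht)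

omit [FiniteDimensional ℂ F] in
lemma inv_apply {t : ℂ} (ht : t ∈ U) (v : F) : X t (Y t v) = v :=
  congrArg (fun L => L v) (hY.inv_mul t ht)

omit [FiniteDimensional ℂ F] in
/-- The flat section with constant coordinates `k` in the frame. -/
lemma isFlatOn (k : F →L[ℂ] ℂ) :
    (conn.dual hV).IsFlatOn U (ofRep (dualBundle V) i fun t => k.comp (Y t)) := by
  refine isFlatOn_of_chart (isHolomorphic_dual hV) (conn.dual hV) (i := i)
    (fun t ht => ⟨hY.chart t ht, hY.regular t ht⟩) fun t ht => ?_
  have h1 : ∀ u ∈ U, rep (dualBundle V) i (ofRep (dualBundle V) i fun t => k.comp (Y t)) u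
      = k.comp (Y u) := fun u hu => rep_ofRep (V := dualBundle V) (hY.chart u hu) _
  rw [h1 t ht]
  have h2 : HasDerivAt (fun u => k.comp (Y u)) (k.comp (Y t * conn.A i t)) t := by
    have := (hasDerivAt_const t k).clm_comp (hY.hasDerivAt t ht)
    simpa using this
  have h3 : -((conn.dual hV).A i t (k.comp (Y t))) = k.comp (Y t * conn.A i t) := by
    change -((-precompL (conn.A i t)) (k.comp (Y t))) = _
    rw [neg_apply, neg_neg, precompL_apply]
    rfl
  rw [h3]
  refine h2.congr_of_eventuallyEq ?_
  filter_upwards [hY.isOpen.mem_nhds ht] with u hu using h1 u hu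

omit [FiniteDimensional ℂ F] in
/-- Flat sections of the dual bundle have constant coordinates in the frame. -/
lemma exists_coord {W : Set ℂ} (hW : IsOpen W) (hc : IsPreconnected W) (hWU : W ⊆ U)
    {δ : ℂ → (F →L[ℂ] ℂ)} (hδ : (conn.dual hV).IsFlatOn W δ) :
    ∃ k : F →L[ℂ] ℂ, ∀ t ∈ W, rep (dualBundle V) i δ t = k.comp (Y t) := by
  have hd : ∀ t ∈ W, HasDerivAt (fun u => (rep (dualBundle V) i δ u).comp (X u)) 0 t := by
    intro t ht
    have h1 := ((isFlatOn_dual_iff hV conn).1 hδ i t ht (hY.chart t (hWU ht))).clm_comp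
      (hY.hasDerivAt_inv t (hWU ht))
    refine h1.congr_deriv ?_
    ext v
    simp
  obtain ⟨k, hk⟩ := hW.exists_is_const_of_deriv_eq_zero hc
    (fun t ht => (hd t ht).differentiableAt.differentiableWithinAt) (fun t ht => (hd t ht).deriv)
  refine ⟨k, fun t ht => ?_⟩
  rw [← hk t ht]
  ext v
  simp [hY.inv_apply (hWU ht)]

end IsDualFrame

omit [FiniteDimensional ℂ F] in
lemma exists_flat_eventuallyEq {i : ι} {U : Set ℂ} {Y X : ℂ → F →L[ℂ] F}
    (hY : IsDualFrame conn i U Y X) {t : ℂ} (ht : t ∈ U) {δ : ℂ → (F →L[ℂ] ℂ)}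
    (hδ : SolAt (conn.dual hV).IsFlatOn t δ) :
    ∃ k : F →L[ℂ] ℂ, ∀ᶠ u in 𝓝 t, rep (dualBundle V) i δ u = k.comp (Y u) := by
  obtain ⟨W, hW, htW, hδ⟩ := hδ
  obtain ⟨r, hr, hB⟩ := Metric.isOpen_iff.1 (hW.inter hY.isOpen) t ⟨htW, ht⟩
  obtain ⟨k, hk⟩ := hY.exists_coord hV Metric.isOpen_ball (convex_ball t r).isPreconnected
    (hB.trans inter_subset_right) (fun j u hu => hδ j u (hB hu).1)
  refine ⟨k, ?_⟩
  filter_upwards [Metric.ball_mem_nhds t hr] with u hu using hk u hu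

variable (conn) in
-- In a frame over a ball every flat germ has constant coordinates, and constant coordinates define
-- a flat section over the whole ball.
lemma hasLocalExtension_flat {X : Set ℂ} (hX : ∀ t ∈ X, (t : OnePoint ℂ) ∉ D.support) :
    HasLocalExtension X (conn.dual hV).IsFlatOn := by
  intro c hc
  obtain ⟨r, hr, Y, X, hY⟩ := exists_isDualFrame_ball conn (V.mem_baseSet_at (c : OnePoint ℂ))
    (hX c hc)
  refine ⟨_, Metric.isOpen_ball, Metric.mem_ball_self hr, fun t ht δ hδ => ?_⟩
  obtain ⟨k, hk⟩ := exists_flat_eventuallyEq hV hY ht hδ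
  refine ⟨_, hY.isFlatOn hV k, ?_⟩
  filter_upwards [hk, hY.isOpen.mem_nhds ht] with u h1 h2
  exact (rep_eq_iff (V := dualBundle V) (hY.chart u h2) _ _).1
    ((rep_ofRep (V := dualBundle V) (hY.chart u h2) _).trans h1.symm)

/-- The frame is invertible at `t`, so vanishing at `t` forces the constant coordinates to vanish.
-/
lemma eventuallyEq_zero_of_apply_eq_zero {t : ℂ} (hD : (t : OnePoint ℂ) ∉ D.support)
    {δ : ℂ → (F →L[ℂ] ℂ)} (hδ : SolAt (conn.dual hV).IsFlatOn t δ) (h0 : δ t = 0) :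
    δ =ᶠ[𝓝 t] 0 := by
  obtain ⟨r, hr, Y, X, hY⟩ := exists_isDualFrame_ball conn (V.mem_baseSet_at (t : OnePoint ℂ)) hD
  have ht := Metric.mem_ball_self (x := t) hr
  obtain ⟨k, hk⟩ := exists_flat_eventuallyEq hV hY ht hδ
  have h1 : k = 0 := by
    ext v
    have h2 : rep (dualBundle V) (V.indexAt (t : OnePoint ℂ)) δ t = 0 :=
      (rep_indexAt (V := dualBundle V) δ t).trans h0
    have h3 := congrArg (fun L => L (X t v)) (hk.self_of_nhds.symm.trans h2)
    simpa [hY.apply_inv ht] using h3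
  filter_upwards [hk, hY.isOpen.mem_nhds ht] with u h2 h3
  refine (rep_eq_iff (V := dualBundle V) (hY.chart u h3) _ _).1 ?_
  rw [h2, h1, rep_zero]
  simp

end Frames

/-! ### Dimension counts and the construction of the section -/

section Rank

variable {ι : Type*} {α : ℕ} {V : VectorBundleCore ℂ (OnePoint ℂ) (Fin α → ℂ) ι}
  {D : OnePoint ℂ →₀ ℕ} (hV : IsHolomorphic V) (conn : MeromorphicConnection V D)

lemma finrank_clm_dual (α : ℕ) : Module.finrank ℂ ((Fin α → ℂ) →L[ℂ] ℂ) = α := by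
  rw [← (LinearMap.toContinuousLinearMap (𝕜 := ℂ) (E := Fin α → ℂ) (F' := ℂ)).finrank_eq,
    Module.finrank_linearMap]
  simp

lemma linearIndependent_apply {t : ℂ} (hD : (t : OnePoint ℂ) ∉ D.support)
    {Δ : Fin α → ℂ → ((Fin α → ℂ) →L[ℂ] ℂ)} (hΔ : ∀ k, SolAt (conn.dual hV).IsFlatOn t (Δ k))
    (hi : GermIndep t Δ) : LinearIndependent ℂ fun k => Δ k t := by
  rw [Fintype.linearIndependent_iff]
  intro k hk
  refine congrFun (hi k (eventuallyEq_zero_of_apply_eq_zero hV (conn := conn) hD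
    ((isSolSheaf_isFlatOn (conn.dual hV) univ).solAt_sum hΔ _ k) ?_))
  simpa using hk

lemma exists_eq_sum_of_linearIndependent {f : Fin α → (Fin α → ℂ) →L[ℂ] ℂ}
    (hf : LinearIndependent ℂ f) (g : (Fin α → ℂ) →L[ℂ] ℂ) : ∃ n : Fin α → ℂ, g = ∑ l, n l • f l := by
  have h1 : Submodule.span ℂ (range f) = ⊤ :=
    hf.span_eq_top_of_card_eq_finrank' (by rw [finrank_clm_dual, Fintype.card_fin])
  have h2 : g ∈ Submodule.span ℂ (range f) := h1 ▸ Submodule.mem_top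
  obtain ⟨n, hn⟩ := (Submodule.mem_span_range_iff_exists_fun ℂ).1 h2
  exact ⟨n, hn.symm⟩

lemma flat_span {X : Set ℂ} (hX : ∀ t ∈ X, (t : OnePoint ℂ) ∉ D.support) :
    ∀ t ∈ X, ∀ Δ : Fin α → ℂ → ((Fin α → ℂ) →L[ℂ] ℂ),
      (∀ k, SolAt (conn.dual hV).IsFlatOn t (Δ k)) → GermIndep t Δ →
      ∀ f, SolAt (conn.dual hV).IsFlatOn t f → ∃ n : Fin α → ℂ, f =ᶠ[𝓝 t] ∑ l, n l • Δ l := by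
  intro t ht Δ hΔ hi f hf
  have hS := isSolSheaf_isFlatOn (conn.dual hV) univ
  obtain ⟨n, hn⟩ := exists_eq_sum_of_linearIndependent
    (linearIndependent_apply hV conn (hX t ht) hΔ hi) (f t)
  refine ⟨n, ?_⟩
  have h1 := eventuallyEq_zero_of_apply_eq_zero hV (conn := conn) (hX t ht)
    (hS.solAt_add hf (hS.solAt_smul (-1) (hS.solAt_sum hΔ Finset.univ n))) (by simp [hn])
  filter_upwards [h1] with u hu
  have : f u + -1 • (∑ l, n l • Δ l) u = 0 := by simpa using hu
  simpa [add_neg_eq_zero] using this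

lemma eq_of_forall_apply_eq {f : Fin α → (Fin α → ℂ) →L[ℂ] ℂ} (hf : LinearIndependent ℂ f)
    {v w : Fin α → ℂ} (h : ∀ k, f k v = f k w) : v = w := by
  ext j
  obtain ⟨n, hn⟩ := exists_eq_sum_of_linearIndependent hf (ContinuousLinearMap.proj j)
  have : ∀ x : Fin α → ℂ, x j = ∑ l, n l • f l x := fun x => by
    have := congrArg (fun L => L x) hn
    simpa using this
  rw [this v, this w]
  simp only [h]

lemma exists_forall_apply_eq {f : Fin α → (Fin α → ℂ) →L[ℂ] ℂ} (hf : LinearIndependent ℂ f)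
    (c : Fin α → ℂ) : ∃ v, ∀ k, f k v = c k := by
  let L : (Fin α → ℂ) →ₗ[ℂ] (Fin α → ℂ) := LinearMap.pi fun k => (f k : (Fin α → ℂ) →ₗ[ℂ] ℂ)
  have hinj : Function.Injective L := fun v w h =>
    eq_of_forall_apply_eq hf fun k => congrFun h k
  obtain ⟨v, hv⟩ := LinearMap.injective_iff_surjective.1 hinj c
  exact ⟨v, fun k => congrFun hv k⟩

lemma isOpen_regularSet (D : OnePoint ℂ →₀ ℕ) (Z : Finset ℂ) : IsOpen (regularSet D Z) :=
  (isOpen_compl_support D).inter Z.finite_toSet.isClosed.isOpen_compl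

/-- The complement of a countable set in a real vector space of dimension greater than one is
connected. -/
lemma isPreconnected_regularSet (D : OnePoint ℂ →₀ ℕ) (Z : Finset ℂ) :
    IsPreconnected (regularSet D Z) := by
  have h1 : ({t : ℂ | (t : OnePoint ℂ) ∈ D.support} ∪ Z).Countable := by
    refine Countable.union ?_ Z.countable_toSet
    exact (D.support.finite_toSet.preimage OnePoint.coe_injective.injOn).countable
  have h2 := (h1.isConnected_compl_of_one_lt_rank (by simp)).isPreconnected
  convert! h2 using 1
  ext t
  simp [regularSet]

/-- Near `t` the section `ω` pairs with a basis of flat sections to a basis of solutions of `ψ`. -/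
def HasPeriods (ψ : LinearODE α) (ω : ℂ → (Fin α → ℂ)) (t : ℂ) : Prop :=
  ∃ (Δ : Fin α → ℂ → ((Fin α → ℂ) →L[ℂ] ℂ)) (E : Fin α → ℂ → ℂ),
    (∀ k, SolAt (conn.dual hV).IsFlatOn t (Δ k)) ∧ GermIndep t Δ ∧
    (∀ k, SolAt ψ.IsSolOn t (E k)) ∧ GermIndep t E ∧
    ∀ᶠ u in 𝓝 t, ∀ k, Δ k u (ω u) = E k u

/-- The data obtained from equality of monodromy: a section `ω` which locally pairs with a basis of
flat sections to a basis of solutions. -/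
lemma exists_section_of_sameMonodromy {Z : Finset ℂ} {ψ : LinearODE α} {b : ℂ}
    (hb : b ∈ regularSet D Z)
    (hmon : SameMonodromy α (conn.dual hV).IsFlatOn ψ.IsSolOn (regularSet D Z) b) :
    ∃ ω : ℂ → (Fin α → ℂ), ∀ t ∈ regularSet D Z, HasPeriods hV conn ψ ω t := by
  obtain ⟨r, δ, e, hr, hB, ⟨hδi, hδ⟩, ⟨hei, he⟩, hmon⟩ := hmon
  set X := regularSet D Z
  have hX : IsOpen X := isOpen_regularSet D Z
  have hXD : ∀ t ∈ X, (t : OnePoint ℂ) ∉ D.support := fun t ht => ht.1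
  have hS₁ := isSolSheaf_isFlatOn (conn.dual hV) X
  have hS₂ := isSolSheaf_isSolOn ψ X
  have hbr := Metric.mem_ball_self (x := b) hr
  have hbp := (convex_ball b r).isPreconnected
  have hδb := hS₁.germIndep_of_indepOn Metric.isOpen_ball hB hbp hδ hδi hbr
  have heb := hS₂.germIndep_of_indepOn Metric.isOpen_ball hB hbp he hei hbr
  let J := JointContinuation (conn.dual hV).IsFlatOn ψ.IsSolOn X b δ e
  have hJ : ∀ t ∈ X, ∃ Δ E, J t Δ E := fun t ht =>
    exists_jointContinuation hS₁ hX (isPreconnected_regularSet D Z)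
      (hasLocalExtension_flat hV conn hXD) hb (fun k => ⟨_, Metric.isOpen_ball, hbr, hδ k⟩) hmon ht
  have hJ1 : ∀ t ∈ X, ∀ Δ E, J t Δ E → (∀ k, SolAt (conn.dual hV).IsFlatOn t (Δ k)) ∧
      GermIndep t Δ ∧ (∀ k, SolAt ψ.IsSolOn t (E k)) ∧ GermIndep t E := by
    rintro t ht Δ E ⟨γ, hγ, h1, h2⟩
    exact ⟨fun k => (h1 k).solAt_right hS₁, hS₁.germIndep_continuesAlong hγ h1 hδb,
      fun k => (h2 k).solAt_right hS₂, hS₂.germIndep_continuesAlong hγ h2 heb⟩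
  -- One joint continuation determines `w`, since the values of `Δ` form a basis of the dual fibre.
  -- Any other is related to it by a common matrix `N` and imposes the same conditions on `w`.
  have hval : ∀ t ∈ X, ∃ w, ∀ Δ E, J t Δ E → ∀ k, Δ k t w = E k t := by
    intro t ht
    obtain ⟨Δ, E, h⟩ := hJ t ht
    obtain ⟨h1, h2, -, -⟩ := hJ1 t ht Δ E h
    obtain ⟨w, hw⟩ := exists_forall_apply_eq (linearIndependent_apply hV conn (hXD t ht) h1 h2)
      fun k => E k t
    refine ⟨w, fun Δ' E' h' k => ?_⟩
    obtain ⟨N, hN⟩ := JointContinuation.exists_matrix hS₁ hS₂ hδb (flat_span hV conn hXD) hmon ht h h'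
    rw [(hN k).1.self_of_nhds, (hN k).2.self_of_nhds]
    simp [hw]
  choose! ω hω using hval
  refine ⟨ω, fun t ht => ?_⟩
  obtain ⟨Δ, E, h⟩ := hJ t ht
  obtain ⟨h1, h2, h3, h4⟩ := hJ1 t ht Δ E h
  refine ⟨Δ, E, h1, h2, h3, h4, ?_⟩
  filter_upwards [h.eventually hS₁ hS₂ hX, hX.mem_nhds ht] with u hu huX
  exact hω u huX Δ E hu

end Rank

/-! ### Uniqueness for linear equations and Cramer's rule -/

section Uniqueness

/-- For an invertible solution `Y` of `Y' = -Y C` the product `Y v` is constant, and it vanishes at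
`c`. -/
lemma linearODE_eq_zero {F : Type*} [NormedAddCommGroup F] [NormedSpace ℂ F]
    [FiniteDimensional ℂ F] {c : ℂ} {r : ℝ} (hr : 0 < r) {C : ℂ → F →L[ℂ] F}
    (hC : DifferentiableOn ℂ C (Metric.ball c r)) {v : ℂ → F}
    (hv : ∀ t ∈ Metric.ball c r, HasDerivAt v (C t (v t)) t) (h0 : v c = 0) :
    ∀ t ∈ Metric.ball c r, v t = 0 := by
  obtain ⟨Y, X, hY, -, -, hXY⟩ := exists_frame Metric.isOpen_ball (convex_ball c r)
    ⟨c, Metric.mem_ball_self hr⟩ hC.neg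
  have hd : ∀ t ∈ Metric.ball c r, HasDerivAt (fun u => Y u (v u)) 0 t := by
    intro t ht
    refine ((hY t ht).clm_apply (hv t ht)).congr_deriv ?_
    simp
  intro t ht
  have h1 := Metric.isOpen_ball.is_const_of_deriv_eq_zero (convex_ball c r).isPreconnected
    (fun t ht => (hd t ht).differentiableAt.differentiableWithinAt)
    (fun t ht => (hd t ht).deriv) ht (Metric.mem_ball_self hr)
  have h2 : X t (Y t (v t)) = v t := congrArg (fun L => L (v t)) (hXY t ht)
  rw [← h2, h1, h0, map_zero, map_zero]

variable {α : ℕ}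

/-- The part of the companion matrix that does not depend on the equation. -/
noncomputable def companionShift (α : ℕ) : (Fin α → ℂ) →L[ℂ] (Fin α → ℂ) :=
  ContinuousLinearMap.pi fun i => if h : (i : ℕ) + 1 < α then
    ContinuousLinearMap.proj (⟨i + 1, h⟩ : Fin α) else 0

/-- The last row of the companion matrix, one entry at a time. -/
noncomputable def companionRow (k : Fin α) : (Fin α → ℂ) →L[ℂ] (Fin α → ℂ) :=
  ContinuousLinearMap.pi fun i => if (i : ℕ) + 1 < α then 0 else ContinuousLinearMap.proj k

/-- A solution of an analytic linear equation with vanishing initial values vanishes. -/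
lemma LinearODE.eventuallyEq_zero {ψ : LinearODE α} {t : ℂ} (hψ : ∀ k, AnalyticAt ℂ (ψ k) t)
    {y : ℂ → ℂ} (hy : SolAt ψ.IsSolOn t y) (h0 : ∀ i : Fin α, iteratedDeriv i y t = 0) :
    y =ᶠ[𝓝 t] 0 := by
  obtain ⟨W, hW, htW, hy⟩ := hy
  -- In order zero there is no initial value to read `y` from, but the equation itself says `y = 0`.
  rcases Nat.eq_zero_or_pos α with rfl | hα
  · filter_upwards [hW.mem_nhds htW] with u hu
    simpa using hy.2 u hu
  have hψ' : ∀ᶠ u in 𝓝 t, ∀ k, AnalyticAt ℂ (ψ k) u :=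
    eventually_all.2 fun k => (hψ k).eventually_analyticAt
  obtain ⟨r, hr, hB⟩ := Metric.eventually_nhds_iff_ball.1 (hψ'.and (hW.mem_nhds htW))
  let C : ℂ → (Fin α → ℂ) →L[ℂ] (Fin α → ℂ) := fun u =>
    companionShift α - ∑ k, ψ k u • companionRow k
  have hC : DifferentiableOn ℂ C (Metric.ball t r) := by
    intro u hu
    refine DifferentiableAt.differentiableWithinAt ?_
    refine (differentiableAt_const _).sub (DifferentiableAt.fun_sum fun k _ => ?_)
    exact ((hB u hu).1 k).differentiableAt.smul_const _
  let v : ℂ → (Fin α → ℂ) := fun u i => iteratedDeriv i y u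
  have hv : ∀ u ∈ Metric.ball t r, HasDerivAt v (C u (v u)) u := by
    intro u hu
    rw [hasDerivAt_pi]
    intro i
    have h1 : HasDerivAt (iteratedDeriv i y) (iteratedDeriv (i + 1) y u) u := by
      rw [iteratedDeriv_succ]
      have h2 : AnalyticAt ℂ (iteratedDeriv i y) u := by
        rw [iteratedDeriv_eq_iterate]
        exact (hy.1 u (hB u hu).2).iterated_deriv i
      exact h2.differentiableAt.hasDerivAt
    refine h1.congr_deriv ?_
    by_cases hi : (i : ℕ) + 1 < α
    · simp [C, companionShift, companionRow, hi, v]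
    · have hi' : (i : ℕ) + 1 = α := by omega
      have h3 := hy.2 u (hB u hu).2
      simp [C, companionShift, companionRow, hi, v]
      rw [hi']
      linear_combination h3
  have h4 := linearODE_eq_zero hr hC hv (funext h0)
  filter_upwards [Metric.ball_mem_nhds t hr] with u hu
  simpa [v] using congrFun (h4 u hu) ⟨0, hα⟩

lemma iteratedDeriv_sum_smul {y : Fin α → ℂ → ℂ} {t : ℂ} (hy : ∀ k, AnalyticAt ℂ (y k) t)
    (n : Fin α → ℂ) (i : ℕ) :
    iteratedDeriv i (∑ k, n k • y k) t = ∑ k, n k * iteratedDeriv i (y k) t := by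
  suffices ∀ s : Finset (Fin α), iteratedDeriv i (∑ k ∈ s, n k • y k) t =
      ∑ k ∈ s, n k * iteratedDeriv i (y k) t ∧ AnalyticAt ℂ (∑ k ∈ s, n k • y k) t from (this _).1
  intro s
  induction s using Finset.induction_on with
  | empty =>
    have h0 : iteratedDeriv i (0 : ℂ → ℂ) t = 0 := by
      rw [show (0 : ℂ → ℂ) = fun _ => 0 from rfl, iteratedDeriv_const]
      simp
    simp only [Finset.sum_empty, h0, true_and]
    exact analyticAt_const
  | insert a s ha ih =>
    have h1 : AnalyticAt ℂ (n a • y a) t := analyticAt_const.smul (hy a)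
    rw [Finset.sum_insert ha, Finset.sum_insert ha]
    refine ⟨?_, h1.add ih.2⟩
    rw [iteratedDeriv_add h1.contDiffAt ih.2.contDiffAt, ih.1, iteratedDeriv_const_smul_field,
      smul_eq_mul]

lemma analyticAt_of_isSolAt {ψ : LinearODE α} {t : ℂ} {y : ℂ → ℂ} (hy : SolAt ψ.IsSolOn t y) :
    AnalyticAt ℂ y t := by
  obtain ⟨W, -, ht, hy⟩ := hy
  exact hy.1 t ht

lemma LinearODE.equation_of_solAt {ψ : LinearODE α} {t : ℂ} {y : ℂ → ℂ}
    (hy : SolAt ψ.IsSolOn t y) :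
    iteratedDeriv α y t + ∑ k : Fin α, ψ k t * iteratedDeriv (k : ℕ) y t = 0 := by
  obtain ⟨W, -, ht, hy⟩ := hy
  exact hy.2 t ht

/-- A relation between the jets at `t` gives a solution with zero initial data, hence a relation
between the germs. -/
lemma linearIndependent_jets {ψ : LinearODE α} {t : ℂ} (hψ : ∀ k, AnalyticAt ℂ (ψ k) t)
    {y : Fin α → ℂ → ℂ} (hy : ∀ k, SolAt ψ.IsSolOn t (y k)) (hi : GermIndep t y) :
    LinearIndependent ℂ fun k => fun i : Fin α => iteratedDeriv i (y k) t := by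
  rw [Fintype.linearIndependent_iff]
  intro n hn
  refine congrFun (hi n (ψ.eventuallyEq_zero hψ
    ((isSolSheaf_isSolOn ψ univ).solAt_sum hy _ n) fun i => ?_))
  rw [iteratedDeriv_sum_smul fun k => analyticAt_of_isSolAt (hy k)]
  simpa using congrFun hn i

/-- Independent solutions span the germs of solutions. -/
lemma LinearODE.exists_eq_sum {ψ : LinearODE α} {t : ℂ} (hψ : ∀ k, AnalyticAt ℂ (ψ k) t)
    {E : Fin α → ℂ → ℂ} (hE : ∀ k, SolAt ψ.IsSolOn t (E k)) (hi : GermIndep t E) {y : ℂ → ℂ}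
    (hy : SolAt ψ.IsSolOn t y) : ∃ n : Fin α → ℂ, y =ᶠ[𝓝 t] ∑ l, n l • E l := by
  have hS := isSolSheaf_isSolOn ψ univ
  have h1 := (linearIndependent_jets hψ hE hi).span_eq_top_of_card_eq_finrank' (by simp)
  have h2 : (fun i : Fin α => iteratedDeriv i y t) ∈ Submodule.span ℂ
      (range fun k => fun i : Fin α => iteratedDeriv i (E k) t) := h1 ▸ Submodule.mem_top
  obtain ⟨n, hn⟩ := (Submodule.mem_span_range_iff_exists_fun ℂ).1 h2
  refine ⟨n, ?_⟩
  have hsum := hS.solAt_sum hE Finset.univ n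
  have h3 := ψ.eventuallyEq_zero hψ (hS.solAt_add hy (hS.solAt_smul (-1) hsum)) fun i => by
    have h4 := (analyticAt_of_isSolAt hsum)
    have h5 : AnalyticAt ℂ ((-1 : ℂ) • ∑ l, n l • E l) t := analyticAt_const.smul h4
    rw [iteratedDeriv_add (analyticAt_of_isSolAt hy).contDiffAt h5.contDiffAt,
      iteratedDeriv_const_smul_field,
      iteratedDeriv_sum_smul fun k => analyticAt_of_isSolAt (hE k)]
    have h6 := congrFun hn i
    simp only [Finset.sum_apply, Pi.smul_apply, smul_eq_mul] at h6
    rw [h6]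
    simp
  filter_upwards [h3] with u hu
  have : y u + -1 • (∑ l, n l • E l) u = 0 := by simpa using hu
  simpa [add_neg_eq_zero] using this

/-- Coefficients of a linear relation between `α + 1` vectors of length `α`, by Cramer's rule. -/
lemma mul_det_eq_of_relation (R : Fin (α + 1) → Fin α → ℂ) (p : Fin α → ℂ)
    (h : ∀ j, R (Fin.last α) j + ∑ k : Fin α, p k * R k.castSucc j = 0) (k : Fin α) :
    p k * Matrix.det (Matrix.of fun i j : Fin α => R i.castSucc j) = (-1) ^ (α - (k : ℕ)) *
      Matrix.det (Matrix.of fun i j : Fin α => R (k.castSucc.succAbove i) j) := by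
  -- Border the rows `R` with a column `c` annihilated by `(p, 1)`, as `p k * 1 + 1 * (-p k) = 0`.
  -- The square matrix is then singular, and expanding its determinant along `c` leaves exactly the
  -- two minors of the claim.
  let c : Fin (α + 1) → ℂ := fun i => if i = k.castSucc then 1 else if i = Fin.last α then -p k else 0
  let M : Matrix (Fin (α + 1)) (Fin (α + 1)) ℂ := Matrix.of fun i => Fin.cons (c i) (R i)
  have hne : k.castSucc ≠ Fin.last α := (Fin.castSucc_lt_last k).ne
  let q : Fin (α + 1) → ℂ := Fin.snoc p 1
  have hq : q ≠ 0 := fun h0 => by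
    have := congrFun h0 (Fin.last α)
    simp [q] at this
  have hM : Matrix.vecMul q M = 0 := by
    ext j
    refine Fin.cases ?_ (fun j => ?_) j
    · simp only [Matrix.vecMul, dotProduct, Fin.sum_univ_castSucc, M, Matrix.of_apply,
        Fin.cons_zero, q, Fin.snoc_castSucc, Fin.snoc_last, c]
      simp [hne.symm, Fin.castSucc_ne_last, (Fin.castSucc_injective α).eq_iff]
    · have := h j
      simp only [Matrix.vecMul, dotProduct, Fin.sum_univ_castSucc, M, Matrix.of_apply,
        Fin.cons_succ, q, Fin.snoc_castSucc, Fin.snoc_last, one_mul, Pi.zero_apply]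
      linear_combination this
  have hdet : M.det = 0 := Matrix.exists_vecMul_eq_zero_iff.1 ⟨q, hq, hM⟩
  have hminor : ∀ i : Fin (α + 1), (M.submatrix i.succAbove Fin.succ) =
      Matrix.of fun a j : Fin α => R (i.succAbove a) j := by
    intro i
    ext a j
    simp [M]
  have hlast : M.submatrix Fin.castSucc Fin.succ =
      Matrix.of fun a j : Fin α => R a.castSucc j := by
    ext a j
    simp [M]
  rw [Matrix.det_succ_column_zero, Fin.sum_univ_castSucc] at hdet
  simp only [hminor, Fin.succAbove_last, hlast] at hdet
  have hc1 : ∀ x : Fin α, M x.castSucc 0 = if x = k then 1 else 0 := by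
    intro x
    simp [M, c, Fin.castSucc_ne_last, (Fin.castSucc_injective α).eq_iff]
  have hc2 : M (Fin.last α) 0 = -p k := by simp [M, c, hne.symm]
  simp only [hc1, hc2, mul_ite, mul_one, mul_zero, ite_mul, zero_mul, Finset.sum_ite_eq',
    Finset.mem_univ, if_true, Fin.val_castSucc, Fin.val_last] at hdet
  have hpow : (-1 : ℂ) ^ α = (-1) ^ (k : ℕ) * (-1) ^ (α - (k : ℕ)) := by
    rw [← pow_add]
    congr 1
    omega
  have hk : (-1 : ℂ) ^ (k : ℕ) * (-1) ^ (k : ℕ) = 1 := by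
    rw [← mul_pow]; simp
  have hk' : (-1 : ℂ) ^ (α - (k : ℕ)) * (-1) ^ (α - (k : ℕ)) = 1 := by
    rw [← mul_pow]; simp
  rw [hpow] at hdet
  generalize Matrix.det (Matrix.of fun i j : Fin α => R i.castSucc j) = d₁ at *
  generalize Matrix.det (Matrix.of fun i j : Fin α => R (k.castSucc.succAbove i) j) = d₂ at *
  generalize (-1 : ℂ) ^ (k : ℕ) = a at *
  generalize (-1 : ℂ) ^ (α - (k : ℕ)) = e at *
  linear_combination (-(a * e)) * hdet + (e * d₂ - p k * d₁ * e * e) * hk - p k * d₁ * hk'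

end Uniqueness

/-! ### From periods to the Picard–Fuchs equation -/

section Periods

variable {ι : Type*} {α : ℕ} {V : VectorBundleCore ℂ (OnePoint ℂ) (Fin α → ℂ) ι}
  {D : OnePoint ℂ →₀ ℕ} {hV : IsHolomorphic V} {conn : MeromorphicConnection V D}
  {ψ : LinearODE α} {ω : ℂ → (Fin α → ℂ)} {t : ℂ}

lemma HasPeriods.congr (h : HasPeriods hV conn ψ ω t) {ω' : ℂ → (Fin α → ℂ)}
    (hω : ω =ᶠ[𝓝 t] ω') : HasPeriods hV conn ψ ω' t := by
  obtain ⟨Δ, E, h1, h2, h3, h4, h5⟩ := h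
  refine ⟨Δ, E, h1, h2, h3, h4, ?_⟩
  filter_upwards [h5, hω] with u h6 h7
  rwa [← h7]

lemma HasPeriods.exists_coord (h : HasPeriods hV conn ψ ω t) (hD : (t : OnePoint ℂ) ∉ D.support) :
    ∃ (Δ : Fin α → ℂ → ((Fin α → ℂ) →L[ℂ] ℂ)) (E : Fin α → ℂ → ℂ),
      (∀ k, SolAt (conn.dual hV).IsFlatOn t (Δ k)) ∧ GermIndep t Δ ∧
      (∀ k, SolAt ψ.IsSolOn t (E k)) ∧ GermIndep t E ∧
      (∀ n : Fin α → ℂ, (fun u => (∑ l, n l • Δ l) u (ω u)) =ᶠ[𝓝 t] ∑ l, n l • E l) ∧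
      ∀ δ, SolAt (conn.dual hV).IsFlatOn t δ → ∃ n : Fin α → ℂ, δ =ᶠ[𝓝 t] ∑ l, n l • Δ l := by
  obtain ⟨Δ, E, h1, h2, h3, h4, h5⟩ := h
  refine ⟨Δ, E, h1, h2, h3, h4, fun n => ?_,
    flat_span hV conn (X := {t | (t : OnePoint ℂ) ∉ D.support}) (fun _ h => h) t hD Δ h1 h2⟩
  filter_upwards [h5] with u hu
  simp [hu]

/-- Pairings of flat sections with `ω` are solutions. -/
lemma HasPeriods.solAt (h : HasPeriods hV conn ψ ω t) (hD : (t : OnePoint ℂ) ∉ D.support)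
    {δ : ℂ → ((Fin α → ℂ) →L[ℂ] ℂ)} (hδ : SolAt (conn.dual hV).IsFlatOn t δ) :
    SolAt ψ.IsSolOn t (fun u => δ u (ω u)) := by
  obtain ⟨Δ, E, -, -, h3, -, h5, h6⟩ := h.exists_coord hD
  obtain ⟨n, hn⟩ := h6 δ hδ
  have hS := isSolSheaf_isSolOn ψ univ
  refine hS.solAt_congr (hS.solAt_sum h3 Finset.univ n) ?_
  filter_upwards [hn, h5 n] with u h7 h8
  rw [← h8, h7]

/-- Pairing with `ω` takes the basis `Δ` to the independent germs `E`, so it is injective on flat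
germs. -/
lemma HasPeriods.eventuallyEq_zero (h : HasPeriods hV conn ψ ω t)
    (hD : (t : OnePoint ℂ) ∉ D.support) {δ : ℂ → ((Fin α → ℂ) →L[ℂ] ℂ)}
    (hδ : SolAt (conn.dual hV).IsFlatOn t δ) (h0 : ∀ᶠ u in 𝓝 t, δ u (ω u) = 0) :
    δ =ᶠ[𝓝 t] 0 := by
  obtain ⟨Δ, E, -, -, -, h4, h5, h6⟩ := h.exists_coord hD
  obtain ⟨n, hn⟩ := h6 δ hδ
  have h1 : n = 0 := by
    refine h4 n ?_
    filter_upwards [hn, h5 n, h0] with u h7 h8 h9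
    rw [← h8, ← h7, h9]
    rfl
  have h7 : ∑ l, n l • Δ l = 0 := Finset.sum_eq_zero fun l _ => by
    rw [h1]
    exact zero_smul ℂ (Δ l)
  rwa [h7] at hn

/-- Surjectivity of the pairing: `E` spans the germs of solutions, since the solution space has
dimension at most `α`. -/
lemma HasPeriods.exists_flat (h : HasPeriods hV conn ψ ω t) (hD : (t : OnePoint ℂ) ∉ D.support)
    (hψ : ∀ k, AnalyticAt ℂ (ψ k) t) {y : ℂ → ℂ} (hy : SolAt ψ.IsSolOn t y) :
    ∃ δ, SolAt (conn.dual hV).IsFlatOn t δ ∧ ∀ᶠ u in 𝓝 t, y u = δ u (ω u) := by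
  obtain ⟨Δ, E, h1, -, h3, h4, h5, -⟩ := h.exists_coord hD
  obtain ⟨n, hn⟩ := LinearODE.exists_eq_sum hψ h3 h4 hy
  refine ⟨_, (isSolSheaf_isFlatOn (conn.dual hV) univ).solAt_sum h1 Finset.univ n, ?_⟩
  filter_upwards [hn, h5 n] with u h7 h8
  rw [h8, h7]

/-- A section is recovered from its pairings with a frame. -/
lemma IsDualFrame.rep_eq {i : ι} {U : Set ℂ} {Y X : ℂ → (Fin α → ℂ) →L[ℂ] (Fin α → ℂ)}
    (hY : IsDualFrame conn i U Y X) (s : ℂ → (Fin α → ℂ)) {u : ℂ} (hu : u ∈ U) :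
    rep V i s u = X u (fun j => (ofRep (dualBundle V) i
      (fun t => (ContinuousLinearMap.proj j : (Fin α → ℂ) →L[ℂ] ℂ).comp (Y t)) u) (s u)) := by
  have h1 : ∀ j, (ofRep (dualBundle V) i
      (fun t => (ContinuousLinearMap.proj j : (Fin α → ℂ) →L[ℂ] ℂ).comp (Y t)) u) (s u) =
        Y u (rep V i s u) j := by
    intro j
    rw [← rep_dual_pairing (hY.chart u hu), rep_ofRep (V := dualBundle V) (hY.chart u hu)]
    rfl
  simp only [h1]
  exact (hY.inv_apply hu _).symm

/-- The periods are solutions, hence holomorphic, and the inverse frame that reconstructs `ω` from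
them is holomorphic as well. -/
lemma HasPeriods.analyticAt (h : HasPeriods hV conn ψ ω t) (hD : (t : OnePoint ℂ) ∉ D.support)
    {i : ι} (hi : (t : OnePoint ℂ) ∈ V.baseSet i) : AnalyticAt ℂ (rep V i ω) t := by
  obtain ⟨r, hr, Y, X, hY⟩ := exists_isDualFrame_ball conn hi hD
  have ht := Metric.mem_ball_self (x := t) hr
  have h1 : AnalyticAt ℂ (fun u => X u (fun j => (ofRep (dualBundle V) i
      (fun t => (ContinuousLinearMap.proj j : (Fin α → ℂ) →L[ℂ] ℂ).comp (Y t)) u) (ω u))) t := by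
    refine analyticAt_clm_apply (hY.analyticAt_inv ht) (AnalyticAt.pi fun j => ?_)
    exact analyticAt_of_isSolAt (h.solAt hD ⟨_, hY.isOpen, ht, hY.isFlatOn hV _⟩)
  refine h1.congr ?_
  filter_upwards [hY.isOpen.mem_nhds ht] with u hu using (hY.rep_eq ω hu).symm

lemma isSolOn_iff {W : Set ℂ} {y : ℂ → ℂ} (hW : IsOpen W) :
    ψ.IsSolOn W y ↔ ∀ t ∈ W, SolAt ψ.IsSolOn t y :=
  ⟨fun h _ ht => ⟨W, hW, ht, h⟩, fun h => ⟨fun t ht => analyticAt_of_isSolAt (h t ht),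
    fun t ht => ψ.equation_of_solAt (h t ht)⟩⟩

lemma isFlatOn_of_solAt {W : Set ℂ} {δ : ℂ → ((Fin α → ℂ) →L[ℂ] ℂ)}
    (h : ∀ t ∈ W, SolAt (conn.dual hV).IsFlatOn t δ) : (conn.dual hV).IsFlatOn W δ := by
  intro i t ht hi
  obtain ⟨W', -, ht', h'⟩ := h t ht
  exact h' i t ht' hi

/-- Locally each solution is the pairing of `ω` with a flat section, which is unique by
`HasPeriods.eventuallyEq_zero`. The local choices therefore agree and glue to `t ↦ δ t t`, even when
`W` is not simply connected. -/
lemma isSolOn_iff_exists_flat {W : Set ℂ} (hW : IsOpen W)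
    (hD : ∀ t ∈ W, (t : OnePoint ℂ) ∉ D.support) (hψ : ∀ k, AnalyticOnNhd ℂ (ψ k) W)
    (h : ∀ t ∈ W, HasPeriods hV conn ψ ω t) (y : ℂ → ℂ) :
    ψ.IsSolOn W y ↔ ∃ δ, (conn.dual hV).IsFlatOn W δ ∧ ∀ t ∈ W, y t = δ t (ω t) := by
  constructor
  · intro hy
    have h1 : ∀ t ∈ W, ∃ δ, SolAt (conn.dual hV).IsFlatOn t δ ∧ ∀ᶠ u in 𝓝 t, y u = δ u (ω u) :=
      fun t ht => (h t ht).exists_flat (hD t ht) (fun k => hψ k t ht) ⟨W, hW, ht, hy⟩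
    choose! δ hδ hyδ using h1
    refine ⟨fun t => δ t t, isFlatOn_of_solAt fun t ht => ?_, fun t ht => (hyδ t ht).self_of_nhds⟩
    have hS := isSolSheaf_isFlatOn (conn.dual hV) univ
    refine hS.solAt_congr (hδ t ht) ?_
    filter_upwards [hW.mem_nhds ht, (hδ t ht).eventually, (hyδ t ht).eventually_nhds]
      with u hu h2 h3
    have h4 := (h u hu).eventuallyEq_zero (hD u hu)
      (hS.solAt_add h2 (hS.solAt_smul (-1) (hδ u hu))) (by
        filter_upwards [h3, hyδ u hu] with v h5 h6
        simp [← h5, ← h6])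
    have h5 : δ t u + -1 • δ u u = 0 := by simpa using h4.self_of_nhds
    simpa [add_neg_eq_zero] using h5
  · rintro ⟨δ, hδ, hyδ⟩
    have hS := isSolSheaf_isSolOn ψ univ
    refine hS.congr hW (f := fun t => δ t (ω t)) (fun t ht => (hyδ t ht).symm) ?_
    exact (isSolOn_iff hW).2 fun t ht => (h t ht).solAt (hD t ht) ⟨W, hW, ht, hδ⟩

lemma wronskian_eq (hD : (t : OnePoint ℂ) ∉ D.support) (h : HasPeriods hV conn ψ ω t)
    {δ : Fin α → ℂ → ((Fin α → ℂ) →L[ℂ] ℂ)} (hδ : ∀ j, SolAt (conn.dual hV).IsFlatOn t (δ j))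
    (n : Fin α → ℕ) : conn.wronskian ω δ n t =
      Matrix.det (Matrix.of fun i j : Fin α => iteratedDeriv (n i) (fun u => δ j u (ω u)) t) := by
  rw [MeromorphicConnection.wronskian]
  congr 1
  ext i j
  have hi := V.mem_baseSet_at (t : OnePoint ℂ)
  simp only [Matrix.of_apply]
  exact (iteratedDeriv_pairing hV conn hD hi (h.analyticAt hD hi) (hδ j) (n i)).self_of_nhds.symm

/-- The Wronskian does not vanish and Cramer's rule recovers the equation. -/
lemma wronskian_ne_zero_and_coeff (hD : (t : OnePoint ℂ) ∉ D.support)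
    (hψ : ∀ k, AnalyticAt ℂ (ψ k) t) (h : HasPeriods hV conn ψ ω t)
    {δ : Fin α → ℂ → ((Fin α → ℂ) →L[ℂ] ℂ)} (hδ : ∀ j, SolAt (conn.dual hV).IsFlatOn t (δ j))
    (hi : GermIndep t δ) :
    conn.wronskian ω δ (fun i => (i : ℕ)) t ≠ 0 ∧
      ∀ k : Fin α, ψ k t = (-1) ^ (α - (k : ℕ)) *
        conn.wronskian ω δ (fun i => ((k.castSucc.succAbove i : Fin (α + 1)) : ℕ)) t /
          conn.wronskian ω δ (fun i => (i : ℕ)) t := by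
  have hy : ∀ j, SolAt ψ.IsSolOn t (fun u => δ j u (ω u)) := fun j => h.solAt hD (hδ j)
  have hyi : GermIndep t (fun j u => δ j u (ω u)) := by
    intro n hn
    refine hi n (h.eventuallyEq_zero hD
      ((isSolSheaf_isFlatOn (conn.dual hV) univ).solAt_sum hδ Finset.univ n) ?_)
    filter_upwards [hn] with u hu
    simpa using hu
  have hne : conn.wronskian ω δ (fun i => (i : ℕ)) t ≠ 0 := by
    rw [wronskian_eq hD h hδ, ← Matrix.det_transpose]
    have h1 := linearIndependent_jets hψ hy hyi
    have h2 := (Matrix.linearIndependent_rows_iff_isUnit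
      (A := Matrix.of fun j i : Fin α => iteratedDeriv i (fun u => δ j u (ω u)) t)).1 h1
    exact ((Matrix.isUnit_iff_isUnit_det _).1 h2).ne_zero
  refine ⟨hne, fun k => ?_⟩
  rw [eq_div_iff hne, wronskian_eq hD h hδ, wronskian_eq hD h hδ]
  exact mul_det_eq_of_relation (fun i j => iteratedDeriv i (fun u => δ j u (ω u)) t)
    (fun k => ψ k t) (fun j => ψ.equation_of_solAt (hy j)) k

lemma isPicardFuchsOf_of_hasPeriods {X : Set ℂ} (hD : ∀ t ∈ X, (t : OnePoint ℂ) ∉ D.support)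
    (hψ : ∀ k, AnalyticOnNhd ℂ (ψ k) X) (h : ∀ t ∈ X, HasPeriods hV conn ψ ω t) :
    IsPicardFuchsOf hV conn X ψ ω := by
  refine ⟨fun W hW hc hWX δ hδ hi t ht => ?_, fun W hW hWX y => ?_⟩
  · refine wronskian_ne_zero_and_coeff (hD t (hWX ht)) (fun k => hψ k t (hWX ht)) (h t (hWX ht))
      (fun j => ⟨W, hW, ht, hδ j⟩) ?_
    exact (isSolSheaf_isFlatOn (conn.dual hV) X).germIndep_of_indepOn hW hWX hc hδ hi ht
  · exact isSolOn_iff_exists_flat hW (fun t ht => hD t (hWX ht)) (fun k => (hψ k).mono hWX)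
      (fun t ht => h t (hWX ht)) y

end Periods

/-! ### Holomorphic extension at apparent singularities -/

section Apparent

/-- Polar coordinates present the punctured disc as a continuous image of a product of intervals. -/
lemma isPreconnected_punctured_ball (z : ℂ) (r : ℝ) : IsPreconnected (Metric.ball z r \ {z}) := by
  have h : Metric.ball z r \ {z} =
      (fun q : ℝ × ℝ => z + q.1 * Complex.exp (q.2 * Complex.I)) '' (Ioo 0 r ×ˢ univ) := by
    ext t
    simp only [Set.mem_sdiff, Metric.mem_ball, mem_singleton_iff, mem_image, mem_prod, mem_Ioo, mem_univ,
      and_true, Prod.exists]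
    constructor
    · rintro ⟨h1, h2⟩
      refine ⟨‖t - z‖, (t - z).arg, ⟨norm_pos_iff.2 (sub_ne_zero.2 h2), ?_⟩, ?_⟩
      · rwa [← dist_eq_norm]
      · rw [Complex.norm_mul_exp_arg_mul_I]
        ring
    · rintro ⟨ρ, φ, ⟨h1, h2⟩, rfl⟩
      have h3 : Complex.exp (φ * Complex.I) ≠ 0 := Complex.exp_ne_zero _
      refine ⟨?_, ?_⟩
      · rw [dist_eq_norm, add_sub_cancel_left, norm_mul, Complex.norm_exp_ofReal_mul_I, mul_one]
        simpa [abs_of_pos h1] using h2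
      · simp [h1.ne']
  rw [h]
  refine (isPreconnected_Ioo.prod isPreconnected_univ).image _ ?_
  fun_prop

variable {ι : Type*} {α : ℕ} {V : VectorBundleCore ℂ (OnePoint ℂ) (Fin α → ℂ) ι}
  {D : OnePoint ℂ →₀ ℕ} {hV : IsHolomorphic V} {conn : MeromorphicConnection V D}
  {ψ : LinearODE α} {ω : ℂ → (Fin α → ℂ)}

/-- At an apparent singularity of `ψ` off the poles of the connection, `ω` extends analytically. -/
lemma exists_analytic_extension {X : Set ℂ} (hX : ∀ t ∈ X, (t : OnePoint ℂ) ∉ D.support)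
    (hψ : ∀ k, AnalyticOnNhd ℂ (ψ k) X) (h : ∀ t ∈ X, HasPeriods hV conn ψ ω t) {z : ℂ} (hz : ψ.IsApparentAt X z)
    (hD : (z : OnePoint ℂ) ∉ D.support) {i : ι} (hi : (z : OnePoint ℂ) ∈ V.baseSet i) :
    ∃ g : ℂ → (Fin α → ℂ), AnalyticAt ℂ g z ∧ rep V i ω =ᶠ[𝓝[≠] z] g := by
  obtain ⟨r, e, hr, hrX, hei, he⟩ := hz
  obtain ⟨r', hr', hch⟩ := exists_ball_chart hi hD
  set ρ := min r r'
  have hρ : 0 < ρ := lt_min hr hr'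
  -- The connection has no pole at `z`, so the frame lives on the full disc, centre included; only
  -- the periods are at first restricted to the punctured disc.
  obtain ⟨Y, Xi, hY⟩ := exists_isDualFrame conn (i := i) (U := Metric.ball z ρ)
    Metric.isOpen_ball (convex_ball _ _) ⟨z, Metric.mem_ball_self hρ⟩
    (fun t ht => hch t (Metric.ball_subset_ball (min_le_right _ _) ht))
  set W := Metric.ball z ρ \ {z}
  have hW : IsOpen W := Metric.isOpen_ball.sdiff isClosed_singleton
  have hWr : W ⊆ Metric.ball z r \ {z} :=
    sdiff_subset_sdiff_left (Metric.ball_subset_ball (min_le_left _ _))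
  have hWz : W ∈ 𝓝[≠] z := sdiff_mem_nhdsWithin_compl (Metric.ball_mem_nhds z hρ) _
  obtain ⟨u₀, hu₀⟩ : W.Nonempty := (mem_of_superset hWz subset_rfl |> Filter.nonempty_of_mem)
  have hS := isSolSheaf_isSolOn ψ X
  have hgi := hS.germIndep_of_indepOn (Metric.isOpen_ball.sdiff isClosed_singleton) hrX
    (isPreconnected_punctured_ball z r) (fun k => (he k).2) hei (hWr hu₀)
  let δ : Fin α → ℂ → ((Fin α → ℂ) →L[ℂ] ℂ) := fun j => ofRep (dualBundle V) i
      (fun t => (ContinuousLinearMap.proj j : (Fin α → ℂ) →L[ℂ] ℂ).comp (Y t))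
  have hsol : ∀ j, ψ.IsSolOn W (fun u => δ j u (ω u)) := fun j =>
    (isSolOn_iff hW).2 fun t ht => (h t (hrX (hWr ht))).solAt (hX t (hrX (hWr ht)))
      ⟨_, hY.isOpen, ht.1, hY.isFlatOn hV _⟩
  have key : ∀ j, ∃ f : ℂ → ℂ, AnalyticAt ℂ f z ∧ ∀ u ∈ W, δ j u (ω u) = f u := by
    intro j
    have hsum : ∀ n : Fin α → ℂ, AnalyticAt ℂ (∑ l, n l • e l) z := fun n =>
      Finset.analyticAt_sum _ fun l _ => analyticAt_const.smul ((he l).1 z (Metric.mem_ball_self hr))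
    -- Near one point `u₀` the period is a combination of the `e l`; unique continuation spreads
    -- this over the connected punctured disc, and the combination is holomorphic at `z`.
    obtain ⟨n, hn⟩ := LinearODE.exists_eq_sum (fun k => hψ k u₀ (hrX (hWr hu₀)))
      (fun k => ⟨_, Metric.isOpen_ball.sdiff isClosed_singleton, hWr hu₀, (he k).2⟩) hgi
      (y := fun u => δ j u (ω u)) ⟨W, hW, hu₀, hsol j⟩
    exact ⟨_, hsum n, hS.eqOn_of_eventuallyEq hW (hWr.trans hrX)
      (isPreconnected_punctured_ball z ρ) (hsol j)
      (hS.sum hW (fun k => hS.mono hWr (he k).2) Finset.univ n) hu₀ hn⟩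
  choose f hf hfW using key
  refine ⟨fun u => Xi u (fun j => f j u), ?_, ?_⟩
  · exact analyticAt_clm_apply (hY.analyticAt_inv (Metric.mem_ball_self hρ)) (AnalyticAt.pi hf)
  · filter_upwards [hWz] with u hu
    rw [hY.rep_eq ω hu.1]
    congr 1
    ext j
    exact hfW j u hu

end Apparent

open Asymptotics

/-! ### Polynomial growth, half planes and meromorphy -/

section Tempered

variable {E : Type*} [NormedAddCommGroup E]

/-- `f` grows at most polynomially in `1 / ‖z‖` along the filter `l`. -/
def Tempered (l : Filter ℂ) (f : ℂ → E) : Prop := ∃ N : ℕ, f =O[l] fun z => (‖z‖⁻¹) ^ N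

lemma inv_norm_pow_isBigO {l : Filter ℂ} (hl : l ≤ 𝓝[≠] 0) {N M : ℕ} (h : N ≤ M) :
    (fun z : ℂ => (‖z‖⁻¹) ^ N) =O[l] fun z => (‖z‖⁻¹) ^ M := by
  refine IsBigO.of_bound 1 (hl ?_)
  have h1 : ∀ᶠ z : ℂ in 𝓝[≠] 0, z ∈ Metric.ball (0 : ℂ) 1 :=
    nhdsWithin_le_nhds (Metric.ball_mem_nhds 0 one_pos)
  filter_upwards [h1, self_mem_nhdsWithin] with z hz hz0
  have h2 : ‖z‖ < 1 := by simpa using hz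
  have h3 : 0 < ‖z‖ := norm_pos_iff.2 hz0
  rw [one_mul, Real.norm_of_nonneg (by positivity), Real.norm_of_nonneg (by positivity)]
  exact pow_le_pow_right₀ ((one_le_inv₀ h3).2 h2.le) h

namespace Tempered

variable {l : Filter ℂ}

lemma mono {l' : Filter ℂ} {f : ℂ → E} (h : Tempered l f) (hl : l' ≤ l) : Tempered l' f :=
  h.imp fun _ hN => IsBigO.mono hN hl

lemma congr {f g : ℂ → E} (h : Tempered l f) (hfg : f =ᶠ[l] g) : Tempered l g :=
  h.imp fun _ hN => hN.congr' hfg EventuallyEq.rfl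

lemma sup {l' : Filter ℂ} (hl : l ≤ 𝓝[≠] 0) (hl' : l' ≤ 𝓝[≠] 0) {f : ℂ → E} (h : Tempered l f)
    (h' : Tempered l' f) : Tempered (l ⊔ l') f := by
  obtain ⟨N, hN⟩ := h
  obtain ⟨M, hM⟩ := h'
  exact ⟨N + M, (hN.trans (inv_norm_pow_isBigO hl (by omega))).sup
    (hM.trans (inv_norm_pow_isBigO hl' (by omega)))⟩

lemma add (hl : l ≤ 𝓝[≠] 0) {f g : ℂ → E} (h : Tempered l f) (h' : Tempered l g) :
    Tempered l (fun z => f z + g z) := by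
  obtain ⟨N, hN⟩ := h
  obtain ⟨M, hM⟩ := h'
  exact ⟨N + M, (hN.trans (inv_norm_pow_isBigO hl (by omega))).add
    (hM.trans (inv_norm_pow_isBigO hl (by omega)))⟩

lemma smul [NormedSpace ℂ E] {f : ℂ → ℂ} {g : ℂ → E} (h : Tempered l f) (h' : Tempered l g) :
    Tempered l (fun z => f z • g z) := by
  obtain ⟨N, hN⟩ := h
  obtain ⟨M, hM⟩ := h'
  exact ⟨N + M, by simpa only [pow_add, smul_eq_mul] using hN.smul hM⟩

lemma mul {f g : ℂ → ℂ} (h : Tempered l f) (h' : Tempered l g) :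
    Tempered l (fun z => f z * g z) := h.smul h'

lemma const (c : E) : Tempered l (fun _ => c) :=
  ⟨0, by simpa using isBigO_const_const c (one_ne_zero (α := ℝ)) l⟩

lemma sum (hl : l ≤ 𝓝[≠] 0) {κ : Type*} (s : Finset κ) {f : κ → ℂ → E}
    (h : ∀ k ∈ s, Tempered l (f k)) : Tempered l (fun z => ∑ k ∈ s, f k z) := by
  classical
  induction s using Finset.induction_on with
  | empty => simpa using const (0 : E)
  | insert a s ha ih =>
    simp only [Finset.sum_insert ha]
    exact add hl (h a (Finset.mem_insert_self _ _))
      (ih fun k hk => h k (Finset.mem_insert_of_mem hk))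

lemma prod {κ : Type*} (s : Finset κ) {f : κ → ℂ → ℂ}
    (h : ∀ k ∈ s, Tempered l (f k)) : Tempered l (fun z => ∏ k ∈ s, f k z) := by
  classical
  induction s using Finset.induction_on with
  | empty => simpa using const (1 : ℂ)
  | insert a s ha ih =>
    simp only [Finset.prod_insert ha]
    exact mul (h a (Finset.mem_insert_self _ _))
      (ih fun k hk => h k (Finset.mem_insert_of_mem hk))

lemma of_isBigO {E' : Type*} [NormedAddCommGroup E'] {f : ℂ → E} {g : ℂ → E'} (h : Tempered l g)
    (hfg : f =O[l] g) : Tempered l f :=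
  h.imp fun _ hN => hfg.trans hN

lemma of_continuousAt (hl : l ≤ 𝓝[≠] 0) {f : ℂ → E} (h : ContinuousAt f 0) : Tempered l f :=
  ⟨0, by simpa using (h.isBigO_one ℝ).mono (hl.trans nhdsWithin_le_nhds)⟩

lemma pi {κ : Type*} [Fintype κ] (hl : l ≤ 𝓝[≠] 0) {f : ℂ → κ → ℂ}
    (h : ∀ k, Tempered l (fun z => f z k)) : Tempered l f := by
  choose N hN using h
  refine ⟨∑ k, N k, isBigO_pi.2 fun k => (hN k).trans (inv_norm_pow_isBigO hl ?_)⟩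
  exact Finset.single_le_sum (f := N) (fun _ _ => Nat.zero_le _) (Finset.mem_univ k)

lemma det (hl : l ≤ 𝓝[≠] 0) {n : ℕ} {M : ℂ → Matrix (Fin n) (Fin n) ℂ}
    (h : ∀ i j, Tempered l (fun z => M z i j)) : Tempered l (fun z => (M z).det) := by
  simp only [Matrix.det_apply']
  exact sum hl _ fun σ _ => (const _).mul (prod _ fun i _ => h _ _)

lemma adjugate (hl : l ≤ 𝓝[≠] 0) {n : ℕ} {M : ℂ → Matrix (Fin n) (Fin n) ℂ}
    (h : ∀ i j, Tempered l (fun z => M z i j)) (i j : Fin n) :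
    Tempered l (fun z => (M z).adjugate i j) := by
  simp only [Matrix.adjugate_apply]
  refine det hl fun a b => ?_
  by_cases ha : a = j
  · subst ha
    simpa using const _
  · simpa [Matrix.updateRow_ne ha] using h a b

lemma matrix_inv (hl : l ≤ 𝓝[≠] 0) {n : ℕ} {M : ℂ → Matrix (Fin n) (Fin n) ℂ}
    (h : ∀ i j, Tempered l (fun z => M z i j)) (hd : Tempered l (fun z => ((M z).det)⁻¹))
    (i j : Fin n) : Tempered l (fun z => (M z)⁻¹ i j) := by
  simp only [Matrix.inv_def, Ring.inverse_eq_inv', Matrix.smul_apply]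
  exact hd.smul (adjugate hl h i j)

end Tempered

lemma tempered_of_meromorphicAt [NormedSpace ℂ E] {f : ℂ → E} (hf : MeromorphicAt f 0) :
    Tempered (𝓝[≠] 0) f := by
  obtain ⟨n, hn⟩ := hf
  have h1 := Tempered.of_continuousAt (le_refl (𝓝[≠] (0 : ℂ))) hn.continuousAt
  have h2 : Tempered (𝓝[≠] (0 : ℂ)) (fun z : ℂ => (z⁻¹) ^ n) :=
    ⟨n, IsBigO.of_bound 1 (Eventually.of_forall fun z => by simp)⟩
  refine (h2.smul h1).congr ?_
  filter_upwards [self_mem_nhdsWithin] with z hz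
  rw [sub_zero, smul_smul, ← mul_pow, inv_mul_cancel₀ hz, one_pow, one_smul]

/-- Multiplication by `z ^ (N + 1)`, one power more than the growth exponent, gives a function
tending to `0`, to which Riemann's removable singularity theorem applies. -/
lemma meromorphicAt_of_tempered [NormedSpace ℂ E] [CompleteSpace E] {f : ℂ → E}
    (hd : ∀ᶠ z in 𝓝[≠] (0 : ℂ), DifferentiableAt ℂ f z) (hf : Tempered (𝓝[≠] 0) f) :
    MeromorphicAt f 0 := by
  obtain ⟨N, hN⟩ := hf
  refine ⟨N + 1, ?_⟩
  simp only [sub_zero]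
  refine Complex.analyticAt_of_differentiable_on_punctured_nhds_of_continuousAt ?_ ?_
  · filter_upwards [hd] with z hz
    exact (differentiableAt_id.pow (N + 1)).smul hz
  · rw [continuousAt_iff_punctured_nhds]
    simp only [ne_eq, Nat.add_eq_zero_iff, one_ne_zero, and_false, not_false_eq_true, zero_pow,
      zero_smul]
    have h1 : (fun z : ℂ => z ^ (N + 1) • f z) =O[𝓝[≠] 0] fun z : ℂ => ‖z‖ ^ (N + 1) * (‖z‖⁻¹) ^ N :=
      IsBigO.smul (k₁ := fun z : ℂ => z ^ (N + 1)) (k₂ := fun z : ℂ => ‖z‖ ^ (N + 1))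
        (IsBigO.of_bound 1 (Eventually.of_forall fun z => by simp)) hN
    refine h1.trans_tendsto ?_
    have h2 : Tendsto (fun z : ℂ => ‖z‖) (𝓝[≠] 0) (𝓝 0) := by
      simpa using (continuous_norm (E := ℂ)).continuousAt.tendsto.mono_left
        (nhdsWithin_le_nhds (a := (0 : ℂ)) (s := {0}ᶜ))
    refine h2.congr' ?_
    filter_upwards [self_mem_nhdsWithin] with z hz
    have : ‖z‖ ≠ 0 := norm_ne_zero_iff.2 hz
    rw [inv_pow, pow_succ, mul_comm (‖z‖ ^ N), mul_assoc, mul_inv_cancel₀ (pow_ne_zero _ this),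
      mul_one]

/-- The open half plane with direction `θ`. -/
def halfPlane (θ : ℝ) : Set ℂ := {z | 0 < (z * Complex.exp (-(θ * Complex.I))).re}

lemma isOpen_halfPlane (θ : ℝ) : IsOpen (halfPlane θ) :=
  isOpen_lt continuous_const (by fun_prop)

lemma convex_halfPlane (θ : ℝ) : Convex ℝ (halfPlane θ) := by
  intro z hz w hw a b ha hb hab
  simp only [halfPlane, mem_ofPred_eq] at *
  rw [add_mul, Complex.add_re, smul_mul_assoc, smul_mul_assoc, Complex.smul_re, Complex.smul_re,
    smul_eq_mul, smul_eq_mul]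
  rcases ha.eq_or_lt with rfl | ha
  · have : b = 1 := by linarith
    subst this
    simpa using hw
  · have := mul_pos ha hz
    have := mul_nonneg hb hw.le
    linarith

lemma ne_zero_of_mem_halfPlane {θ : ℝ} {z : ℂ} (hz : z ∈ halfPlane θ) : z ≠ 0 := by
  rintro rfl
  simp [halfPlane] at hz

lemma halfPlane_le (θ : ℝ) : 𝓝[halfPlane θ] (0 : ℂ) ≤ 𝓝[≠] 0 :=
  nhdsWithin_mono _ fun _ hz => ne_zero_of_mem_halfPlane hz

/-- Sectors of opening `π` satisfy the bound `2 * π` in the regularity conditions and are convex, so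
frames exist on them. -/
lemma sector_eq_halfPlane_inter_ball (r θ : ℝ) :
    sector r (θ - Real.pi / 2) (θ + Real.pi / 2) = halfPlane θ ∩ Metric.ball 0 r := by
  ext z
  simp only [sector, halfPlane, mem_ofPred_eq, mem_inter_iff, mem_ball_zero_iff]
  constructor
  · rintro ⟨ρ, φ, h1, h2, h3, h4, rfl⟩
    refine ⟨?_, ?_⟩
    · have : (ρ : ℂ) * Complex.exp (φ * Complex.I) * Complex.exp (-(θ * Complex.I)) =
          (ρ : ℂ) * Complex.exp ((φ - θ : ℝ) * Complex.I) := by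
        rw [mul_assoc, ← Complex.exp_add]
        push_cast
        ring_nf
      rw [this, Complex.re_ofReal_mul, Complex.exp_ofReal_mul_I_re]
      exact mul_pos h1 (Real.cos_pos_of_mem_Ioo ⟨by linarith, by linarith⟩)
    · rw [norm_mul, Complex.norm_exp_ofReal_mul_I, mul_one]
      simpa [abs_of_pos h1] using h2
  · rintro ⟨h1, h2⟩
    set w := z * Complex.exp (-(θ * Complex.I)) with hw
    have hwz : z = w * Complex.exp (θ * Complex.I) := by
      rw [hw, mul_assoc, ← Complex.exp_add]
      simp
    have hnorm : ‖w‖ = ‖z‖ := by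
      conv_rhs => rw [hwz, norm_mul, Complex.norm_exp_ofReal_mul_I, mul_one]
    have hw0 : w ≠ 0 := fun h => by simp [h] at h1
    have harg := abs_lt.1 (Complex.abs_arg_lt_pi_div_two_iff.2 (Or.inl h1))
    refine ⟨‖w‖, w.arg + θ, norm_pos_iff.2 hw0, hnorm ▸ h2, by linarith [harg.1],
      by linarith [harg.2], ?_⟩
    rw [hwz]
    push_cast
    rw [add_mul, Complex.exp_add, ← mul_assoc, Complex.norm_mul_exp_arg_mul_I]

lemma tempered_iff_polynomialGrowth {r : ℝ} (hr : 0 < r) (θ : ℝ) (f : ℂ → E) :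
    PolynomialGrowth (sector r (θ - Real.pi / 2) (θ + Real.pi / 2)) f ↔
      Tempered (𝓝[halfPlane θ] 0) f := by
  rw [sector_eq_halfPlane_inter_ball]
  constructor
  · rintro ⟨K, N, ε, hε, h⟩
    refine ⟨N, IsBigO.of_bound K ?_⟩
    rw [eventually_nhdsWithin_iff]
    filter_upwards [Metric.ball_mem_nhds (0 : ℂ) hε, Metric.ball_mem_nhds (0 : ℂ) hr]
      with z h1 h2 h3
    rw [Real.norm_of_nonneg (by positivity)]
    exact h z ⟨h3, h2⟩ (by simpa using h1)
  · rintro ⟨N, h⟩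
    obtain ⟨K, hK⟩ := h.bound
    rw [eventually_nhdsWithin_iff, Metric.eventually_nhds_iff] at hK
    obtain ⟨ε, hε, hK⟩ := hK
    refine ⟨K, N, ε, hε, fun z hz hzε => ?_⟩
    have := hK (by simpa using hzε) hz.1
    rwa [Real.norm_of_nonneg (by positivity)] at this

/-- Four half planes, in the directions of the coordinate half-axes, cover the punctured plane;
finiteness allows a common exponent. -/
lemma tempered_of_halfPlanes {f : ℂ → E} (h : ∀ θ, Tempered (𝓝[halfPlane θ] 0) f) :
    Tempered (𝓝[≠] 0) f := by
  have h1 : 𝓝[≠] (0 : ℂ) ≤ (𝓝[halfPlane 0] 0 ⊔ 𝓝[halfPlane Real.pi] 0) ⊔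
      (𝓝[halfPlane (Real.pi / 2)] 0 ⊔ 𝓝[halfPlane (-(Real.pi / 2))] 0) := by
    simp only [← nhdsWithin_union]
    refine nhdsWithin_mono _ fun z hz => ?_
    have e1 : Complex.exp (-(Real.pi / 2 * Complex.I)) = -Complex.I := by
      rw [Complex.exp_neg, Complex.exp_pi_div_two_mul_I, Complex.inv_I]
    have e2 : Complex.exp (Real.pi / 2 * Complex.I) = Complex.I := Complex.exp_pi_div_two_mul_I
    have e3 : Complex.exp (-(Real.pi * Complex.I)) = -1 := by
      rw [Complex.exp_neg, Complex.exp_pi_mul_I]; norm_num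
    simp only [halfPlane, mem_union, mem_ofPred_eq]
    push_cast
    simp only [neg_mul, neg_neg, e1, e2, e3]
    simp
    by_contra hcon
    push Not at hcon
    exact hz (Complex.ext hcon.1.symm hcon.2.symm)
  refine Tempered.mono ?_ h1
  exact Tempered.sup (sup_le (halfPlane_le _) (halfPlane_le _))
    (sup_le (halfPlane_le _) (halfPlane_le _))
    (Tempered.sup (halfPlane_le _) (halfPlane_le _) (h _) (h _))
    (Tempered.sup (halfPlane_le _) (halfPlane_le _) (h _) (h _))

end Tempered

/-! ### Scalar equations of first order with a meromorphic coefficient -/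

section ScalarEquation

/-- The branch of the logarithm on the half plane with direction `θ` (up to a constant). -/
noncomputable def halfLog (θ : ℝ) (z : ℂ) : ℂ := Complex.log (z * Complex.exp (-(θ * Complex.I)))

lemma hasDerivAt_halfLog {θ : ℝ} {z : ℂ} (hz : z ∈ halfPlane θ) :
    HasDerivAt (halfLog θ) z⁻¹ z := by
  have h1 : HasDerivAt (fun z => z * Complex.exp (-(θ * Complex.I)))
      (Complex.exp (-(θ * Complex.I))) z := by
    simpa using (hasDerivAt_id z).mul_const (Complex.exp (-(θ * Complex.I)))
  refine (h1.clog (Or.inl hz)).congr_deriv ?_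
  have h2 := ne_zero_of_mem_halfPlane hz
  have h3 := Complex.exp_ne_zero (-(θ * Complex.I))
  field_simp

/-- The modulus of the logarithm is at most `log (1 / ‖z‖) + π` near `0`, so an integer exponent `N
≥ ‖k‖` suffices, with the angular part absorbed into the constant. -/
lemma tempered_exp_halfLog (θ : ℝ) (k : ℂ) :
    Tempered (𝓝[halfPlane θ] 0) (fun z => Complex.exp (k * halfLog θ z)) := by
  obtain ⟨N, hN⟩ := exists_nat_ge ‖k‖
  refine ⟨N, IsBigO.of_bound (Real.exp (‖k‖ * Real.pi)) ?_⟩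
  rw [eventually_nhdsWithin_iff]
  filter_upwards [Metric.ball_mem_nhds (0 : ℂ) one_pos] with z h1 h2
  have hz0 : 0 < ‖z‖ := norm_pos_iff.2 (ne_zero_of_mem_halfPlane h2)
  have hz1 : ‖z‖ < 1 := by simpa using h1
  have hn : ‖z * Complex.exp (-(θ * Complex.I))‖ = ‖z‖ := by
    have : -((θ : ℂ) * Complex.I) = ((-θ : ℝ) : ℂ) * Complex.I := by push_cast; ring
    rw [norm_mul, this, Complex.norm_exp_ofReal_mul_I, mul_one]
  have hlog : ‖halfLog θ z‖ ≤ Real.log ‖z‖⁻¹ + Real.pi := by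
    refine (Complex.norm_le_abs_re_add_abs_im _).trans (add_le_add ?_ ?_)
    · rw [halfLog, Complex.log_re, hn, abs_of_nonpos (Real.log_nonpos hz0.le hz1.le), Real.log_inv]
    · rw [halfLog, Complex.log_im]
      exact Complex.abs_arg_le_pi _
  have hlog0 : 0 ≤ Real.log ‖z‖⁻¹ := Real.log_nonneg ((one_le_inv₀ hz0).2 hz1.le)
  rw [Complex.norm_exp, Real.norm_of_nonneg (by positivity)]
  calc Real.exp (k * halfLog θ z).re ≤ Real.exp (‖k‖ * Real.pi + N * Real.log ‖z‖⁻¹) := by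
        refine Real.exp_le_exp.2 ((Complex.re_le_norm _).trans ?_)
        rw [norm_mul]
        calc ‖k‖ * ‖halfLog θ z‖ ≤ ‖k‖ * (Real.log ‖z‖⁻¹ + Real.pi) := by gcongr
          _ = ‖k‖ * Real.pi + ‖k‖ * Real.log ‖z‖⁻¹ := by ring
          _ ≤ _ := by gcongr
    _ = _ := by
        rw [Real.exp_add, Real.exp_nat_mul, Real.exp_log (inv_pos.2 hz0)]

/-- Peel off `B 0` and lower the pole order: `B 0 / z ^ (n + 1)` has an explicit primitive unless `n
= 0`, when it contributes to the residue `k`. Removing the residue is what makes `G` single-valued.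
-/
lemma exists_primitive_div_pow (n : ℕ) (B : ℂ → ℂ) (hB : AnalyticAt ℂ B 0) :
    ∃ (k : ℂ) (G : ℂ → ℂ), ∀ᶠ z in 𝓝[≠] (0 : ℂ), HasDerivAt G (B z / z ^ n - k / z) z := by
  induction n generalizing B with
  | zero =>
    obtain ⟨r, hr, h⟩ := Metric.eventually_nhds_iff_ball.1 hB.eventually_analyticAt
    obtain ⟨G, -, hG⟩ := exists_primitive_of_convex Metric.isOpen_ball (convex_ball (0 : ℂ) r)
      (t₀ := 0) (fun z hz => (h z hz).differentiableAt.differentiableWithinAt)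
    refine ⟨0, G, nhdsWithin_le_nhds ?_⟩
    filter_upwards [Metric.ball_mem_nhds (0 : ℂ) hr] with z hz
    simpa using hG z hz
  | succ n ih =>
    have hB1 : AnalyticAt ℂ (dslope B 0) 0 := by
      obtain ⟨p, hp⟩ := hB
      exact ⟨_, hp.has_fpower_series_dslope_fslope⟩
    have hBd : ∀ z, B z = B 0 + z * dslope B 0 z := fun z => by
      have := sub_smul_dslope B 0 z
      rw [sub_zero, smul_eq_mul] at this
      rw [this]; ring
    obtain ⟨k, G, hG⟩ := ih _ hB1
    rcases Nat.eq_zero_or_pos n with rfl | hn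
    · refine ⟨k + B 0, G, ?_⟩
      filter_upwards [hG, self_mem_nhdsWithin] with z hz hz0
      refine hz.congr_deriv ?_
      rw [hBd z]
      have : z ≠ 0 := hz0
      field_simp
      ring
    · refine ⟨k, fun z => G z + B 0 * ((z ^ n)⁻¹ / (-n)), ?_⟩
      filter_upwards [hG, self_mem_nhdsWithin] with z hz hz0
      have hz0 : z ≠ 0 := hz0
      have h1 := (((hasDerivAt_pow n z).fun_inv (pow_ne_zero n hz0)).div_const (-(n : ℂ))).const_mul
        (B 0)
      refine (hz.add h1).congr_deriv ?_
      rw [hBd z]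
      obtain ⟨m, rfl⟩ := Nat.exists_eq_succ_of_ne_zero hn.ne'
      have hm : ((m.succ : ℕ) : ℂ) ≠ 0 := Nat.cast_ne_zero.2 (Nat.succ_ne_zero m)
      simp only [Nat.succ_eq_add_one, Nat.add_sub_cancel] at *
      field_simp
      ring

lemma exists_primitive_of_meromorphicAt {g : ℂ → ℂ} (hg : MeromorphicAt g 0) :
    ∃ (k : ℂ) (G : ℂ → ℂ), ∀ᶠ z in 𝓝[≠] (0 : ℂ), HasDerivAt G (g z - k / z) z := by
  obtain ⟨n, hn⟩ := hg
  obtain ⟨k, G, hG⟩ := exists_primitive_div_pow n _ hn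
  refine ⟨k, G, ?_⟩
  filter_upwards [hG, self_mem_nhdsWithin] with z hz hz0
  have hz0 : z ≠ 0 := hz0
  refine hz.congr_deriv ?_
  rw [sub_zero, smul_eq_mul, mul_div_cancel_left₀ _ (pow_ne_zero n hz0)]

/-- If the solutions of a scalar equation `u' = g u` with `g` meromorphic at `0` are tempered, so
are their inverses. -/
lemma tempered_inv_of_scalar_equation {g : ℂ → ℂ} (hg : MeromorphicAt g 0) {r : ℝ} (hr : 0 < r)
    {u : ℝ → ℂ → ℂ} (hu0 : ∀ θ, ∀ z ∈ halfPlane θ ∩ Metric.ball 0 r, u θ z ≠ 0)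
    (hu : ∀ θ, ∀ z ∈ halfPlane θ ∩ Metric.ball 0 r, HasDerivAt (u θ) (g z * u θ z) z)
    (ht : ∀ θ, Tempered (𝓝[halfPlane θ] 0) (u θ)) (θ : ℝ) :
    Tempered (𝓝[halfPlane θ] 0) (fun z => (u θ z)⁻¹) := by
  obtain ⟨k, G, hG⟩ := exists_primitive_of_meromorphicAt hg
  rw [eventually_nhdsWithin_iff, Metric.eventually_nhds_iff_ball] at hG
  obtain ⟨ρ', hρ', hG⟩ := hG
  set ρ := min r ρ'
  have hρ : 0 < ρ := lt_min hr hρ'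
  have hG' : ∀ z ∈ Metric.ball (0 : ℂ) ρ, z ≠ 0 → HasDerivAt G (g z - k / z) z := fun z hz hz0 =>
    hG z (Metric.ball_subset_ball (min_le_right _ _) hz) hz0
  -- Both sides solve the equation satisfied by `u θ`, so on the connected half disc they are
  -- proportional.
  have key : ∀ θ, ∃ c : ℂ, c ≠ 0 ∧ ∀ z ∈ halfPlane θ ∩ Metric.ball 0 ρ,
      Complex.exp (G z) * Complex.exp (k * halfLog θ z) = c * u θ z := by
    intro θ
    have hmem : ∀ z ∈ halfPlane θ ∩ Metric.ball 0 ρ, z ∈ halfPlane θ ∩ Metric.ball 0 r :=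
      fun z hz => ⟨hz.1, Metric.ball_subset_ball (min_le_left _ _) hz.2⟩
    have hd : ∀ z ∈ halfPlane θ ∩ Metric.ball 0 ρ, HasDerivAt
        (fun z => Complex.exp (G z) * Complex.exp (k * halfLog θ z) / u θ z) 0 z := by
      intro z hz
      have hz0 := ne_zero_of_mem_halfPlane hz.1
      have h1 := (hG' z hz.2 hz0).cexp
      have h2 := ((hasDerivAt_halfLog hz.1).const_mul k).cexp
      refine ((h1.fun_mul h2).fun_div (hu θ z (hmem z hz)) (hu0 θ z (hmem z hz))).congr_deriv ?_
      have h3 := hu0 θ z (hmem z hz)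
      field_simp
      ring
    have hopen : IsOpen (halfPlane θ ∩ Metric.ball 0 ρ) :=
      (isOpen_halfPlane θ).inter Metric.isOpen_ball
    have hconv : Convex ℝ (halfPlane θ ∩ Metric.ball (0 : ℂ) ρ) :=
      (convex_halfPlane θ).inter (convex_ball 0 ρ)
    obtain ⟨c, hc⟩ := hopen.exists_is_const_of_deriv_eq_zero hconv.isPreconnected
      (fun t ht => (hd t ht).differentiableAt.differentiableWithinAt) (fun t ht => (hd t ht).deriv)
    have hc' : ∀ z ∈ halfPlane θ ∩ Metric.ball 0 ρ,
        Complex.exp (G z) * Complex.exp (k * halfLog θ z) = c * u θ z := fun z hz => by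
      rw [← hc z hz, div_mul_cancel₀ _ (hu0 θ z (hmem z hz))]
    -- A product of exponentials is never zero, so `c = 0` could occur only over an empty domain;
    -- any nonzero constant then serves.
    by_cases hc0 : c = 0
    · refine ⟨1, one_ne_zero, fun z hz => absurd (hc' z hz) ?_⟩
      rw [hc0, zero_mul]
      exact mul_ne_zero (Complex.exp_ne_zero _) (Complex.exp_ne_zero _)
    · exact ⟨c, hc0, hc'⟩
  have hball : ∀ θ, ∀ᶠ z in 𝓝[halfPlane θ] (0 : ℂ), z ∈ halfPlane θ ∩ Metric.ball 0 ρ := fun θ =>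
    inter_mem self_mem_nhdsWithin (nhdsWithin_le_nhds (Metric.ball_mem_nhds 0 hρ))
  -- Here growth in all directions is used: `G` does not depend on `θ`, so the bounds for the
  -- individual `u θ` combine into one for `exp G` on a punctured neighbourhood.
  have hh : Tempered (𝓝[≠] 0) (fun z => Complex.exp (G z)) := by
    refine tempered_of_halfPlanes fun θ => ?_
    obtain ⟨c, -, hc⟩ := key θ
    refine (((Tempered.const c).mul (ht θ)).mul (tempered_exp_halfLog θ (-k))).congr ?_
    filter_upwards [hball θ] with z hz
    rw [← hc z hz, mul_assoc, ← Complex.exp_add]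
    simp
  have hmer : MeromorphicAt (fun z => Complex.exp (G z)) 0 := by
    refine meromorphicAt_of_tempered ?_ hh
    rw [eventually_nhdsWithin_iff]
    filter_upwards [Metric.ball_mem_nhds (0 : ℂ) hρ] with z hz hz0
    exact (hG' z hz hz0).cexp.differentiableAt
  obtain ⟨c, hc0, hc⟩ := key θ
  have hinv := (tempered_of_meromorphicAt hmer.inv).mono (halfPlane_le θ)
  refine (((Tempered.const c).mul hinv).mul (tempered_exp_halfLog θ (-k))).congr ?_
  filter_upwards [hball θ] with z hz
  have h1 := hc z hz
  have h2 : u θ z = c⁻¹ * (Complex.exp (G z) * Complex.exp (k * halfLog θ z)) := by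
    rw [h1, inv_mul_cancel_left₀ hc0]
  rw [h2, neg_mul, Complex.exp_neg, mul_inv, mul_inv, inv_inv, Pi.inv_apply]
  ring

end ScalarEquation

/-! ### Liouville's formula -/

section Liouville

variable {n : ℕ}

/-- Liouville's formula for `M' = M A`. -/
lemma hasDerivAt_det {M : ℂ → Matrix (Fin n) (Fin n) ℂ} {A : Matrix (Fin n) (Fin n) ℂ} {z : ℂ}
    (h : ∀ i j, HasDerivAt (fun t => M t i j) ((M z * A) i j) z) :
    HasDerivAt (fun t => (M t).det) (A.trace * (M z).det) z := by
  let f : ContinuousMultilinearMap ℂ (fun _ : Fin n => Fin n → ℂ) ℂ :=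
    { toMultilinearMap := (Matrix.detRowAlternating (n := Fin n) (R := ℂ)).toMultilinearMap
      cont := Continuous.matrix_det (A := fun m : Matrix (Fin n) (Fin n) ℂ => m) continuous_id }
  have h1 : HasDerivAt (fun t => fun j i => M t i j) (fun j i => (M z * A) i j) z :=
    hasDerivAt_pi.2 fun j => hasDerivAt_pi.2 fun i => h i j
  have h2 := (f.hasFDerivAt (fun j i => M z i j)).comp_hasDerivAt z h1
  have h3 : (fun t => (M t).det) = f ∘ fun t => fun j i => M t i j := by
    ext t
    exact (Matrix.det_transpose (M t)).symm
  rw [h3]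
  refine h2.congr_deriv ?_
  rw [ContinuousMultilinearMap.linearDeriv_apply, Matrix.trace, Finset.sum_mul]
  refine Finset.sum_congr rfl fun j _ => ?_
  -- Differentiating column `j` of `M` gives a combination of the columns of `M`; in the determinant
  -- only the `j`-th survives, with coefficient `A j j`.
  have h4 : (fun i => (M z * A) i j) = ∑ l, A l j • (M z).transpose l := by
    ext i
    simp [Matrix.mul_apply, mul_comm]
  change Matrix.det (Matrix.updateRow (M z).transpose j (fun i => (M z * A) i j)) = _
  rw [h4, Matrix.det_updateRow_sum, Matrix.det_transpose]
  rfl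

end Liouville

/-! ### The local coordinate at a point of the sphere -/

section LocalCoordinate

/-- The inverse of the change of coordinates `aff p`. -/
noncomputable def affInv (p : OnePoint ℂ) (t : ℂ) : ℂ := OnePoint.elim p t⁻¹ (fun c => t - c)

lemma affInv_aff (p : OnePoint ℂ) (z : ℂ) : affInv p (aff p z) = z := by
  induction p using OnePoint.rec with
  | infty => exact inv_inv z
  | coe c => exact add_sub_cancel_left c z

lemma aff_affInv (p : OnePoint ℂ) (t : ℂ) : aff p (affInv p t) = t := by
  induction p using OnePoint.rec with
  | infty => exact inv_inv t
  | coe c => exact add_sub_cancel c t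

lemma analyticAt_aff (p : OnePoint ℂ) {z : ℂ} (hz : z ≠ 0) : AnalyticAt ℂ (aff p) z := by
  induction p using OnePoint.rec with
  | infty => exact analyticAt_inv hz
  | coe c => exact analyticAt_const.add analyticAt_id

lemma hasDerivAt_affInv (p : OnePoint ℂ) {z : ℂ} (hz : z ≠ 0) :
    HasDerivAt (affInv p) (deriv (aff p) z)⁻¹ (aff p z) := by
  induction p using OnePoint.rec with
  | infty =>
    have h1 : deriv (aff OnePoint.infty) z = -(z ^ 2)⁻¹ := (hasDerivAt_inv hz).deriv
    have h2 : HasDerivAt (affInv OnePoint.infty) (-((z⁻¹) ^ 2)⁻¹) z⁻¹ :=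
      hasDerivAt_inv (inv_ne_zero hz)
    rw [h1]
    refine h2.congr_deriv ?_
    rw [inv_neg, inv_inv, inv_pow, inv_inv]
  | coe c =>
    have h1 : deriv (aff (c : OnePoint ℂ)) z = 1 := ((hasDerivAt_id z).const_add c).deriv
    rw [h1, inv_one]
    exact (hasDerivAt_id _).sub_const c

lemma deriv_aff_ne_zero (p : OnePoint ℂ) {z : ℂ} (hz : z ≠ 0) : deriv (aff p) z ≠ 0 := by
  intro h
  have h1 := (hasDerivAt_affInv p hz).comp z (analyticAt_aff p hz).differentiableAt.hasDerivAt
  have h2 : affInv p ∘ aff p = id := funext (affInv_aff p)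
  rw [h2, h, mul_zero] at h1
  exact zero_ne_one (h1.unique (hasDerivAt_id z))

lemma loc_of_ne_zero (p : OnePoint ℂ) {z : ℂ} (hz : z ≠ 0) : loc p z = aff p z := if_neg hz

lemma tendsto_aff (p : OnePoint ℂ) :
    Tendsto (fun z => (aff p z : OnePoint ℂ)) (𝓝[≠] 0) (𝓝 p) := by
  induction p using OnePoint.rec with
  | infty =>
    have h1 : Tendsto (fun z : ℂ => z⁻¹) (𝓝[≠] 0) (coclosedCompact ℂ) := by
      rw [coclosedCompact_eq_cocompact, ← Metric.cobounded_eq_cocompact]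
      exact tendsto_inv₀_nhdsNE_zero
    exact OnePoint.tendsto_coe_infty.comp h1
  | coe c =>
    have h1 : Tendsto (fun z : ℂ => c + z) (𝓝[≠] 0) (𝓝 c) := by
      have : Tendsto (fun z : ℂ => c + z) (𝓝 0) (𝓝 (c + 0)) := tendsto_const_nhds.add tendsto_id
      rw [add_zero] at this
      exact this.mono_left nhdsWithin_le_nhds
    exact (OnePoint.continuous_coe.tendsto c).comp h1

lemma aff_ne_self (p : OnePoint ℂ) {z : ℂ} (hz : z ≠ 0) : (aff p z : OnePoint ℂ) ≠ p := by
  induction p using OnePoint.rec with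
  | infty => exact OnePoint.coe_ne_infty _
  | coe c =>
    intro h
    have : c + z = c := OnePoint.coe_injective h
    exact hz (by simpa using this)

lemma exists_punctured_chart {F ι : Type*} [NormedAddCommGroup F] [NormedSpace ℂ F]
    {V : VectorBundleCore ℂ (OnePoint ℂ) F ι} (D : OnePoint ℂ →₀ ℕ) (Z : Finset ℂ)
    {p : OnePoint ℂ} {i : ι} (hp : p ∈ V.baseSet i) :
    ∃ r > 0, ∀ z ∈ Metric.ball (0 : ℂ) r, z ≠ 0 →
      (aff p z : OnePoint ℂ) ∈ V.baseSet i ∧ aff p z ∈ regularSet D Z := by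
  -- The point `p` is taken out of the exceptional set, because it may itself be a pole or lie in
  -- `Z`; the punctured coordinate disc never returns to it.
  have hfin : (((D.support : Set (OnePoint ℂ)) ∪ (fun c : ℂ => (c : OnePoint ℂ)) '' Z) \ {p}).Finite :=
    (D.support.finite_toSet.union (Z.finite_toSet.image _)).sdiff
  have h1 := (tendsto_aff p).eventually (Eventually.and ((V.isOpen_baseSet i).mem_nhds hp)
    (hfin.isClosed.isOpen_compl.mem_nhds (by simp)))
  rw [eventually_nhdsWithin_iff, Metric.eventually_nhds_iff_ball] at h1
  obtain ⟨r, hr, h⟩ := h1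
  refine ⟨r, hr, fun z hz hz0 => ⟨(h z hz hz0).1, fun hD => ?_, fun hZ => ?_⟩⟩
  · exact (h z hz hz0).2 ⟨Or.inl hD, aff_ne_self p hz0⟩
  · exact (h z hz hz0).2 ⟨Or.inr ⟨_, hZ, rfl⟩, aff_ne_self p hz0⟩

end LocalCoordinate

/-! ### Frames in the local coordinate -/

section LocalFrames

variable {F ι : Type*} [NormedAddCommGroup F] [NormedSpace ℂ F]
  {V : VectorBundleCore ℂ (OnePoint ℂ) F ι} {D : OnePoint ℂ →₀ ℕ}
  (conn : MeromorphicConnection V D)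

/-- The connection matrix in the local coordinate at `p`. -/
noncomputable def localMatrix (i : ι) (p : OnePoint ℂ) (z : ℂ) : F →L[ℂ] F :=
  deriv (aff p) z • conn.A i (aff p z)

lemma differentiableAt_localMatrix [CompleteSpace F] {i : ι} {p : OnePoint ℂ} {z : ℂ} (hz : z ≠ 0)
    (hi : (aff p z : OnePoint ℂ) ∈ V.baseSet i) (hD : (aff p z : OnePoint ℂ) ∉ D.support) :
    DifferentiableAt ℂ (localMatrix conn i p) z := by
  have h1 := analyticAt_aff p hz
  have h2 : DifferentiableAt ℂ (fun w => conn.A i (aff p w)) z :=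
    DifferentiableAt.comp (g := conn.A i) z (conn.analytic i _ hi hD).differentiableAt
      h1.differentiableAt
  exact h1.deriv.differentiableAt.smul h2

variable {conn} in
-- The factor `deriv (aff p)` in `localMatrix` cancels against the derivative of `affInv p`, so
-- equations solved in the coordinate `z`, uniformly for finite points and `∞`, give frames in `t`.
lemma isDualFrame_of_local {i : ι} {p : OnePoint ℂ} {S : Set ℂ} (hS : IsOpen S)
    (h : ∀ z ∈ S, z ≠ 0 ∧ (aff p z : OnePoint ℂ) ∈ V.baseSet i ∧
      (aff p z : OnePoint ℂ) ∉ D.support) {Y X : ℂ → F →L[ℂ] F}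
    (hY : ∀ z ∈ S, HasDerivAt Y (Y z * localMatrix conn i p z) z)
    (hX : ∀ z ∈ S, HasDerivAt X (-(localMatrix conn i p z * X z)) z)
    (hYX : ∀ z ∈ S, Y z * X z = 1) (hXY : ∀ z ∈ S, X z * Y z = 1) :
    IsDualFrame conn i (aff p '' S) (fun t => Y (affInv p t)) (fun t => X (affInv p t)) where
  isOpen := by
    rw [isOpen_iff_mem_nhds]
    rintro _ ⟨z, hz, rfl⟩
    have h1 := (hasDerivAt_affInv p (h z hz).1).continuousAt
    have h2 : S ∈ 𝓝 (affInv p (aff p z)) := by rw [affInv_aff]; exact hS.mem_nhds hz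
    filter_upwards [h1.preimage_mem_nhds h2] with t ht
    exact ⟨affInv p t, ht, aff_affInv p t⟩
  chart := by
    rintro _ ⟨z, hz, rfl⟩
    exact (h z hz).2.1
  regular := by
    rintro _ ⟨z, hz, rfl⟩
    exact (h z hz).2.2
  hasDerivAt := by
    rintro _ ⟨z, hz, rfl⟩
    have h1 := hasDerivAt_affInv p (h z hz).1
    have h2 : HasDerivAt Y (Y z * localMatrix conn i p z) (affInv p (aff p z)) := by
      rw [affInv_aff]; exact hY z hz
    refine (h2.scomp _ h1).congr_deriv ?_
    rw [affInv_aff, localMatrix, mul_smul_comm, smul_smul,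
      inv_mul_cancel₀ (deriv_aff_ne_zero p (h z hz).1), one_smul]
  hasDerivAt_inv := by
    rintro _ ⟨z, hz, rfl⟩
    have h1 := hasDerivAt_affInv p (h z hz).1
    have h2 : HasDerivAt X (-(localMatrix conn i p z * X z)) (affInv p (aff p z)) := by
      rw [affInv_aff]; exact hX z hz
    refine (h2.scomp _ h1).congr_deriv ?_
    rw [affInv_aff, localMatrix, smul_mul_assoc, smul_neg, smul_smul,
      inv_mul_cancel₀ (deriv_aff_ne_zero p (h z hz).1), one_smul]
  mul_inv := by
    rintro _ ⟨z, hz, rfl⟩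
    rw [affInv_aff]
    exact hYX z hz
  inv_mul := by
    rintro _ ⟨z, hz, rfl⟩
    rw [affInv_aff]
    exact hXY z hz

end LocalFrames

/-! ### Growth of inverse frames and meromorphy of the section -/

section RegularFrames

variable {ι : Type*} {α : ℕ} {V : VectorBundleCore ℂ (OnePoint ℂ) (Fin α → ℂ) ι}
  {D : OnePoint ℂ →₀ ℕ} {hV : IsHolomorphic V} {conn : MeromorphicConnection V D}

/-- The matrix of a continuous linear endomorphism of `ℂ ^ α`. -/
noncomputable def clmMatrix (L : (Fin α → ℂ) →L[ℂ] (Fin α → ℂ)) : Matrix (Fin α) (Fin α) ℂ :=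
  LinearMap.toMatrix' (L : (Fin α → ℂ) →ₗ[ℂ] (Fin α → ℂ))

lemma clmMatrix_apply (L : (Fin α → ℂ) →L[ℂ] (Fin α → ℂ)) (i j : Fin α) :
    clmMatrix L i j = L (Pi.single j 1) i := by
  rw [clmMatrix, LinearMap.toMatrix'_apply]
  simp

lemma clmMatrix_mul (L M : (Fin α → ℂ) →L[ℂ] (Fin α → ℂ)) :
    clmMatrix (L * M) = clmMatrix L * clmMatrix M :=
  LinearMap.toMatrix'_mul (L : (Fin α → ℂ) →ₗ[ℂ] (Fin α → ℂ)) M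

lemma clmMatrix_one : clmMatrix (1 : (Fin α → ℂ) →L[ℂ] (Fin α → ℂ)) = 1 :=
  LinearMap.toMatrix'_one

lemma apply_eq_sum_clmMatrix (L : (Fin α → ℂ) →L[ℂ] (Fin α → ℂ)) (v : Fin α → ℂ) (i : Fin α) :
    L v i = ∑ j, v j * clmMatrix L i j := by
  have h := congrFun (LinearMap.toMatrix'_mulVec (L : (Fin α → ℂ) →ₗ[ℂ] (Fin α → ℂ)) v) i
  simp only [Matrix.mulVec, dotProduct] at h
  rw [← ContinuousLinearMap.coe_coe, ← h]
  exact Finset.sum_congr rfl fun j _ => mul_comm _ _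

lemma hasDerivAt_clmMatrix {L : ℂ → (Fin α → ℂ) →L[ℂ] (Fin α → ℂ)}
    {L' : (Fin α → ℂ) →L[ℂ] (Fin α → ℂ)} {z : ℂ} (h : HasDerivAt L L' z) (i j : Fin α) :
    HasDerivAt (fun w => clmMatrix (L w) i j) (clmMatrix L' i j) z := by
  have h1 := h.clm_apply (hasDerivAt_const z (Pi.single j (1 : ℂ) : Fin α → ℂ))
  have h2 := hasDerivAt_pi.1 h1 i
  simp only [clmMatrix_apply]
  simpa using h2

lemma analyticAt_clmMatrix {L : ℂ → (Fin α → ℂ) →L[ℂ] (Fin α → ℂ)} {z : ℂ}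
    (h : AnalyticAt ℂ L z) (i j : Fin α) : AnalyticAt ℂ (fun w => clmMatrix (L w) i j) z := by
  simp only [clmMatrix_apply]
  exact analyticAt_pi_iff.1 (analyticAt_clm_apply h analyticAt_const) i

lemma meromorphicAt_trace_localMatrix (conn : MeromorphicConnection V D) {i : ι} {p : OnePoint ℂ}
    (hp : p ∈ V.baseSet i) :
    MeromorphicAt (fun z => (clmMatrix (localMatrix conn i p z)).trace) 0 := by
  obtain ⟨B, hB, h⟩ := conn.pole i p hp
  have h1 : AnalyticAt ℂ (fun z => (clmMatrix (B z)).trace) 0 :=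
    Finset.analyticAt_fun_sum _ fun j _ => analyticAt_clmMatrix hB j j
  have h2 : MeromorphicAt (fun z : ℂ => z ^ D p) 0 := (analyticAt_id.pow (D p)).meromorphicAt
  refine (h1.meromorphicAt.div h2).congr ?_
  filter_upwards [h, self_mem_nhdsWithin] with z hz hz0
  have h3 : z ^ D p ≠ 0 := pow_ne_zero _ hz0
  have h4 : clmMatrix (B z) = z ^ D p • clmMatrix (localMatrix conn i p z) := by
    ext a b
    rw [← hz]
    simp only [clmMatrix_apply, Matrix.smul_apply]
    rfl
  rw [Pi.div_apply, h4, Matrix.trace_smul, smul_eq_mul, mul_div_cancel_left₀ _ h3]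

/-- At a point where the connection has no pole, local frames are bounded. -/
lemma exists_bounded_frame {i : ι} {p : OnePoint ℂ} (hp : p ∈ V.baseSet i) (hpD : p ∉ D.support)
    {r : ℝ} (hr : 0 < r) (hch : ∀ z ∈ Metric.ball (0 : ℂ) r, z ≠ 0 →
      (aff p z : OnePoint ℂ) ∈ V.baseSet i ∧ (aff p z : OnePoint ℂ) ∉ D.support) :
    ∃ ρ > 0, ρ ≤ r ∧ ∀ θ, ∃ Y X, IsDualFrame conn i (aff p '' (halfPlane θ ∩ Metric.ball 0 ρ)) Y X ∧
      ∀ j l, Tempered (𝓝[halfPlane θ] 0) (fun z => clmMatrix (X (aff p z)) j l) := by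
  obtain ⟨B, hB, h⟩ := conn.pole i p hp
  -- Since `D p = 0`, the pole condition says that the connection matrix in the coordinate `z`
  -- extends holomorphically to `B` across `0`; a frame for `B` on the full disc restricts to every
  -- half disc.
  rw [Finsupp.notMem_support_iff] at hpD
  simp only [hpD, pow_zero, one_smul] at h
  obtain ⟨ρ', hρ', hball⟩ := Metric.eventually_nhds_iff_ball.1
    ((eventually_nhdsWithin_iff.1 h).and hB.eventually_analyticAt)
  set ρ := min r ρ'
  have hρ : 0 < ρ := lt_min hr hρ'
  have hρ1 : Metric.ball (0 : ℂ) ρ ⊆ Metric.ball 0 ρ' := Metric.ball_subset_ball (min_le_right _ _)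
  have hρ2 : Metric.ball (0 : ℂ) ρ ⊆ Metric.ball 0 r := Metric.ball_subset_ball (min_le_left _ _)
  obtain ⟨Y, X, hY, hX, hYX, hXY⟩ := exists_frame Metric.isOpen_ball (convex_ball (0 : ℂ) ρ)
    ⟨0, Metric.mem_ball_self hρ⟩
    (fun z hz => (hball z (hρ1 hz)).2.differentiableAt.differentiableWithinAt)
  refine ⟨ρ, hρ, min_le_left _ _, fun θ => ⟨_, _, isDualFrame_of_local (Y := Y) (X := X)
    ((isOpen_halfPlane θ).inter Metric.isOpen_ball) ?_ ?_ ?_ (fun z hz => hYX z hz.2)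
    (fun z hz => hXY z hz.2), fun j l => ?_⟩⟩
  · intro z hz
    have hz0 := ne_zero_of_mem_halfPlane hz.1
    exact ⟨hz0, hch z (hρ2 hz.2) hz0⟩
  · intro z hz
    have h1 : localMatrix conn i p z = B z :=
      (hball z (hρ1 hz.2)).1 (ne_zero_of_mem_halfPlane hz.1)
    rw [h1]
    exact hY z hz.2
  · intro z hz
    have h1 : localMatrix conn i p z = B z :=
      (hball z (hρ1 hz.2)).1 (ne_zero_of_mem_halfPlane hz.1)
    rw [h1]
    exact hX z hz.2
  · simp only [affInv_aff]
    exact Tempered.of_continuousAt (halfPlane_le θ)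
      (hasDerivAt_clmMatrix (hX 0 (Metric.mem_ball_self hρ)) j l).continuousAt

/-- At a regular singular point the inverses of the local frames are tempered. -/
lemma exists_regular_frame (hreg : (conn.dual hV).IsRegular) {i : ι} {p : OnePoint ℂ}
    (hp : p ∈ V.baseSet i) (hpD : p ∈ D.support)
    {r : ℝ} (hr : 0 < r) (hch : ∀ z ∈ Metric.ball (0 : ℂ) r, z ≠ 0 →
      (aff p z : OnePoint ℂ) ∈ V.baseSet i ∧ (aff p z : OnePoint ℂ) ∉ D.support) (θ : ℝ) :
    ∃ Y X, IsDualFrame conn i (aff p '' (halfPlane θ ∩ Metric.ball 0 r)) Y X ∧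
      ∀ j l, Tempered (𝓝[halfPlane θ] 0) (fun z => clmMatrix (X (aff p z)) j l) := by
  have hS : ∀ θ, IsOpen (halfPlane θ ∩ Metric.ball 0 r) := fun θ =>
    (isOpen_halfPlane θ).inter Metric.isOpen_ball
  have hch' : ∀ θ, ∀ z ∈ halfPlane θ ∩ Metric.ball 0 r, z ≠ 0 ∧
      (aff p z : OnePoint ℂ) ∈ V.baseSet i ∧ (aff p z : OnePoint ℂ) ∉ D.support := fun θ z hz =>
    ⟨ne_zero_of_mem_halfPlane hz.1, hch z hz.2 (ne_zero_of_mem_halfPlane hz.1)⟩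
  have hne : ∀ θ, (halfPlane θ ∩ Metric.ball 0 r).Nonempty := fun θ => by
    refine ⟨(r / 2 : ℝ) * Complex.exp (θ * Complex.I), ?_, ?_⟩
    · simp only [halfPlane, mem_ofPred_eq]
      rw [mul_assoc, ← Complex.exp_add, add_neg_cancel, Complex.exp_zero, mul_one,
        Complex.ofReal_re]
      positivity
    · rw [mem_ball_zero_iff, norm_mul, Complex.norm_exp_ofReal_mul_I, mul_one, Complex.norm_real,
        Real.norm_of_nonneg (by positivity)]
      linarith
  have hframe := fun θ => exists_frame (hS θ) ((convex_halfPlane θ).inter (convex_ball 0 r))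
    (hne θ) (A := localMatrix conn i p) fun z hz => (differentiableAt_localMatrix conn
      (hch' θ z hz).1 (hch' θ z hz).2.1 (hch' θ z hz).2.2).differentiableWithinAt
  choose Y X hY hX hYX hXY using hframe
  have hdual := fun θ => isDualFrame_of_local (conn := conn) (hS θ) (hch' θ) (hY θ) (hX θ) (hYX θ)
    (hXY θ)
  have hpi : ∀ θ : ℝ, θ + Real.pi / 2 - (θ - Real.pi / 2) < 2 * Real.pi := fun θ => by
    have := Real.pi_pos
    linarith
  have hlt : ∀ θ : ℝ, θ - Real.pi / 2 < θ + Real.pi / 2 := fun θ => by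
    have := Real.pi_pos
    linarith
  have hYt : ∀ θ j l, Tempered (𝓝[halfPlane θ] 0) (fun z => clmMatrix (Y θ z) j l) := by
    intro θ j l
    -- The rows of `Y θ` are flat sections of the dual bundle, so regularity bounds every matrix
    -- entry.
    have h1 := hreg p hpD i hp r _ _ hr (hlt θ) (hpi θ) (by
        intro z hz
        rw [sector_eq_halfPlane_inter_ball] at hz
        rw [loc_of_ne_zero p (hch' θ z hz).1]
        exact (hch' θ z hz).2)
      (ofRep (dualBundle V) i
        (fun t => (ContinuousLinearMap.proj j : (Fin α → ℂ) →L[ℂ] ℂ).comp (Y θ (affInv p t)))) (by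
        rw [sector_eq_halfPlane_inter_ball]
        exact (hdual θ).isFlatOn hV _)
    rw [tempered_iff_polynomialGrowth hr] at h1
    refine h1.of_isBigO (IsBigO.of_bound ‖(Pi.single l 1 : Fin α → ℂ)‖ ?_)
    filter_upwards [inter_mem self_mem_nhdsWithin
      (nhdsWithin_le_nhds (Metric.ball_mem_nhds 0 hr))] with z hz
    rw [rep_ofRep (V := dualBundle V) (hch' θ z hz).2.1, affInv_aff, clmMatrix_apply, mul_comm]
    exact ((ContinuousLinearMap.proj j : (Fin α → ℂ) →L[ℂ] ℂ).comp (Y θ z)).le_opNorm _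
  have hmul : ∀ θ, ∀ z ∈ halfPlane θ ∩ Metric.ball 0 r,
      clmMatrix (Y θ z) * clmMatrix (X θ z) = 1 := fun θ z hz => by
    rw [← clmMatrix_mul, hYX θ z hz, clmMatrix_one]
  -- The determinants for all `θ` solve the same scalar equation, whose coefficient is the trace of
  -- the connection matrix.
  have hdet := tempered_inv_of_scalar_equation (meromorphicAt_trace_localMatrix conn hp) hr
    (u := fun θ z => (clmMatrix (Y θ z)).det)
    (fun θ z hz h0 => by
      have := congrArg Matrix.det (hmul θ z hz)
      rw [Matrix.det_mul, h0, zero_mul, Matrix.det_one] at this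
      exact zero_ne_one this)
    (fun θ z hz => hasDerivAt_det fun a b => by
      have := hasDerivAt_clmMatrix (hY θ z hz) a b
      rwa [clmMatrix_mul] at this)
    (fun θ => Tempered.det (halfPlane_le θ) (hYt θ)) θ
  refine ⟨_, _, hdual θ, fun j l => ?_⟩
  simp only [affInv_aff]
  refine (Tempered.matrix_inv (halfPlane_le θ) (hYt θ) hdet j l).congr ?_
  filter_upwards [inter_mem self_mem_nhdsWithin
      (nhdsWithin_le_nhds (Metric.ball_mem_nhds 0 hr))] with z hz
  rw [Matrix.inv_eq_right_inv (hmul θ z hz)]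

variable {ψ : LinearODE α} {ω : ℂ → (Fin α → ℂ)} {Z : Finset ℂ}

/-- A section whose periods solve an equation regular at `p` is meromorphic at `p`. -/
lemma meromorphicAt_rep_aff (hreg : (conn.dual hV).IsRegular)
    (h : ∀ t ∈ regularSet D Z, HasPeriods hV conn ψ ω t) {p : OnePoint ℂ}
    (hψp : ψ.IsRegularAt (regularSet D Z) p) {i : ι} (hp : p ∈ V.baseSet i) :
    MeromorphicAt (fun z => rep V i ω (aff p z)) 0 := by
  obtain ⟨r₀, hr₀, hch₀⟩ := exists_punctured_chart (V := V) D Z hp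
  obtain ⟨r, hr, hrr, hframe⟩ : ∃ r > 0, r ≤ r₀ ∧
      ∀ θ, ∃ Y X, IsDualFrame conn i (aff p '' (halfPlane θ ∩ Metric.ball 0 r)) Y X ∧
        ∀ j l, Tempered (𝓝[halfPlane θ] 0) (fun z => clmMatrix (X (aff p z)) j l) := by
    have hch : ∀ z ∈ Metric.ball (0 : ℂ) r₀, z ≠ 0 →
      (aff p z : OnePoint ℂ) ∈ V.baseSet i ∧ (aff p z : OnePoint ℂ) ∉ D.support :=
      fun z hz hz0 => ⟨(hch₀ z hz hz0).1, (hch₀ z hz hz0).2.1⟩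
    by_cases hpD : p ∈ D.support
    · exact ⟨r₀, hr₀, le_rfl, exists_regular_frame hreg hp hpD hr₀ hch⟩
    · exact exists_bounded_frame hp hpD hr₀ hch
  have hch : ∀ z ∈ Metric.ball (0 : ℂ) r, z ≠ 0 →
      (aff p z : OnePoint ℂ) ∈ V.baseSet i ∧ aff p z ∈ regularSet D Z :=
    fun z hz => hch₀ z (Metric.ball_subset_ball hrr hz)
  refine meromorphicAt_of_tempered ?_ (tempered_of_halfPlanes fun θ => ?_)
  · rw [eventually_nhdsWithin_iff]
    filter_upwards [Metric.ball_mem_nhds (0 : ℂ) hr] with z hz hz0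
    obtain ⟨h1, h2⟩ := hch z hz hz0
    exact DifferentiableAt.comp (g := rep V i ω) z ((h _ h2).analyticAt h2.1 h1).differentiableAt
      (analyticAt_aff p hz0).differentiableAt
  · obtain ⟨Y, X, hY, hXt⟩ := hframe θ
    have hU : aff p '' (halfPlane θ ∩ Metric.ball 0 r) ⊆ regularSet D Z := by
      rintro _ ⟨z, hz, rfl⟩
      exact (hch z hz.2 (ne_zero_of_mem_halfPlane hz.1)).2
    -- The periods against the frame are solutions of `ψ` on the half disc, hence bounded by the
    -- regularity of `ψ` at `p`.
    have hη : ∀ l, Tempered (𝓝[halfPlane θ] 0) (fun z => (ofRep (dualBundle V) i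
        (fun t => (ContinuousLinearMap.proj l : (Fin α → ℂ) →L[ℂ] ℂ).comp (Y t)) (aff p z))
          (ω (aff p z))) := by
      intro l
      rw [← tempered_iff_polynomialGrowth hr]
      have hpi := Real.pi_pos
      refine hψp r _ _ hr (by linarith) (by linarith) ?_ (fun t => (ofRep (dualBundle V) i
        (fun t => (ContinuousLinearMap.proj l : (Fin α → ℂ) →L[ℂ] ℂ).comp (Y t)) t) (ω t)) ?_
      · rw [sector_eq_halfPlane_inter_ball]
        exact hU
      · rw [sector_eq_halfPlane_inter_ball, isSolOn_iff hY.isOpen]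
        intro t ht
        exact (h t (hU ht)).solAt (hU ht).1 ⟨_, hY.isOpen, ht, hY.isFlatOn hV _⟩
    refine Tempered.pi (halfPlane_le θ) fun j => ?_
    refine (Tempered.sum (halfPlane_le θ) Finset.univ fun l _ => (hη l).mul (hXt j l)).congr ?_
    filter_upwards [inter_mem self_mem_nhdsWithin
      (nhdsWithin_le_nhds (Metric.ball_mem_nhds 0 hr))] with z hz
    rw [hY.rep_eq ω (mem_image_of_mem _ hz), apply_eq_sum_clmMatrix]

end RegularFrames

variable {ι : Type*} {α : ℕ} {V : VectorBundleCore ℂ (OnePoint ℂ) (Fin α → ℂ) ι}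
  {D : OnePoint ℂ →₀ ℕ} {hV : IsHolomorphic V} {conn : MeromorphicConnection V D}
  {ψ : LinearODE α} {ω : ℂ → (Fin α → ℂ)} {Z : Finset ℂ}

/-- A section with periods on the regular set can be redefined on `Z` so as to be holomorphic at the
apparent singularities. -/
lemma exists_holomorphic_modification (hψ : ∀ k, AnalyticOnNhd ℂ (ψ k) (regularSet D Z))
    (hZ : ∀ z ∈ Z, ψ.IsApparentAt (regularSet D Z) z)
    (h : ∀ t ∈ regularSet D Z, HasPeriods hV conn ψ ω t) :
    ∃ ω' : ℂ → (Fin α → ℂ), (∀ t ∈ regularSet D Z, HasPeriods hV conn ψ ω' t) ∧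
      ∀ i, ∀ t : ℂ, (t : OnePoint ℂ) ∈ V.baseSet i → (t : OnePoint ℂ) ∉ D.support →
        AnalyticAt ℂ (rep V i ω') t := by
  classical
  have hg : ∀ z : ℂ, ∃ g : ℂ → (Fin α → ℂ), z ∈ Z → (z : OnePoint ℂ) ∉ D.support →
      AnalyticAt ℂ g z ∧ rep V (V.indexAt (z : OnePoint ℂ)) ω =ᶠ[𝓝[≠] z] g := by
    intro z
    by_cases hz : z ∈ Z ∧ (z : OnePoint ℂ) ∉ D.support
    · obtain ⟨g, hg⟩ := exists_analytic_extension (fun t ht => ht.1) hψ h (hZ z hz.1) hz.2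
        (V.mem_baseSet_at (z : OnePoint ℂ))
      exact ⟨g, fun _ _ => hg⟩
    · exact ⟨0, fun h1 h2 => absurd ⟨h1, h2⟩ hz⟩
  choose g hg using hg
  -- At a point `t` of `Z` the old value carries no information. The extension `g t` is written in
  -- the preferred trivialization at `t`, where the coordinates at `t` are the fibre element itself,
  -- so `g t t` is the correct new value.
  let ω' : ℂ → (Fin α → ℂ) := fun t => if t ∈ regularSet D Z then ω t else g t t
  have hω : ∀ t ∈ regularSet D Z, ω t = ω' t := fun t ht => (if_pos ht).symm
  have hper : ∀ t ∈ regularSet D Z, HasPeriods hV conn ψ ω' t := fun t ht => by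
    refine (h t ht).congr ?_
    filter_upwards [(isOpen_regularSet D Z).mem_nhds ht] with u hu using hω u hu
  refine ⟨ω', hper, fun i t hi hD => ?_⟩
  by_cases ht : t ∈ Z
  · obtain ⟨hga, hge⟩ := hg t ht hD
    refine analyticAt_rep_change hV (V.mem_baseSet_at (t : OnePoint ℂ)) hi ?_
    refine hga.congr ?_
    have hreg : regularSet D Z ∈ 𝓝[≠] t := by
      obtain ⟨r, -, hr, hball, -⟩ := hZ t ht
      exact mem_of_superset (sdiff_mem_nhdsWithin_compl (Metric.ball_mem_nhds t hr) _) hball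
    have h1 : ∀ᶠ u in 𝓝[≠] t, g t u = rep V (V.indexAt (t : OnePoint ℂ)) ω' u := by
      filter_upwards [hge, hreg] with u h2 h3
      rw [← h2]
      simp only [rep, hω u h3]
    have h2 : g t t = rep V (V.indexAt (t : OnePoint ℂ)) ω' t := by
      rw [rep_indexAt]
      exact (if_neg fun h3 => h3.2 ht).symm
    filter_upwards [eventually_nhdsWithin_iff.1 h1] with u h3
    by_cases hu : u = t
    · rw [hu, h2]
    · exact h3 hu
  · exact (hper t ⟨hD, ht⟩).analyticAt hD hi

end P1Connection

open P1Connection in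
theorem proposition5 {ι : Type*} (α : ℕ)
    -- a holomorphic vector bundle of rank `α` on the Riemann sphere
    (V : VectorBundleCore ℂ (OnePoint ℂ) (Fin α → ℂ) ι) (hV : IsHolomorphic V)
    -- a meromorphic connection on it with pole divisor `D`, whose support is the set `C`
    (D : OnePoint ℂ →₀ ℕ) (conn : MeromorphicConnection V D)
    (hreg : (conn.dual hV).IsRegular)
    -- the equation `ψ`, holomorphic outside `C ∪ Z ∪ {∞}`
    (Z : Finset ℂ) (ψ : LinearODE α)
    (hψ : ∀ k, AnalyticOnNhd ℂ (ψ k) (regularSet D Z))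
    (hψreg : ∀ p : OnePoint ℂ,
      (p ∈ D.support ∨ (∃ z ∈ Z, p = (z : OnePoint ℂ)) ∨ p = OnePoint.infty) →
        ψ.IsRegularAt (regularSet D Z) p)
    (hZ : ∀ z ∈ Z, ψ.IsApparentAt (regularSet D Z) z)
    (hinf : ψ.IsPoleTypeAtInfty (regularSet D Z))
    (b : ℂ) (hb : b ∈ regularSet D Z)
    (hmon : SameMonodromy α (conn.dual hV).IsFlatOn ψ.IsSolOn (regularSet D Z) b) :
    ∃ ω : ℂ → (Fin α → ℂ), IsMeromorphicSection V D ω ∧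
      IsPicardFuchsOf hV conn (regularSet D Z) ψ ω := by
  obtain ⟨ω₀, hω₀⟩ := exists_section_of_sameMonodromy hV conn hb hmon
  obtain ⟨ω, hper, han⟩ := exists_holomorphic_modification hψ hZ hω₀
  refine ⟨ω, ⟨han, fun i p hp hpD => ?_⟩,
    isPicardFuchsOf_of_hasPeriods (fun t ht => ht.1) hψ hper⟩
  refine meromorphicAt_rep_aff hreg hper (hψreg p ?_) hp
  rcases hpD with hpD | hpD
  · exact Or.inl hpD
  · exact Or.inr (Or.inr hpD)
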